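/- A colored graph is a finite simple graph $G=(V,E)$ together with a tuple $\langle C_1,\dots,C_c\rangle$ of subsets of $V$ (colors). $\mathrm{MSO}_1$ formulas are built from the atomic formulas $x=y$, $E(x,y)$, $C_i(x)$ and $X(x)$ (that is, $x\in X$), for vertex variables $x,y$ and vertex-set variables $X$, by the connectives $\lnot,\land,\lor,\Rightarrow,\Leftrightarrow$ and by quantification over vertices and over sets of vertices; $|\phi|$ is the length of $\phi$. Let $\phi(X)$ be such a formula whose only free variable is the set variable $X$. A $\mathsf{TJ}(\phi)$-sequence of length $\ell$ from $S$ to $S'$ in $G$ is a sequence $S=S_0,S_1,\dots,S_\ell=S'$ of subsets of $V$ with $|S_{i-1}\setminus S_i|=|S_i\setminus S_{i-1}|=1$ for $1\le i\le \ell$ and $G\models\phi(S_i)$ for $0\le i\le \ell$. An instance of $\mathrm{MSO}_1$ Reconfiguration consists of $\phi(X)$, a colored graph $G$, and sets $S,S'\subseteq V$ with $|S|=|S'|$, $G\models\phi(S)$ and $G\models\phi(S')$; the question is whether there is a $\mathsf{TJ}(\phi)$-sequence from $S$ to $S'$. Two vertices $u,v$ are twins if $N(u)=N(v)$ or $N[u]=N[v]$;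 the neighborhood diversity $\mathrm{nd}(G)$ is the number of equivalence classes of the twin relation. Theorem 3.1. $\mathrm{MSO}_1$ Reconfiguration is fixed-parameter tractable with respect to the parameter $\mathrm{nd}(G)+|\phi|$: there are an algorithm, a computable function $f$ and a constant $d$ such that the algorithm decides every instance $I=\langle\phi,G,S,S'\rangle$ in at most $f(\mathrm{nd}(G)+|\phi|)\cdot|I|^{d}$ steps, where $|I|$ is the size of the encoding of $I$. Furthermore, there are an algorithm, a computable function $f$ and a constant $d$ such that the algorithm, given any yes-instance $I$, outputs a $\mathsf{TJ}(\phi)$-sequence from $S$ to $S'$ of minimum length within at most $f(\mathrm{nd}(G)+|\phi|)\cdot|I|^{d}$ steps. -/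

import Mathlib

/-! ### A programming language with a step count

The machine model is first-order call-by-value LISP over binary trees: the data are binary trees
with one kind of leaf, a program is a finite list of mutually recursive one-argument functions, and
every evaluation step (variable access, `nil`, `cons`, `hd`, `tl`, test for `nil`, `let`, function
call) costs one unit. A value is passed as a pointer to an immutable node, so that each unit
is a bounded number of operations of a pointer machine or RAM; running times in this model and on
multitape Turing machines are polynomially related. -/

/-- Binary trees, the data of programs. -/
inductive Tree2 : Type where
  | nil : Tree2
  | cons : Tree2 → Tree2 → Tree2

namespace Tree2

/-- The number of nodes of a tree (leaves included). -/
def size : Tree2 → ℕ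
  | nil => 1
  | cons a b => a.size + b.size + 1

/-- The left subtree (`nil` for a leaf). -/
def hd : Tree2 → Tree2
  | nil => nil
  | cons a _ => a

/-- The right subtree (`nil` for a leaf). -/
def tl : Tree2 → Tree2
  | nil => nil
  | cons _ b => b

/-- Truth values as trees. -/
def ofBool : Bool → Tree2
  | false => nil
  | true => cons nil nil

/-- Natural numbers as trees, in unary. -/
def ofNat : ℕ → Tree2
  | 0 => nil
  | k + 1 => cons nil (ofNat k)

/-- Lists of trees as trees. -/
def ofList : List Tree2 → Tree2
  | [] => nil
  | a :: l => cons a (ofList l)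

end Tree2

/-- Expressions. Variables are de Bruijn indices into the environment. -/
inductive Expr : Type where
  | var : ℕ → Expr
  | nil : Expr
  | cons : Expr → Expr → Expr
  | hd : Expr → Expr
  | tl : Expr → Expr
  /-- `ite c a b` is `b` if the value of `c` is `nil`, and `a` otherwise. -/
  | ite : Expr → Expr → Expr → Expr
  /-- `letIn e b` evaluates `b` with the value of `e` as the new variable `0`. -/
  | letIn : Expr → Expr → Expr
  /-- `call i e` applies the `i`-th function of the program to the value of `e`. -/
  | call : ℕ → Expr → Expr

/-- A program is the list of the bodies of its functions; variable `0` of a body is the argument.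
Function `0` is the main function. -/
abbrev Program := List Expr

/-- `Eval P ρ e y t`: in the program `P` and the environment `ρ`, the expression `e` evaluates to
the tree `y` in exactly `t` steps. A variable that is out of range has the value `nil`, and so
does a call of a function that does not exist. -/
inductive Eval (P : Program) : List Tree2 → Expr → Tree2 → ℕ → Prop where
  | var (ρ : List Tree2) (i : ℕ) : Eval P ρ (Expr.var i) (ρ.getD i Tree2.nil) 1
  | nil (ρ : List Tree2) : Eval P ρ Expr.nil Tree2.nil 1
  | cons {ρ : List Tree2} {e₁ e₂ : Expr} {y₁ y₂ : Tree2} {t₁ t₂ : ℕ} :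
      Eval P ρ e₁ y₁ t₁ → Eval P ρ e₂ y₂ t₂ →
        Eval P ρ (Expr.cons e₁ e₂) (Tree2.cons y₁ y₂) (t₁ + t₂ + 1)
  | hd {ρ : List Tree2} {e : Expr} {y : Tree2} {t : ℕ} :
      Eval P ρ e y t → Eval P ρ (Expr.hd e) y.hd (t + 1)
  | tl {ρ : List Tree2} {e : Expr} {y : Tree2} {t : ℕ} :
      Eval P ρ e y t → Eval P ρ (Expr.tl e) y.tl (t + 1)
  | iteTrue {ρ : List Tree2} {c a b : Expr} {y₁ y₂ y : Tree2} {t₁ t₂ : ℕ} :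
      Eval P ρ c (Tree2.cons y₁ y₂) t₁ → Eval P ρ a y t₂ →
        Eval P ρ (Expr.ite c a b) y (t₁ + t₂ + 1)
  | iteFalse {ρ : List Tree2} {c a b : Expr} {y : Tree2} {t₁ t₂ : ℕ} :
      Eval P ρ c Tree2.nil t₁ → Eval P ρ b y t₂ →
        Eval P ρ (Expr.ite c a b) y (t₁ + t₂ + 1)
  | letIn {ρ : List Tree2} {e b : Expr} {x y : Tree2} {t₁ t₂ : ℕ} :
      Eval P ρ e x t₁ → Eval P (x :: ρ) b y t₂ →
        Eval P ρ (Expr.letIn e b) y (t₁ + t₂ + 1)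
  | call {ρ : List Tree2} {i : ℕ} {e : Expr} {x y : Tree2} {t₁ t₂ : ℕ} :
      Eval P ρ e x t₁ → Eval P [x] (P.getD i Expr.nil) y t₂ →
        Eval P ρ (Expr.call i e) y (t₁ + t₂ + 1)

/-- Evaluation is deterministic: the value and the number of steps are determined. -/
theorem Eval.det {P : Program} {ρ : List Tree2} {e : Expr} {y : Tree2} {t : ℕ}
    (h : Eval P ρ e y t) : ∀ {y' : Tree2} {t' : ℕ}, Eval P ρ e y' t' → y = y' ∧ t = t' := by
  induction h with
  | var | nil => intro _ _ h'; cases h'; exact ⟨rfl, rfl⟩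
  | cons _ _ ih₁ ih₂ =>
    intro _ _ h'
    cases h' with
    | cons a b =>
      obtain ⟨rfl, rfl⟩ := ih₁ a
      obtain ⟨rfl, rfl⟩ := ih₂ b
      exact ⟨rfl, rfl⟩
  | hd _ ih =>
    intro _ _ h'
    cases h' with
    | hd a =>
      obtain ⟨rfl, rfl⟩ := ih a
      exact ⟨rfl, rfl⟩
  | tl _ ih =>
    intro _ _ h'
    cases h' with
    | tl a =>
      obtain ⟨rfl, rfl⟩ := ih a
      exact ⟨rfl, rfl⟩
  | iteTrue _ _ ih₁ ih₂ =>
    intro _ _ h'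
    cases h' with
    | iteTrue a b =>
      obtain ⟨-, rfl⟩ := ih₁ a
      obtain ⟨rfl, rfl⟩ := ih₂ b
      exact ⟨rfl, rfl⟩
    | iteFalse a b => cases (ih₁ a).1
  | iteFalse _ _ ih₁ ih₂ =>
    intro _ _ h'
    cases h' with
    | iteTrue a b => cases (ih₁ a).1
    | iteFalse a b =>
      obtain ⟨-, rfl⟩ := ih₁ a
      obtain ⟨rfl, rfl⟩ := ih₂ b
      exact ⟨rfl, rfl⟩
  | letIn _ _ ih₁ ih₂ =>
    intro _ _ h'
    cases h' with
    | letIn a b =>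
      obtain ⟨rfl, rfl⟩ := ih₁ a
      obtain ⟨rfl, rfl⟩ := ih₂ b
      exact ⟨rfl, rfl⟩
  | call _ _ ih₁ ih₂ =>
    intro _ _ h'
    cases h' with
    | call a b =>
      obtain ⟨rfl, rfl⟩ := ih₁ a
      obtain ⟨rfl, rfl⟩ := ih₂ b
      exact ⟨rfl, rfl⟩

/-- On input `x`, the program `P` halts with output `y` after exactly `t` steps. -/
def Program.RunsTo (P : Program) (x y : Tree2) (t : ℕ) : Prop :=
  Eval P [x] (P.getD 0 Expr.nil) y t

/-! ### Fixed-parameter tractability -/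

/-- A relation `sol` between instances and output trees is solvable in fixed-parameter time: one
program produces, on every instance `a` that satisfies `dom`, some output `y` with `sol a y` within
`f (κ a) * |a| ^ d` steps, where `κ` is the parameter, `|a|` is the size of the encoding of `a`,
`f` is a computable function and `d` is a constant. -/
def FPTSolvable {α : Type} (enc : α → Tree2) (κ : α → ℕ) (dom : α → Prop)
    (sol : α → Tree2 → Prop) : Prop :=
  ∃ (P : Program) (f : ℕ → ℕ) (d : ℕ), Computable f ∧
    ∀ a : α, dom a → ∃ (y : Tree2) (t : ℕ),
      P.RunsTo (enc a) y t ∧ t ≤ f (κ a) * (enc a).size ^ d ∧ sol a y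

open Classical in
/-- The decision problem with yes-instances `yes` is fixed-parameter tractable with respect to the
parameter `κ`. -/
def FPTDecidable {α : Type} (enc : α → Tree2) (κ : α → ℕ) (yes : α → Prop) : Prop :=
  FPTSolvable enc κ (fun _ => True) (fun a y => y = Tree2.ofBool (decide (yes a)))

/-! ### Colored graphs and neighborhood diversity -/

/-- A colored graph with vertex set `Fin n` and a tuple of `c` colors, each a set of vertices. -/
structure ColoredGraph (n c : ℕ) where
  graph : SimpleGraph (Fin n)
  color : Fin c → Finset (Fin n)

/-- Two vertices are twins if they have the same open or the same closed neighborhood. -/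
def Twins {V : Type} (G : SimpleGraph V) (u v : V) : Prop :=
  G.neighborSet u = G.neighborSet v ∨ insert u (G.neighborSet u) = insert v (G.neighborSet v)

theorem Twins.trans {V : Type} {G : SimpleGraph V} {u v w : V}
    (h₁ : Twins G u v) (h₂ : Twins G v w) : Twins G u w := by
  have key : ∀ {a b c : V}, G.neighborSet a = G.neighborSet b →
      insert b (G.neighborSet b) = insert c (G.neighborSet c) → a = b ∨ b = c := by
    intro a b c hab hbc
    simp only [Set.ext_iff, SimpleGraph.mem_neighborSet, Set.mem_insert_iff] at hab hbc
    have h1 := hab a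
    have h2 := hab c
    have h3 := hbc c
    have h4 := hbc a
    have h5 := G.adj_comm a c
    have h6 : ¬ G.Adj a a := G.irrefl
    grind
  rcases h₁ with h₁ | h₁ <;> rcases h₂ with h₂ | h₂
  · exact Or.inl (h₁.trans h₂)
  · rcases key h₁ h₂ with rfl | rfl
    · exact Or.inr h₂
    · exact Or.inl h₁
  · rcases key h₂.symm h₁.symm with rfl | rfl
    · exact Or.inr h₁
    · exact Or.inl h₂
  · exact Or.inr (h₁.trans h₂)

/-- Being twins is an equivalence relation; its classes are the maximal sets of twins. -/
def twinSetoid {V : Type} (G : SimpleGraph V) : Setoid V where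
  r := Twins G
  iseqv :=
    { refl := fun _ => Or.inl rfl
      symm := fun h => h.imp Eq.symm Eq.symm
      trans := Twins.trans }

/-- The neighborhood diversity of a graph: the number of maximal sets of twins. -/
noncomputable def neighborhoodDiversity {V : Type} (G : SimpleGraph V) : ℕ :=
  Nat.card (Quotient (twinSetoid G))

/-! ### Monadic second-order logic on colored graphs -/

/-- `MSO1 c v s`: formulas over graphs with `c` colors, with free vertex variables among
`0, …, v - 1` and free set variables among `0, …, s - 1`. A quantifier binds a new variable `0` of
its sort and shifts the other variables of this sort by one. -/
inductive MSO1 (c : ℕ) : ℕ → ℕ → Type where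
  | eq {v s : ℕ} : Fin v → Fin v → MSO1 c v s
  | adj {v s : ℕ} : Fin v → Fin v → MSO1 c v s
  | color {v s : ℕ} : Fin c → Fin v → MSO1 c v s
  | mem {v s : ℕ} : Fin s → Fin v → MSO1 c v s
  | not {v s : ℕ} : MSO1 c v s → MSO1 c v s
  | and {v s : ℕ} : MSO1 c v s → MSO1 c v s → MSO1 c v s
  | or {v s : ℕ} : MSO1 c v s → MSO1 c v s → MSO1 c v s
  | imp {v s : ℕ} : MSO1 c v s → MSO1 c v s → MSO1 c v s
  | iff {v s : ℕ} : MSO1 c v s → MSO1 c v s → MSO1 c v s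
  | allV {v s : ℕ} : MSO1 c (v + 1) s → MSO1 c v s
  | exV {v s : ℕ} : MSO1 c (v + 1) s → MSO1 c v s
  | allS {v s : ℕ} : MSO1 c v (s + 1) → MSO1 c v s
  | exS {v s : ℕ} : MSO1 c v (s + 1) → MSO1 c v s

namespace MSO1

/-- The length of a formula: the number of occurrences of relation symbols, variables, connectives
and quantifiers. -/
def length {c : ℕ} : {v s : ℕ} → MSO1 c v s → ℕ
  | _, _, eq _ _ => 3
  | _, _, adj _ _ => 3
  | _, _, color _ _ => 2
  | _, _, mem _ _ => 2
  | _, _, not φ => φ.length + 1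
  | _, _, and φ ψ => φ.length + ψ.length + 1
  | _, _, or φ ψ => φ.length + ψ.length + 1
  | _, _, imp φ ψ => φ.length + ψ.length + 1
  | _, _, iff φ ψ => φ.length + ψ.length + 1
  | _, _, allV φ => φ.length + 2
  | _, _, exV φ => φ.length + 2
  | _, _, allS φ => φ.length + 2
  | _, _, exS φ => φ.length + 2

/-- Truth of a formula in a colored graph under an assignment `x` of the free vertex variables and
an assignment `X` of the free set variables. -/
def Holds {n c : ℕ} (G : ColoredGraph n c) :
    {v s : ℕ} → MSO1 c v s → (Fin v → Fin n) → (Fin s → Finset (Fin n)) → Prop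
  | _, _, eq i j, x, _ => x i = x j
  | _, _, adj i j, x, _ => G.graph.Adj (x i) (x j)
  | _, _, color a i, x, _ => x i ∈ G.color a
  | _, _, mem j i, x, X => x i ∈ X j
  | _, _, not φ, x, X => ¬ φ.Holds G x X
  | _, _, and φ ψ, x, X => φ.Holds G x X ∧ ψ.Holds G x X
  | _, _, or φ ψ, x, X => φ.Holds G x X ∨ ψ.Holds G x X
  | _, _, imp φ ψ, x, X => φ.Holds G x X → ψ.Holds G x X
  | _, _, iff φ ψ, x, X => (φ.Holds G x X ↔ ψ.Holds G x X)
  | _, _, allV φ, x, X => ∀ u : Fin n, φ.Holds G (Fin.cons u x) X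
  | _, _, exV φ, x, X => ∃ u : Fin n, φ.Holds G (Fin.cons u x) X
  | _, _, allS φ, x, X => ∀ U : Finset (Fin n), φ.Holds G x (Fin.cons U X)
  | _, _, exS φ, x, X => ∃ U : Finset (Fin n), φ.Holds G x (Fin.cons U X)

/-- `G ⊨ φ(S)` for a formula `φ` whose only free variable is one set variable. -/
def Sat {n c : ℕ} (G : ColoredGraph n c) (φ : MSO1 c 0 1) (S : Finset (Fin n)) : Prop :=
  φ.Holds G Fin.elim0 (fun _ => S)

/-- Formulas as trees. -/
def encode {c : ℕ} : {v s : ℕ} → MSO1 c v s → Tree2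
  | _, _, eq i j => .ofList [.ofNat 0, .ofNat i, .ofNat j]
  | _, _, adj i j => .ofList [.ofNat 1, .ofNat i, .ofNat j]
  | _, _, color a i => .ofList [.ofNat 2, .ofNat a, .ofNat i]
  | _, _, mem j i => .ofList [.ofNat 3, .ofNat j, .ofNat i]
  | _, _, not φ => .ofList [.ofNat 4, φ.encode]
  | _, _, and φ ψ => .ofList [.ofNat 5, φ.encode, ψ.encode]
  | _, _, or φ ψ => .ofList [.ofNat 6, φ.encode, ψ.encode]
  | _, _, imp φ ψ => .ofList [.ofNat 7, φ.encode, ψ.encode]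
  | _, _, iff φ ψ => .ofList [.ofNat 8, φ.encode, ψ.encode]
  | _, _, allV φ => .ofList [.ofNat 9, φ.encode]
  | _, _, exV φ => .ofList [.ofNat 10, φ.encode]
  | _, _, allS φ => .ofList [.ofNat 11, φ.encode]
  | _, _, exS φ => .ofList [.ofNat 12, φ.encode]

end MSO1

/-! ### Token jumping and the reconfiguration problem -/

/-- One token jumps: `|R \ R'| = |R' \ R| = 1`. -/
def TJMove {n : ℕ} (R R' : Finset (Fin n)) : Prop :=
  (R \ R').card = 1 ∧ (R' \ R).card = 1

/-- The list `L = [S₀, …, S_ℓ]` is a `TJ(φ)`-sequence from `S` to `S'`; its length as a sequence of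
moves is `ℓ = L.length - 1`. -/
def IsTJSequence {n c : ℕ} (G : ColoredGraph n c) (φ : MSO1 c 0 1) (S S' : Finset (Fin n))
    (L : List (Finset (Fin n))) : Prop :=
  L.head? = some S ∧ L.getLast? = some S' ∧ L.IsChain TJMove ∧ ∀ R ∈ L, φ.Sat G R

/-- A `TJ(φ)`-sequence from `S` to `S'` of minimum length. -/
def IsShortestTJSequence {n c : ℕ} (G : ColoredGraph n c) (φ : MSO1 c 0 1)
    (S S' : Finset (Fin n)) (L : List (Finset (Fin n))) : Prop :=
  IsTJSequence G φ S S' L ∧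
    ∀ L' : List (Finset (Fin n)), IsTJSequence G φ S S' L' → L.length ≤ L'.length

/-- The data of an instance of `MSO1` reconfiguration. -/
structure MSO1RInstance where
  /-- number of vertices -/
  n : ℕ
  /-- number of colors -/
  c : ℕ
  φ : MSO1 c 0 1
  G : ColoredGraph n c
  S : Finset (Fin n)
  S' : Finset (Fin n)

/-- A set of vertices as a tree: the list of its `n` membership bits. -/
def encodeSet {n : ℕ} (S : Finset (Fin n)) : Tree2 :=
  .ofList (List.ofFn fun i : Fin n => .ofBool (decide (i ∈ S)))

/-- A sequence of sets of vertices as a tree. -/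
def encodeSeq {n : ℕ} (L : List (Finset (Fin n))) : Tree2 :=
  .ofList (L.map encodeSet)

open Classical in
/-- A graph as a tree: the list of the rows of its adjacency matrix. -/
noncomputable def encodeGraph {n : ℕ} (G : SimpleGraph (Fin n)) : Tree2 :=
  .ofList (List.ofFn fun i : Fin n =>
    .ofList (List.ofFn fun j : Fin n => .ofBool (decide (G.Adj i j))))

namespace MSO1RInstance

/-- Instances as trees: the formula, the graph, the list of the colors, and the two sets. -/
noncomputable def encode (I : MSO1RInstance) : Tree2 :=
  .ofList [I.φ.encode, encodeGraph I.G.graph,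
    .ofList (List.ofFn fun a : Fin I.c => encodeSet (I.G.color a)),
    encodeSet I.S, encodeSet I.S']

/-- The parameter `nd(G) + |φ|`. -/
noncomputable def param (I : MSO1RInstance) : ℕ :=
  neighborhoodDiversity I.G.graph + I.φ.length

/-- The conditions that the problem puts on its input. -/
def Valid (I : MSO1RInstance) : Prop :=
  I.S.card = I.S'.card ∧ I.φ.Sat I.G I.S ∧ I.φ.Sat I.G I.S'

/-- Yes-instances: valid inputs with a `TJ(φ)`-sequence from `S` to `S'`. -/
def IsYes (I : MSO1RInstance) : Prop :=
  I.Valid ∧ ∃ L : List (Finset (Fin I.n)), IsTJSequence I.G I.φ I.S I.S' L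

/-- The tree `y` is (the encoding of) a shortest `TJ(φ)`-sequence from `S` to `S'`. -/
def IsShortestSolution (I : MSO1RInstance) (y : Tree2) : Prop :=
  ∃ L : List (Finset (Fin I.n)), IsShortestTJSequence I.G I.φ I.S I.S' L ∧ y = encodeSeq L

end MSO1RInstance

/-! Call two vertices equivalent if they are twins and lie in the same sets among `S`, `S'` and the
colors that occur in the formula. With `p` classes, `p` is at most `nd(G) * 2 ^ (|φ| + 2)`. Vertices
of one class are interchangeable, so a set matters only through the vector of its class sizes. By an
Ehrenfeucht-Fraïssé argument (`MSO1.holdsOn_congr`) a formula with `q` nodes sees each coordinate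
only up to the threshold `θ = 2 ^ q`, counted from `0` and from the class size `m i`. Hence the set
`A` of the vectors of models is closed under `SameShape`.

A token jump moves one unit between two coordinates or leaves the vector unchanged. Conversely, a
unit move lifts to a jump between canonical sets, which consist of the first elements of each class.
As `S` and `S'` are unions of classes, they are canonical and their vectors are corners of the box
given by `m`. The problem becomes that of a shortest walk of unit moves in `A` between two corners.

The box has too many points for a search, so most coordinates have to be confined to few values. A
walk is first compressed to a chain with at most `2 * (2 * θ + 1) ^ p` vectors, whose links are unit
moves or pairs of the same shape (`ShapeChain.exists_short`). A link of the latter kind stands for a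
straight walk, which stays in `A`; the sum norm of the chain is twice the number of moves. Among the
shortest chains with this number of vectors, one with the largest sum of squares is chosen. If a
small integer perturbation `δ` respects the constant sum, the ends, the coordinates close to a bound
and the small differences of neighbors, then both signs of `δ` give chains whose lengths average to
the minimum, so both are shortest, and by strict convexity of the sum of squares `δ = 0`. Therefore
the linear system of these constraints has no small kernel vector, hence trivial kernel, and by
Cramer's rule every coordinate of the chain is a combination of `1` and the `m i` whose coefficients
and denominator are bounded in the parameter (`ShapeChain.exists_isRatCombo`). If a straight walk
finishes one coordinate before it starts another, all but two coordinates of each vector on it are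
of this form (`Walk.exists_restricted`).

So it suffices to search among the vectors with at most two arbitrary coordinates. Their number is a
function of the parameter times a polynomial. Membership in `A` is tested by brute force on a core
with at most `θ` vertices of each class inside and `θ` outside of the canonical set.

The running time is handled by a calculus: programs can be linked, `PT μ f` says that time and
output size of `f` are polynomial in a measure `μ`, and a recursion principle is the only source of
loops. Measures that are bounded by a primitive recursive function of the parameter times a
polynomial of the input size give fixed-parameter time. -/

/-! ### Linking programs -/

/-- Renaming of the functions that an expression calls. -/
def Expr.reloc (r : ℕ → ℕ) : Expr → Expr
  | .var i => .var i
  | .nil => .nil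
  | .cons a b => .cons (a.reloc r) (b.reloc r)
  | .hd a => .hd (a.reloc r)
  | .tl a => .tl (a.reloc r)
  | .ite a b c => .ite (a.reloc r) (b.reloc r) (c.reloc r)
  | .letIn a b => .letIn (a.reloc r) (b.reloc r)
  | .call i a => .call (r i) (a.reloc r)

/-- The hypothesis ranges over all `i`, also beyond the end of `P`: a call of a missing function
must again find the body `nil`. -/
theorem Eval.reloc {P Q : Program} {r : ℕ → ℕ}
    (h : ∀ i, Q.getD (r i) .nil = (P.getD i .nil).reloc r) {ρ : List Tree2} {e : Expr} {y : Tree2}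
    {t : ℕ} (he : Eval P ρ e y t) : Eval Q ρ (e.reloc r) y t := by
  induction he with
  | var ρ i => exact .var ρ i
  | nil ρ => exact .nil ρ
  | cons _ _ ih₁ ih₂ => exact .cons ih₁ ih₂
  | hd _ ih => exact .hd ih
  | tl _ ih => exact .tl ih
  | iteTrue _ _ ih₁ ih₂ => exact .iteTrue ih₁ ih₂
  | iteFalse _ _ ih₁ ih₂ => exact .iteFalse ih₁ ih₂
  | letIn _ _ ih₁ ih₂ => exact .letIn ih₁ ih₂
  | call _ _ ih₁ ih₂ => exact .call ih₁ (by rw [h]; exact ih₂)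

/-- Two programs can be linked behind a header that may call both. -/
theorem exists_link (P₁ P₂ : Program) (h : ℕ) (H : ℕ → ℕ → Program)
    (hH : ∀ a b, (H a b).length = h) :
    ∃ (Q : Program) (a b : ℕ), (∀ i < h, Q.getD i .nil = (H a b).getD i .nil) ∧
      (∀ x y t, P₁.RunsTo x y t → Eval Q [x] (Q.getD a .nil) y t) ∧
      (∀ x y t, P₂.RunsTo x y t → Eval Q [x] (Q.getD b .nil) y t) := by
  -- Position `N` lies just behind the end of `Q`; calls of missing functions are sent there.
  let N := h + P₁.length + P₂.length
  let r₁ : ℕ → ℕ := fun i => if i < P₁.length then h + i else N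
  let r₂ : ℕ → ℕ := fun i => if i < P₂.length then h + P₁.length + i else N
  let Q : Program := H (r₁ 0) (r₂ 0) ++ (P₁.map (Expr.reloc r₁) ++ P₂.map (Expr.reloc r₂))
  have hlen : Q.length = N := by simp [Q, N, hH]; omega
  have e₁ : ∀ i, Q.getD (r₁ i) .nil = (P₁.getD i .nil).reloc r₁ := by
    intro i
    by_cases hi : i < P₁.length
    · simp only [r₁, if_pos hi, Q]
      rw [List.getD_append_right _ _ _ _ (by rw [hH]; omega), hH, Nat.add_sub_cancel_left,
        List.getD_append _ _ _ _ (by simpa using hi)]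
      simp [List.getD_eq_getElem?_getD, hi]
    · rw [List.getD_eq_default P₁ _ (by omega)]
      simp only [r₁, if_neg hi]
      rw [List.getD_eq_default _ _ (by omega)]
      rfl
  have e₂ : ∀ i, Q.getD (r₂ i) .nil = (P₂.getD i .nil).reloc r₂ := by
    intro i
    by_cases hi : i < P₂.length
    · simp only [r₂, if_pos hi, Q]
      rw [List.getD_append_right _ _ _ _ (by rw [hH]; omega), hH,
        List.getD_append_right _ _ _ _ (by simp; omega)]
      have : h + P₁.length + i - h - (P₁.map (Expr.reloc r₁)).length = i := by simp; omega
      rw [this]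
      simp [List.getD_eq_getElem?_getD, hi]
    · rw [List.getD_eq_default P₂ _ (by omega)]
      simp only [r₂, if_neg hi]
      rw [List.getD_eq_default _ _ (by omega)]
      rfl
  refine ⟨Q, r₁ 0, r₂ 0, ?_, ?_, ?_⟩
  · intro i hi
    exact List.getD_append _ _ _ _ (by rw [hH]; exact hi)
  · intro x y t ht
    rw [e₁]
    exact Eval.reloc e₁ ht
  · intro x y t ht
    rw [e₂]
    exact Eval.reloc e₂ ht

/-- The program `P` maps `x` to `y` in at most `T` steps. -/
def Program.RunsIn (P : Program) (x y : Tree2) (T : ℕ) : Prop := ∃ t ≤ T, P.RunsTo x y t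

theorem Program.RunsIn.mono {P : Program} {x y : Tree2} {T T' : ℕ} (h : P.RunsIn x y T)
    (hT : T ≤ T') : P.RunsIn x y T' := by
  obtain ⟨t, ht, h⟩ := h
  exact ⟨t, ht.trans hT, h⟩

/-! ### Combinators for programs -/

namespace Program

theorem exists_id : ∃ P : Program, ∀ x, P.RunsIn x x 1 :=
  ⟨[.var 0], fun x => ⟨1, le_rfl, Eval.var [x] 0⟩⟩

theorem exists_hd : ∃ P : Program, ∀ x, P.RunsIn x x.hd 2 :=
  ⟨[.hd (.var 0)], fun x => ⟨2, le_rfl, Eval.hd (Eval.var [x] 0)⟩⟩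

theorem exists_tl : ∃ P : Program, ∀ x, P.RunsIn x x.tl 2 :=
  ⟨[.tl (.var 0)], fun x => ⟨2, le_rfl, Eval.tl (Eval.var [x] 0)⟩⟩

theorem exists_const (y : Tree2) : ∃ (P : Program) (c : ℕ), ∀ x, P.RunsIn x y c := by
  have key : ∀ y : Tree2, ∃ (e : Expr) (c : ℕ), ∀ (P : Program) (ρ : List Tree2), Eval P ρ e y c := by
    intro y
    induction y with
    | nil => exact ⟨.nil, 1, fun P ρ => .nil ρ⟩
    | cons a b iha ihb =>
      obtain ⟨e, c, h⟩ := iha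
      obtain ⟨e', c', h'⟩ := ihb
      exact ⟨.cons e e', c + c' + 1, fun P ρ => .cons (h P ρ) (h' P ρ)⟩
  obtain ⟨e, c, h⟩ := key y
  exact ⟨[e], c, fun x => ⟨c, le_rfl, h _ _⟩⟩

theorem exists_comp (P₁ P₂ : Program) : ∃ Q : Program, ∀ x y z T U,
    P₁.RunsIn x y T → P₂.RunsIn y z U → Q.RunsIn x z (T + U + 3) := by
  obtain ⟨Q, a, b, h, h₁, h₂⟩ := exists_link P₁ P₂ 1
    (fun a b => [.call b (.call a (.var 0))]) (fun _ _ => rfl)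
  refine ⟨Q, ?_⟩
  rintro x y z T U ⟨t, ht, h⟩ ⟨u, hu, h'⟩
  refine ⟨1 + t + 1 + u + 1, by omega, ?_⟩
  have h0 := ‹∀ i < 1, _› 0 (by omega)
  unfold Program.RunsTo
  rw [h0]
  exact .call (.call (.var _ 0) (h₁ _ _ _ h)) (h₂ _ _ _ h')

theorem exists_pair (P₁ P₂ : Program) : ∃ Q : Program, ∀ x y z T U,
    P₁.RunsIn x y T → P₂.RunsIn x z U → Q.RunsIn x (.cons y z) (T + U + 5) := by
  obtain ⟨Q, a, b, h, h₁, h₂⟩ := exists_link P₁ P₂ 1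
    (fun a b => [.cons (.call a (.var 0)) (.call b (.var 0))]) (fun _ _ => rfl)
  refine ⟨Q, ?_⟩
  rintro x y z T U ⟨t, ht, h⟩ ⟨u, hu, h'⟩
  refine ⟨(1 + t + 1) + (1 + u + 1) + 1, by omega, ?_⟩
  have h0 := ‹∀ i < 1, _› 0 (by omega)
  unfold Program.RunsTo
  rw [h0]
  exact .cons (.call (.var _ 0) (h₁ _ _ _ h)) (.call (.var _ 0) (h₂ _ _ _ h'))

/-- On `cons c x`, run the first program on `x` if `c` is not `nil`, and else the second. -/
theorem exists_branch (P₁ P₂ : Program) : ∃ Q : Program, ∀ x y T,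
    (∀ a b, P₁.RunsIn x y T → Q.RunsIn (.cons (.cons a b) x) y (T + 6)) ∧
    (P₂.RunsIn x y T → Q.RunsIn (.cons .nil x) y (T + 6)) := by
  obtain ⟨Q, a, b, h, h₁, h₂⟩ := exists_link P₁ P₂ 1
    (fun a b => [.ite (.hd (.var 0)) (.call a (.tl (.var 0))) (.call b (.tl (.var 0)))])
    (fun _ _ => rfl)
  have h0 := ‹∀ i < 1, _› 0 (by omega)
  refine ⟨Q, fun x y T => ⟨?_, ?_⟩⟩
  · rintro c d ⟨t, ht, h⟩
    refine ⟨(1 + 1) + (1 + 1 + t + 1) + 1, by omega, ?_⟩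
    unfold Program.RunsTo
    rw [h0]
    exact .iteTrue (.hd (.var [Tree2.cons (.cons c d) x] 0))
      (.call (.tl (.var [Tree2.cons (.cons c d) x] 0)) (h₁ _ _ _ h))
  · rintro ⟨t, ht, h⟩
    refine ⟨(1 + 1) + (1 + 1 + t + 1) + 1, by omega, ?_⟩
    unfold Program.RunsTo
    rw [h0]
    exact .iteFalse (.hd (.var [Tree2.cons .nil x] 0))
      (.call (.tl (.var [Tree2.cons .nil x] 0)) (h₂ _ _ _ h))

/-- Recursion: if `P₁` computes the list of the arguments of the recursive calls and `P₂` combines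
the argument with the list of their results, then there is a program for the recursive function.
Here `ι` is a type of arguments, encoded by `e`, and `N` bounds the number of calls. -/
theorem exists_rec {ι : Type} (P₁ P₂ : Program) : ∃ Q : Program,
    ∀ (e : ι → Tree2) (ch : ι → List ι) (F : ι → Tree2) (N : ι → ℕ) (T : ι → ℕ),
      (∀ i, 1 + ((ch i).map N).sum ≤ N i) →
      (∀ i, ∀ j ∈ ch i, T j ≤ T i) →
      (∀ i, P₁.RunsIn (e i) (.ofList ((ch i).map e)) (T i)) →
      (∀ i, P₂.RunsIn (.cons (e i) (.ofList ((ch i).map F))) (F i) (T i)) →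
      ∀ i, Q.RunsIn (e i) (F i) (N i * (2 * T i + 20)) := by
  -- Function `0` is the recursive function, function `1` applies it to every entry of a list.
  obtain ⟨Q, a, b, h, h₁, h₂⟩ := exists_link P₁ P₂ 2
    (fun a b => [.call b (.cons (.var 0) (.call 1 (.call a (.var 0)))),
      .ite (.var 0) (.cons (.call 0 (.hd (.var 0))) (.call 1 (.tl (.var 0)))) .nil])
    (fun _ _ => rfl)
  refine ⟨Q, fun e ch F N T hN hT hch hcomb => ?_⟩
  have h0 := h 0 (by omega)
  have h1 := h 1 (by omega)
  clear h
  -- The spare `9` is the cost of processing the list cell from which the call is made.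
  suffices ∀ n i, N i ≤ n →
      ∃ t, t + 9 ≤ N i * (2 * T i + 20) ∧ Q.RunsTo (e i) (F i) t by
    intro i
    obtain ⟨t, ht, h⟩ := this _ i le_rfl
    exact ⟨t, by omega, h⟩
  intro n
  induction n with
  | zero => intro i hi; have := hN i; omega
  | succ n ih =>
    intro i hi
    obtain ⟨t, ht, hch⟩ := hch i
    obtain ⟨u, hu, hcomb⟩ := hcomb i
    have hlist : ∀ l : List ι, (∀ j ∈ l, j ∈ ch i) → (l.map N).sum ≤ n →
        ∃ v ≤ (l.map N).sum * (2 * T i + 20) + 3,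
          Eval Q [.ofList (l.map e)] (Q.getD 1 .nil) (.ofList (l.map F)) v := by
      intro l
      induction l with
      | nil =>
        intro _ _
        refine ⟨1 + 1 + 1, by simp, ?_⟩
        rw [h1]
        exact .iteFalse (.var [Tree2.nil] 0) (.nil _)
      | cons j l ihl =>
        intro hl hs
        simp only [List.map_cons, List.sum_cons] at hs
        obtain ⟨v, hv, hl'⟩ := ihl (fun k hk => hl k (by simp [hk])) (by omega)
        obtain ⟨w, hw, hj⟩ := ih j (by omega)
        have hTj := hT i j (hl j (by simp))
        have hmul : N j * (2 * T j + 20) ≤ N j * (2 * T i + 20) := by gcongr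
        refine ⟨1 + ((1 + 1 + w + 1) + (1 + 1 + v + 1) + 1) + 1, ?_, ?_⟩
        · simp only [List.map_cons, List.sum_cons, add_mul]
          omega
        · rw [h1]
          refine .iteTrue (y₁ := e j) (y₂ := .ofList (l.map e))
            (.var [Tree2.ofList ((j :: l).map e)] 0) (.cons ?_ ?_)
          · exact .call (.hd (.var [Tree2.ofList ((j :: l).map e)] 0)) hj
          · exact .call (.tl (.var [Tree2.ofList ((j :: l).map e)] 0)) hl'
    have hNi := hN i
    obtain ⟨v, hv, hl⟩ := hlist (ch i) (fun _ h => h) (by omega)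
    refine ⟨(1 + (1 + t + 1 + v + 1) + 1) + u + 1, ?_, ?_⟩
    · have : (1 + ((ch i).map N).sum) * (2 * T i + 20) ≤ N i * (2 * T i + 20) := by gcongr
      rw [add_mul] at this
      omega
    · unfold Program.RunsTo
      rw [h0]
      exact .call (.cons (.var [e i] 0) (.call (.call (.var [e i] 0) (h₁ _ _ _ hch)) hl))
        (h₂ _ _ _ hcomb)

end Program

/-! ### Polynomial domination -/

/-- `f` is bounded by a polynomial in `g`. -/
def PolyLE {ι : Type} (f g : ι → ℕ) : Prop := ∃ d, ∀ i, f i ≤ (g i + 2) ^ d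

namespace PolyLE

variable {ι : Type} {f f' g h : ι → ℕ}

theorem refl (f : ι → ℕ) : PolyLE f f := ⟨1, fun i => by simp⟩

theorem mono (hf : PolyLE f g) (h : ∀ i, f' i ≤ f i) : PolyLE f' g :=
  hf.imp fun _ hd i => (h i).trans (hd i)

theorem of_le (h : ∀ i, f i ≤ g i) : PolyLE f g := (refl g).mono h

/-- Here it matters that the base `g i + 2` is at least `2`: its powers exceed every constant. -/
theorem const (c : ℕ) : PolyLE (fun _ => c) g :=
  ⟨c, fun i => (Nat.lt_pow_self (by omega : 1 < g i + 2)).le⟩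

theorem mul (hf : PolyLE f g) (hf' : PolyLE f' g) : PolyLE (fun i => f i * f' i) g := by
  obtain ⟨a, ha⟩ := hf
  obtain ⟨b, hb⟩ := hf'
  exact ⟨a + b, fun i => by rw [pow_add]; exact Nat.mul_le_mul (ha i) (hb i)⟩

theorem add (hf : PolyLE f g) (hf' : PolyLE f' g) : PolyLE (fun i => f i + f' i) g := by
  obtain ⟨a, ha⟩ := hf
  obtain ⟨b, hb⟩ := hf'
  refine ⟨a + b + 1, fun i => ?_⟩
  have h1 : (g i + 2) ^ a ≤ (g i + 2) ^ (a + b) := Nat.pow_le_pow_right (by omega) (by omega)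
  have h2 : (g i + 2) ^ b ≤ (g i + 2) ^ (a + b) := Nat.pow_le_pow_right (by omega) (by omega)
  have := ha i
  have := hb i
  rw [pow_succ]
  nlinarith

theorem pow (hf : PolyLE f g) (k : ℕ) : PolyLE (fun i => f i ^ k) g := by
  obtain ⟨a, ha⟩ := hf
  exact ⟨a * k, fun i => by rw [pow_mul]; exact Nat.pow_le_pow_left (ha i) k⟩

theorem trans (hf : PolyLE f g) (hg : PolyLE g h) : PolyLE f h := by
  obtain ⟨a, ha⟩ := hf
  have h2 : PolyLE (fun i => (g i + 2) ^ a) h := (hg.add (const 2)).pow a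
  exact h2.mono ha

theorem comp {κ : Type} (hf : PolyLE f g) (u : κ → ι) :
    PolyLE (fun i => f (u i)) (fun i => g (u i)) :=
  hf.imp fun _ hd i => hd (u i)

end PolyLE

/-! ### Encodings -/

/-- Types whose elements are represented by trees. -/
class Enc (α : Type) where
  enc : α → Tree2

open Enc (enc)

instance : Enc Tree2 := ⟨id⟩
instance : Enc Unit := ⟨fun _ => .nil⟩
instance : Enc Bool := ⟨Tree2.ofBool⟩
instance : Enc ℕ := ⟨Tree2.ofNat⟩
instance {α β : Type} [Enc α] [Enc β] : Enc (α × β) := ⟨fun z => .cons (enc z.1) (enc z.2)⟩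
instance {α : Type} [Enc α] : Enc (List α) := ⟨fun l => .ofList (l.map enc)⟩

/-- The size of the representation. -/
def sz {α : Type} [Enc α] (a : α) : ℕ := (enc a).size

/-! ### Sizes of encoded data -/

section Size

variable {α β : Type} [Enc α] [Enc β]

theorem Tree2.size_pos (t : Tree2) : 1 ≤ t.size := by cases t <;> simp [Tree2.size]

theorem sz_pos (a : α) : 1 ≤ sz a := Tree2.size_pos _

theorem sz_pair (a : α) (b : β) : sz (a, b) = sz a + sz b + 1 := rfl

theorem sz_prod (z : α × β) : sz z = sz z.1 + sz z.2 + 1 := rfl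

theorem sz_nil : sz ([] : List α) = 1 := rfl

theorem sz_cons (a : α) (l : List α) : sz (a :: l) = sz a + sz l + 1 := rfl

theorem sz_nat (n : ℕ) : sz n = 2 * n + 1 := by
  induction n with
  | zero => rfl
  | succ n ih =>
    have : sz (n + 1) = 1 + sz n + 1 := rfl
    omega

theorem sz_bool (b : Bool) : sz b ≤ 3 := by cases b <;> simp [sz, enc, Tree2.ofBool, Tree2.size]

theorem sz_append (l l' : List α) : sz (l ++ l') + 1 = sz l + sz l' := by
  induction l with
  | nil => simp [sz_nil]; omega
  | cons a l ih => simp only [List.cons_append, sz_cons]; omega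

theorem length_lt_sz (l : List α) : l.length < sz l := by
  induction l with
  | nil => simp [sz_nil]
  | cons a l ih => simp only [List.length_cons, sz_cons]; have := sz_pos a; omega

theorem sz_mem {a : α} {l : List α} (h : a ∈ l) : sz a < sz l := by
  induction l with
  | nil => simp at h
  | cons b l ih =>
    rw [sz_cons]
    rcases List.mem_cons.1 h with rfl | h
    · omega
    · have := ih h; omega

theorem sz_list_le {l : List α} {k : ℕ} (h : ∀ a ∈ l, sz a ≤ k) : sz l ≤ l.length * (k + 1) + 1 := by
  induction l with
  | nil => simp [sz_nil]
  | cons a l ih =>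
    have h1 := ih fun b hb => h b (by simp [hb])
    have h2 := h a (by simp)
    rw [sz_cons, List.length_cons, Nat.succ_mul]
    omega

theorem sz_sublist {l l' : List α} (h : l.Sublist l') : sz l ≤ sz l' := by
  induction h with
  | slnil => exact le_rfl
  | cons a _ ih => rw [sz_cons]; omega
  | cons_cons a _ ih => rw [sz_cons, sz_cons]; omega

end Size

/-! ### Functions computed within a polynomial of a measure -/

/-- `f` is computed by a program whose running time, and whose output size, are polynomial in the
measure `μ` of the input. -/
def PT {α β : Type} [Enc α] [Enc β] (μ : α → ℕ) (f : α → β) : Prop :=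
  ∃ (P : Program) (d : ℕ), ∀ a, P.RunsIn (enc a) (enc (f a)) ((μ a + 2) ^ d) ∧
    sz (f a) ≤ (μ a + 2) ^ d

/-- Polynomial time functions. -/
@[fun_prop]
def PolyTime {α β : Type} [Enc α] [Enc β] (f : α → β) : Prop := PT sz f

section Calculus

variable {α β γ δ : Type} [Enc α] [Enc β] [Enc γ] [Enc δ] {μ : α → ℕ}

theorem PT.intro {f : α → β} {P : Program} {T : α → ℕ}
    (h : ∀ a, P.RunsIn (enc a) (enc (f a)) (T a)) (hT : PolyLE T μ)
    (hf : PolyLE (fun a => sz (f a)) μ) : PT μ f := by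
  obtain ⟨d, hd⟩ := hT.add hf
  exact ⟨P, d, fun a => ⟨(h a).mono ((Nat.le_add_right _ _).trans (hd a)),
    (Nat.le_add_left _ _).trans (hd a)⟩⟩

theorem PT.elim {f : α → β} (hf : PT μ f) : ∃ (P : Program) (T : α → ℕ), PolyLE T μ ∧
    PolyLE (fun a => sz (f a)) μ ∧ ∀ a, P.RunsIn (enc a) (enc (f a)) (T a) := by
  obtain ⟨P, d, h⟩ := hf
  exact ⟨P, _, ⟨d, fun a => le_rfl⟩, ⟨d, fun a => (h a).2⟩, fun a => (h a).1⟩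

theorem PT.size {f : α → β} (hf : PT μ f) : PolyLE (fun a => sz (f a)) μ :=
  let ⟨_, _, _, h, _⟩ := hf.elim
  h

theorem PT.mono {f : α → β} {μ' : α → ℕ} (hf : PT μ f) (h : PolyLE μ μ') : PT μ' f := by
  obtain ⟨P, T, hT, hs, hP⟩ := hf.elim
  exact .intro hP (hT.trans h) (hs.trans h)

/-- Programs see trees only, so a function may be replaced by one with values in another type that
has the same trees. Many operations below are obtained in this way. -/
theorem PT.congr_enc {γ : Type} [Enc γ] {f : α → β} {g : α → γ} (hf : PT μ f)
    (h : ∀ a, enc (g a) = enc (f a)) : PT μ g := by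
  obtain ⟨P, d, hP⟩ := hf
  refine ⟨P, d, fun a => ?_⟩
  have : sz (g a) = sz (f a) := by unfold sz; rw [h]
  rw [h, this]
  exact hP a

theorem PT.comp {ν : β → ℕ} {g : β → γ} {f : α → β} (hg : PT ν g) (hf : PT μ f)
    (h : PolyLE (fun a => ν (f a)) μ) : PT μ (fun a => g (f a)) := by
  obtain ⟨P, T, hT, hs, hP⟩ := hf.elim
  obtain ⟨P', T', hT', hs', hP'⟩ := hg.elim
  obtain ⟨Q, hQ⟩ := Program.exists_comp P P'
  exact .intro (fun a => hQ _ _ _ _ _ (hP a) (hP' (f a)))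
    ((hT.add ((hT'.comp f).trans h)).add (.const 3)) ((hs'.comp f).trans h)

theorem PT.pair {f : α → β} {g : α → γ} (hf : PT μ f) (hg : PT μ g) :
    PT μ (fun a => (f a, g a)) := by
  obtain ⟨P, T, hT, hs, hP⟩ := hf.elim
  obtain ⟨P', T', hT', hs', hP'⟩ := hg.elim
  obtain ⟨Q, hQ⟩ := Program.exists_pair P P'
  exact .intro (fun a => hQ _ _ _ _ _ (hP a) (hP' a)) ((hT.add hT').add (.const 5))
    ((hs.add hs').add (.const 1))

theorem PolyTime.pt {f : α → β} (hf : PolyTime f) (h : PolyLE sz μ) : PT μ f :=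
  PT.mono hf h

theorem PolyTime.comp_pt {g : β → γ} {f : α → β} (hg : PolyTime g) (hf : PT μ f) :
    PT μ (fun a => g (f a)) :=
  PT.comp hg hf hf.size

/-- A function that does not change the representation. -/
theorem PolyTime.cast {f : α → β} (h : ∀ a, enc (f a) = enc a) : PolyTime f := by
  obtain ⟨P, hP⟩ := Program.exists_id
  refine PT.intro (P := P) (T := fun _ => 1) (fun a => by rw [h]; exact hP _) (.const 1)
    (.of_le fun a => ?_)
  unfold sz
  rw [h]

@[fun_prop]
theorem PolyTime.id : PolyTime (fun a : α => a) := .cast fun _ => rfl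

@[fun_prop]
theorem PolyTime.const (b : β) : PolyTime (fun _ : α => b) := by
  obtain ⟨P, c, hP⟩ := Program.exists_const (enc b)
  exact PT.intro (fun _ => hP _) (.const c) (.const (sz b))

@[fun_prop]
theorem PolyTime.comp {g : β → γ} {f : α → β} (hg : PolyTime g) (hf : PolyTime f) :
    PolyTime (fun a => g (f a)) := hg.comp_pt hf

@[fun_prop]
theorem PolyTime.pair {f : α → β} {g : α → γ} (hf : PolyTime f) (hg : PolyTime g) :
    PolyTime (fun a => (f a, g a)) := PT.pair hf hg

@[fun_prop]
theorem PolyTime.fst {f : α → β × γ} (hf : PolyTime f) : PolyTime (fun a => (f a).1) := by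
  have : PolyTime (fun z : β × γ => z.1) := by
    obtain ⟨P, hP⟩ := Program.exists_hd
    exact PT.intro (P := P) (fun z => hP (enc z)) (.const 2)
      (.of_le fun z => by rw [sz_prod z]; omega)
  exact this.comp hf

@[fun_prop]
theorem PolyTime.snd {f : α → β × γ} (hf : PolyTime f) : PolyTime (fun a => (f a).2) := by
  have : PolyTime (fun z : β × γ => z.2) := by
    obtain ⟨P, hP⟩ := Program.exists_tl
    exact PT.intro (P := P) (fun z => hP (enc z)) (.const 2)
      (.of_le fun z => by rw [sz_prod z]; omega)
  exact this.comp hf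

@[fun_prop]
theorem PolyTime.cons {f : α → β} {g : α → List β} (hf : PolyTime f) (hg : PolyTime g) :
    PolyTime (fun a => f a :: g a) :=
  PT.congr_enc (PT.pair hf hg) fun _ => rfl

@[fun_prop]
theorem PolyTime.tail {f : α → List β} (hf : PolyTime f) : PolyTime (fun a => (f a).tail) := by
  have : PolyTime (fun l : List β => l.tail) := by
    obtain ⟨P, hP⟩ := Program.exists_tl
    refine PT.intro (P := P) (T := fun _ => 2) (fun z => ?_) (.const 2)
      (.of_le fun z => sz_sublist (List.tail_sublist z))
    have : enc z.tail = (enc z).tl := by cases z <;> rfl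
    rw [this]
    exact hP _
  exact this.comp hf

/-- Case distinction on a list, as a function. -/
def caseList {β γ : Type} (l : List β) (b : γ) (f : β → List β → γ) : γ :=
  match l with
  | [] => b
  | a :: t => f a t

/-- The pairs `(a, x :: l)` and `(a, x, l)` have the same tree, so after the test of the list the
unchanged input is handed to the program for `g`. -/
theorem PT.listElim {f : α → γ} {g : α × β × List β → γ} {ν : α → ℕ} {ν' : α × β × List β → ℕ}
    {μ : α × List β → ℕ} (hf : PT ν f) (hg : PT ν' g) (hν : ∀ a, ν a ≤ μ (a, []))
    (hν' : ∀ a x l, ν' (a, x, l) ≤ μ (a, x :: l)) (hsz : ∀ z, sz z ≤ μ z) :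
    PT μ (fun z : α × List β => caseList z.2 (f z.1) fun x l => g (z.1, x, l)) := by
  have hf' : PT (fun z : α × List β => ν z.1 + sz z) (fun z : α × List β => f z.1) :=
    PT.comp hf (PolyTime.pt (PolyTime.fst PolyTime.id) (.of_le fun z => Nat.le_add_left _ _))
      (.of_le fun z => Nat.le_add_right _ _)
  obtain ⟨P, d, hP⟩ := hf'
  obtain ⟨P', d', hP'⟩ := hg
  obtain ⟨Q, hQ⟩ := Program.exists_branch P' P
  let T : α × List β → ℕ := fun z => (2 * μ z + 2) ^ (d + d')
  have key : ∀ z : α × List β,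
      Q.RunsIn (enc (z.2, z)) (enc (caseList z.2 (f z.1) fun x l => g (z.1, x, l))) (T z + 6) ∧
      sz (caseList z.2 (f z.1) fun x l => g (z.1, x, l)) ≤ T z := by
    rintro ⟨a, l⟩
    have hle : ∀ k e, k ≤ 2 * μ (a, l) → e ≤ d + d' → (k + 2) ^ e ≤ T (a, l) := fun k e hk he =>
      (Nat.pow_le_pow_left (Nat.add_le_add_right hk 2) e).trans
        (Nat.pow_le_pow_right (by omega) he)
    cases l with
    | nil =>
      have h1 := hle _ d (show ν a + sz (a, ([] : List β)) ≤ _ by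
        have := hν a; have := hsz (a, []); omega) (by omega)
      exact ⟨(hQ _ _ _).2 ((hP (a, [])).1.mono h1), (hP (a, [])).2.trans h1⟩
    | cons b t =>
      have h2 := hle _ d' (show ν' (a, b, t) ≤ _ by have := hν' a b t; omega) (by omega)
      exact ⟨(hQ _ _ _).1 _ _ ((hP' (a, b, t)).1.mono h2), (hP' (a, b, t)).2.trans h2⟩
  have h2 : PolyTime (fun z : α × List β => (z.2, z)) := by fun_prop
  obtain ⟨R, T₂, hT₂, hs₂, hR⟩ := (h2.pt (.of_le hsz)).elim
  obtain ⟨U, hU⟩ := Program.exists_comp R Q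
  have e : PolyLE T μ := (((PolyLE.const 2).mul (.refl _)).add (.const 2)).pow _
  exact PT.intro (fun z => hU _ _ _ _ _ (hR z) (key z).1)
    ((hT₂.add (e.add (.const 6))).add (.const 3)) (e.mono fun z => (key z).2)

@[fun_prop]
theorem PolyTime.listElim {l : α → List β} {f : α → γ} {g : α → β → List β → γ}
    (hl : PolyTime l) (hf : PolyTime f)
    (hg : PolyTime (fun z : α × β × List β => g z.1 z.2.1 z.2.2)) :
    PolyTime (fun a => caseList (l a) (f a) (g a)) := by
  have h : PolyTime (fun z : α × List β => caseList z.2 (f z.1) fun x l => g z.1 x l) :=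
    PT.listElim hf hg (fun a => by simp only [sz_pair]; omega) (fun a x l => le_rfl)
      fun _ => le_rfl
  exact h.comp (f := fun a => (a, l a)) (by fun_prop)

-- A truth value has the tree of a list with at most one unit, so this is a case distinction on
-- lists.
@[fun_prop]
theorem PolyTime.cond {c : α → Bool} {f g : α → β} (hc : PolyTime c) (hf : PolyTime f)
    (hg : PolyTime g) : PolyTime (fun a => bif c a then f a else g a) := by
  have h : PolyTime (fun b : Bool => bif b then [()] else []) :=
    PolyTime.cast fun b => by cases b <;> rfl
  have h' : PolyTime (fun a => bif c a then [()] else []) := h.comp hc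
  have h2 := PolyTime.listElim (g := fun a _ _ => f a) h' hg (by fun_prop)
  refine PT.congr_enc h2 fun a => ?_
  cases c a <;> rfl

@[fun_prop]
theorem PolyTime.headD {l : α → List β} {f : α → β} (hl : PolyTime l) (hf : PolyTime f) :
    PolyTime (fun a => (l a).headD (f a)) := by
  have h2 := PolyTime.listElim (g := fun _ b _ => b) hl hf (by fun_prop)
  refine PT.congr_enc h2 fun a => ?_
  cases l a <;> rfl

@[fun_prop]
theorem PolyTime.isEmpty {l : α → List β} (hl : PolyTime l) :
    PolyTime (fun a => (l a).isEmpty) := by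
  have h2 := PolyTime.listElim (g := fun _ _ _ => false) hl (.const true) (by fun_prop)
  refine PT.congr_enc h2 fun a => ?_
  cases l a <;> rfl

@[fun_prop]
theorem PolyTime.not {f : α → Bool} (hf : PolyTime f) : PolyTime (fun a => !f a) := by
  have : PolyTime (fun a => bif f a then false else true) := by fun_prop
  refine PT.congr_enc this fun a => ?_
  cases f a <;> rfl

@[fun_prop]
theorem PolyTime.and {f g : α → Bool} (hf : PolyTime f) (hg : PolyTime g) :
    PolyTime (fun a => f a && g a) := by
  have : PolyTime (fun a => bif f a then g a else false) := by fun_prop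
  refine PT.congr_enc this fun a => ?_
  cases f a <;> rfl

@[fun_prop]
theorem PolyTime.or {f g : α → Bool} (hf : PolyTime f) (hg : PolyTime g) :
    PolyTime (fun a => f a || g a) := by
  have : PolyTime (fun a => bif f a then true else g a) := by fun_prop
  refine PT.congr_enc this fun a => ?_
  cases f a <;> rfl

@[fun_prop]
theorem PolyTime.beqBool {f g : α → Bool} (hf : PolyTime f) (hg : PolyTime g) :
    PolyTime (fun a => f a == g a) := by
  have : PolyTime (fun a => bif f a then g a else !g a) := by fun_prop
  refine PT.congr_enc this fun a => ?_
  cases f a <;> cases g a <;> rfl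

/-- The recursion principle: `F` is computed from the list `ch` of the arguments of the recursive
calls by `comb`, and `N` bounds the number of calls. -/
theorem PT.recursion {ch : α → List α} {comb : α × List β → β} {F : α → β} {N : α → ℕ}
    {ν : α × List β → ℕ} (hF : ∀ a, F a = comb (a, (ch a).map F)) (hch : PT μ ch)
    (hcomb : PT ν comb) (hν : PolyLE (fun a => ν (a, (ch a).map F)) μ)
    (hN : ∀ a, 1 + ((ch a).map N).sum ≤ N a) (hNμ : PolyLE N μ)
    (hμ : ∀ a, ∀ b ∈ ch a, μ b ≤ μ a) (hout : PolyLE (fun a => sz (F a)) μ) :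
    PT μ F := by
  obtain ⟨P, d, hP⟩ := hch
  obtain ⟨P', T', hT', -, hP'⟩ := hcomb.elim
  obtain ⟨Q, hQ⟩ := Program.exists_rec (ι := α) P P'
  obtain ⟨e, he⟩ := (hT'.comp fun a => (a, (ch a).map F)).trans hν
  let T : α → ℕ := fun a => (μ a + 2) ^ d + (μ a + 2) ^ e
  have hTmono : ∀ a b, μ b ≤ μ a → T b ≤ T a := by
    intro a b h
    simp only [T]
    gcongr
  have hrun := hQ enc ch (fun a => enc (F a)) N T hN (fun a b hb => hTmono a b (hμ a b hb))
    (fun a => (hP a).1.mono (Nat.le_add_right _ _))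
    (fun a => by
      have h := hP' (a, (ch a).map F)
      rw [← hF a] at h
      have h3 : enc (a, (ch a).map F) = .cons (enc a) (.ofList ((ch a).map fun a => enc (F a))) := by
        simp only [enc, List.map_map]
        rfl
      rw [h3] at h
      exact h.mono ((he a).trans (Nat.le_add_left _ _)))
  have hm : ∀ j, PolyLE (fun a => (μ a + 2) ^ j) μ := fun j => ⟨j, fun _ => le_rfl⟩
  exact PT.intro hrun (hNμ.mul ((PolyLE.mul (.const 2) ((hm d).add (hm e))).add (.const 20))) hout

/-- The recursion principle for a polynomial time combination of the results. -/
theorem PT.recursion_polyTime {ch : α → List α} {comb : α × List β → β} {F : α → β} {N : α → ℕ}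
    (hF : ∀ a, F a = comb (a, (ch a).map F)) (hch : PT μ ch) (hcomb : PolyTime comb)
    (hN : ∀ a, 1 + ((ch a).map N).sum ≤ N a) (hNμ : PolyLE N μ)
    (hμ : ∀ a, ∀ b ∈ ch a, μ b ≤ μ a) (hsz : PolyLE sz μ) (hout : PolyLE (fun a => sz (F a)) μ) :
    PT μ F := by
  refine PT.recursion hF hch hcomb ?_ hN hNμ hμ hout
  obtain ⟨e, he⟩ := hout
  -- Every call contributes at least `1` to `N`, so `N a` also bounds the number of children, and
  -- with it the size of the list of their results.
  have hlen : ∀ a, (ch a).length ≤ N a := by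
    intro a
    have h1 : ∀ l : List α, l.length ≤ (l.map N).sum := by
      intro l
      induction l with
      | nil => simp
      | cons j l ihl => have := hN j; simp; omega
    have := hN a
    have := h1 (ch a)
    omega
  have hA : PolyLE (fun a => sz a + (N a * ((μ a + 2) ^ e + 1) + 1) + 1) μ :=
    (hsz.add ((hNμ.mul (PolyLE.add ⟨e, fun _ => le_rfl⟩ (.const 1))).add (.const 1))).add (.const 1)
  refine hA.mono fun a => ?_
  rw [sz_pair]
  have h1 : sz ((ch a).map F) ≤ ((ch a).map F).length * ((μ a + 2) ^ e + 1) + 1 := by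
    refine sz_list_le fun b hb => ?_
    obtain ⟨b, hb', rfl⟩ := List.mem_map.1 hb
    exact (he b).trans (Nat.pow_le_pow_left (by have := hμ a b hb'; omega) _)
  have h2 : ((ch a).map F).length * ((μ a + 2) ^ e + 1) ≤ N a * ((μ a + 2) ^ e + 1) := by
    refine Nat.mul_le_mul_right _ ?_
    rw [List.length_map]
    exact hlen a
  omega

/-- Recursion on the tail. The intermediate accumulators are the folds over shorter lists, so
`hout`, which speaks of all lists, bounds them too. -/
theorem PT.foldr {f : α → β → γ → γ} {b : α → γ} {μ : α × List β → ℕ}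
    (hf : PolyTime (fun z : α × β × γ => f z.1 z.2.1 z.2.2)) (hb : PolyTime b)
    (hμ : ∀ a x l, μ (a, l) ≤ μ (a, x :: l)) (hsz : PolyLE sz μ)
    (hout : PolyLE (fun z : α × List β => sz (z.2.foldr (f z.1) (b z.1))) μ) :
    PT μ (fun z : α × List β => z.2.foldr (f z.1) (b z.1)) := by
  have hcomb : PolyTime (fun z : (α × List β) × List γ =>
      caseList z.2 (b z.1.1) fun r _ => caseList z.1.2 (b z.1.1) fun x _ => f z.1.1 x r) := by
    refine PolyTime.listElim (by fun_prop) (by fun_prop) ?_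
    refine PolyTime.listElim (by fun_prop) (by fun_prop) ?_
    exact hf.comp (f := fun z : (((α × List β) × List γ) × γ × List γ) × β × List β =>
      (z.1.1.1.1, z.2.1, z.1.2.1)) (by fun_prop)
  have hch : PolyTime (fun z : α × List β =>
      caseList z.2 [] fun _ t => [(z.1, t)]) := by fun_prop
  refine PT.recursion_polyTime (N := fun z => z.2.length + 1) ?_ (hch.pt hsz) hcomb ?_ ?_ ?_ hsz hout
  · rintro ⟨a, l⟩
    cases l <;> rfl
  · rintro ⟨a, l⟩
    cases l
    · simp [caseList]
    · simp [caseList]; omega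
  · exact hsz.mono fun z => by
      have := length_lt_sz z.2
      rw [sz_prod]
      omega
  · rintro ⟨a, l⟩ z hz
    cases l with
    | nil => simp [caseList] at hz
    | cons x l =>
      simp only [caseList, List.mem_singleton] at hz
      subst hz
      exact hμ _ _ _

theorem PolyTime.foldr {f : α → β → γ → γ} {b : α → γ} {l : α → List β}
    (hf : PolyTime (fun z : α × β × γ => f z.1 z.2.1 z.2.2)) (hb : PolyTime b) (hl : PolyTime l)
    (hout : PolyLE (fun z : α × List β => sz (z.2.foldr (f z.1) (b z.1))) sz) :
    PolyTime (fun a => (l a).foldr (f a) (b a)) := by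
  have h : PolyTime (fun z : α × List β => z.2.foldr (f z.1) (b z.1)) :=
    PT.foldr hf hb (fun a x l => by simp only [sz_pair, sz_cons]; omega) (.refl _) hout
  exact h.comp (f := fun a => (a, l a)) (by fun_prop)

/-- Filtering by a predicate that is computed within a polynomial of some measure. -/
theorem PT.filter {p : α → β → Bool} {ν : α × β → ℕ} {μ : α × List β → ℕ}
    (hp : PT ν (fun z : α × β => p z.1 z.2))
    (hν : ∀ a x l, ν (a, x) ≤ μ (a, x :: l)) (hμ : ∀ a x l, μ (a, l) ≤ μ (a, x :: l))
    (hsz : ∀ z, sz z ≤ μ z) : PT μ (fun z : α × List β => z.2.filter (p z.1)) := by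
  have hch : PolyTime (fun z : α × List β => caseList z.2 [] fun _ t => [(z.1, t)]) := by fun_prop
  have hbranch : PolyTime (fun w : Bool × β × List (List β) =>
      bif w.1 then w.2.1 :: w.2.2.headD [] else w.2.2.headD []) := by fun_prop
  let ν' : (α × List (List β)) × β × List β → ℕ := fun z => ν (z.1.1, z.2.1) + sz z
  have hstep : PT ν' (fun z : (α × List (List β)) × β × List β =>
      bif p z.1.1 z.2.1 then z.2.1 :: z.1.2.headD [] else z.1.2.headD []) := by
    have hle : PolyLE sz ν' := .of_le fun z => Nat.le_add_left _ _
    have hproj : PolyTime (fun z : (α × List (List β)) × β × List β => (z.1.1, z.2.1)) := by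
      fun_prop
    have h1 : PT ν' (fun z : (α × List (List β)) × β × List β => p z.1.1 z.2.1) :=
      PT.comp hp (hproj.pt hle) (.of_le fun z => Nat.le_add_right _ _)
    have h2 : PolyTime (fun z : (α × List (List β)) × β × List β => (z.2.1, z.1.2)) := by fun_prop
    exact hbranch.comp_pt (h1.pair (h2.pt hle))
  let ν₂ : (α × List (List β)) × List β → ℕ := fun z => μ (z.1.1, z.2) + sz z
  have hcase := PT.listElim (μ := ν₂) (PolyTime.const (α := α × List (List β)) ([] : List β)) hstep
    (fun a => by simp only [ν₂, sz_pair]; omega)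
    (fun a x l => by
      have := hν a.1 x l
      simp only [ν₂, ν']
      simp only [sz_pair, sz_cons]
      omega) (fun z => Nat.le_add_left _ _)
  have hswap : PolyTime (fun w : (α × List β) × List (List β) => ((w.1.1, w.2), w.1.2)) := by
    fun_prop
  have hcomb := PT.comp (μ := fun w : (α × List β) × List (List β) => μ w.1 + sz w) hcase
    (hswap.pt (.of_le fun z => Nat.le_add_left _ _)) (.of_le fun z => by
      simp only [ν₂, sz_prod, Prod.mk.eta]; omega)
  have hout : ∀ z : α × List β, sz (z.2.filter (p z.1)) ≤ μ z := fun z => by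
    have := sz_sublist (List.filter_sublist (p := p z.1) (l := z.2))
    have h2 := hsz z
    rw [sz_prod] at h2
    omega
  refine PT.recursion (N := fun z => z.2.length + 1) ?_ (hch.pt (.of_le hsz)) hcomb ?_ ?_ ?_ ?_
    (.of_le hout)
  · rintro ⟨a, l⟩
    cases l with
    | nil => rfl
    | cons x l =>
      simp only [caseList, List.map_cons, List.map_nil, List.headD_cons, List.filter_cons]
      cases p a x <;> rfl
  · refine PolyLE.mono (f := fun z => 3 * μ z + 3) (((PolyLE.const 3).mul (.refl _)).add (.const 3))
      fun z => ?_
    have h1 := hsz z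
    rcases z with ⟨a, l⟩
    cases l with
    | nil => simp only [caseList, List.map_nil, sz_pair, sz_nil] at *; omega
    | cons x l =>
      have h2 := hout (a, l)
      have h3 := hμ a x l
      simp only [caseList, List.map_nil, List.map_cons, sz_pair, sz_nil, sz_cons] at *
      omega
  · rintro ⟨a, l⟩
    cases l
    · simp [caseList]
    · simp [caseList]; omega
  · refine .of_le fun z => ?_
    have := length_lt_sz z.2
    have h2 := hsz z
    rw [sz_prod] at h2
    omega
  · rintro ⟨a, l⟩ z hz
    cases l with
    | nil => simp [caseList] at hz
    | cons x l =>
      simp only [caseList, List.mem_singleton] at hz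
      subst hz
      exact hμ _ _ _

end Calculus

/-! ### Polynomial time functions on lists and numbers -/

section Library

variable {α β γ δ : Type} [Enc α] [Enc β] [Enc γ] [Enc δ]

theorem PolyTime.foldrOfSmall {f : α → β → γ → γ} {b : α → γ} {l : α → List β} {k : ℕ}
    (hf : PolyTime (fun z : α × β × γ => f z.1 z.2.1 z.2.2)) (hb : PolyTime b) (hl : PolyTime l)
    (hout : ∀ c : γ, sz c ≤ k) : PolyTime (fun a => (l a).foldr (f a) (b a)) :=
  PolyTime.foldr hf hb hl ((PolyLE.const k).mono fun _ => hout _)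

@[fun_prop]
theorem PolyTime.any {f : α → β → Bool} {l : α → List β}
    (hf : PolyTime (fun z : α × β => f z.1 z.2)) (hl : PolyTime l) :
    PolyTime (fun a => (l a).any (f a)) := by
  have h := PolyTime.foldrOfSmall (γ := Bool) (f := fun a x r => f a x || r) (b := fun _ => false)
    (PolyTime.or (hf.comp (f := fun z : α × β × Bool => (z.1, z.2.1)) (by fun_prop)) (by fun_prop))
    (by fun_prop) hl sz_bool
  refine PT.congr_enc h fun a => ?_
  congr 1
  induction l a with
  | nil => rfl
  | cons x l ih => rw [List.any_cons, ih, List.foldr_cons]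

@[fun_prop]
theorem PolyTime.all {f : α → β → Bool} {l : α → List β}
    (hf : PolyTime (fun z : α × β => f z.1 z.2)) (hl : PolyTime l) :
    PolyTime (fun a => (l a).all (f a)) := by
  have : PolyTime (fun a => !(l a).any (fun x => !f a x)) := by fun_prop
  refine PT.congr_enc this fun a => ?_
  rw [List.not_any_eq_all_not]
  simp

@[fun_prop]
theorem PolyTime.map {f : α → β → γ} {l : α → List β}
    (hf : PolyTime (fun z : α × β => f z.1 z.2)) (hl : PolyTime l) :
    PolyTime (fun a => (l a).map (f a)) := by
  have h := PolyTime.foldr (γ := List γ) (f := fun a x r => f a x :: r) (b := fun _ => []) (l := l)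
    (PolyTime.cons (hf.comp (f := fun z : α × β × List γ => (z.1, z.2.1)) (by fun_prop))
      (by fun_prop)) (by fun_prop) hl ?_
  · refine PT.congr_enc h fun a => ?_
    rw [List.map_eq_foldr]
  · obtain ⟨d, hd⟩ := hf.size
    have h2 : PolyLE (fun z : α × List β => sz z * ((sz z + 2) ^ d + 1) + 1) sz :=
      ((PolyLE.refl _).mul (PolyLE.add ⟨d, fun _ => le_rfl⟩ (.const 1))).add (.const 1)
    refine h2.mono ?_
    rintro ⟨a, l⟩
    simp only [← List.map_eq_foldr]
    have h3 : sz (l.map (f a)) ≤ _ := sz_list_le (k := (sz (a, l) + 2) ^ d) fun b hb => by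
      obtain ⟨x, hx, rfl⟩ := List.mem_map.1 hb
      refine (hd (a, x)).trans (Nat.pow_le_pow_left ?_ d)
      have := sz_mem hx
      simp only [sz_pair]
      omega
    refine h3.trans (Nat.add_le_add_right (Nat.mul_le_mul_right _ ?_) 1)
    have := length_lt_sz l
    simp only [sz_pair, List.length_map]
    omega

@[fun_prop]
theorem PolyTime.filter {f : α → β → Bool} {l : α → List β}
    (hf : PolyTime (fun z : α × β => f z.1 z.2)) (hl : PolyTime l) :
    PolyTime (fun a => (l a).filter (f a)) := by
  have e : ∀ a (l : List β),
      l.foldr (fun x r => bif f a x then x :: r else r) [] = l.filter (f a) := by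
    intro a l
    induction l with
    | nil => rfl
    | cons x l ih =>
      rw [List.foldr_cons, ih, List.filter_cons]
      cases f a x <;> rfl
  have h := PolyTime.foldr (γ := List β) (f := fun a x r => bif f a x then x :: r else r)
    (b := fun _ => []) (l := l)
    (PolyTime.cond (hf.comp (f := fun z : α × β × List β => (z.1, z.2.1)) (by fun_prop))
      (by fun_prop) (by fun_prop)) (by fun_prop) hl ?_
  · exact PT.congr_enc h fun a => by rw [e]
  · refine .of_le ?_
    rintro ⟨a, l⟩
    simp only [e]
    have := sz_sublist (List.filter_sublist (p := f a) (l := l))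
    simp only [sz_pair]
    omega

@[fun_prop]
theorem PolyTime.append {f g : α → List β} (hf : PolyTime f) (hg : PolyTime g) :
    PolyTime (fun a => f a ++ g a) := by
  have h := PT.foldr (α := List β) (γ := List β) (f := fun _ x r => x :: r)
    (b := fun l => l) (μ := sz) (by fun_prop) (by fun_prop)
    (fun a x l => by simp only [sz_pair, sz_cons]; omega) (.refl _) (.of_le ?_)
  · have h' : PolyTime (fun z : List β × List β => z.2 ++ z.1) :=
      PT.congr_enc h fun z => by simp
    exact h'.comp (f := fun a => (g a, f a)) (by fun_prop)
  · rintro ⟨a, l⟩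
    have := sz_append l a
    simp [sz_pair]
    omega

@[fun_prop]
theorem PolyTime.flatten {l : α → List (List β)} (hl : PolyTime l) :
    PolyTime (fun a => (l a).flatten) := by
  have e : ∀ l : List (List β), l.foldr (fun x r => x ++ r) [] = l.flatten := by
    intro l
    induction l with
    | nil => rfl
    | cons x l ih => rw [List.foldr_cons, ih, List.flatten_cons]
  have h := PolyTime.foldr (γ := List β) (f := fun _ x r => x ++ r)
    (b := fun _ => []) (l := l) (by fun_prop) (by fun_prop) hl (.of_le ?_)
  · exact PT.congr_enc h fun a => by rw [e]
  · rintro ⟨a, l⟩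
    simp only [e]
    have : sz l.flatten ≤ sz l := by
      induction l with
      | nil => simp [sz_nil]
      | cons x l ih =>
        have := sz_append x l.flatten
        rw [List.flatten_cons, sz_cons]
        omega
    simp only [sz_pair]
    omega

@[fun_prop]
theorem PolyTime.flatMap {f : α → β → List γ} {l : α → List β}
    (hf : PolyTime (fun z : α × β => f z.1 z.2)) (hl : PolyTime l) :
    PolyTime (fun a => (l a).flatMap (f a)) := by
  have : PolyTime (fun a => ((l a).map (f a)).flatten) := by fun_prop
  exact PT.congr_enc this fun a => by rw [List.flatMap_def]

/-- Unary numbers and lists of units have the same trees; arithmetic thus reduces to operations on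
lists. -/
theorem enc_replicate_unit (n : ℕ) : enc (List.replicate n ()) = enc n := by
  induction n with
  | zero => rfl
  | succ n ih =>
    rw [List.replicate_succ]
    have : enc (() :: List.replicate n ()) = Tree2.cons .nil (enc (List.replicate n ())) := rfl
    rw [this, ih]
    rfl

@[fun_prop]
theorem PolyTime.replicateUnit {f : α → ℕ} (hf : PolyTime f) :
    PolyTime (fun a => List.replicate (f a) ()) :=
  PT.congr_enc hf fun a => enc_replicate_unit (f a)

@[fun_prop]
theorem PolyTime.length {l : α → List β} (hl : PolyTime l) : PolyTime (fun a => (l a).length) := by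
  have : PolyTime (fun a => (l a).map (fun _ => ())) := by fun_prop
  refine PT.congr_enc this fun a => ?_
  rw [← enc_replicate_unit, List.map_const']

@[fun_prop]
theorem PolyTime.add {f g : α → ℕ} (hf : PolyTime f) (hg : PolyTime g) :
    PolyTime (fun a => f a + g a) := by
  have : PolyTime (fun a => (List.replicate (f a) () ++ List.replicate (g a) ()).length) := by
    fun_prop
  exact PT.congr_enc this fun a => by simp

theorem List.foldr_tail_replicate {β : Type} (l : List β) (n : ℕ) :
    (List.replicate n ()).foldr (fun _ r => r.tail) l = l.drop n := by
  induction n with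
  | zero => rfl
  | succ n ih => rw [List.replicate_succ, List.foldr_cons, ih, List.tail_drop]

@[fun_prop]
theorem PolyTime.drop {f : α → ℕ} {l : α → List β} (hf : PolyTime f) (hl : PolyTime l) :
    PolyTime (fun a => (l a).drop (f a)) := by
  have e : ∀ (l : List β) (k : List Unit), k.foldr (fun _ r => r.tail) l = l.drop k.length := by
    intro l k
    rw [← List.foldr_tail_replicate, show List.replicate k.length () = k from
      (List.eq_replicate_of_mem (by simp)).symm]
  have h := PT.foldr (α := List β) (β := Unit) (γ := List β) (f := fun _ _ r => r.tail)
    (b := fun l => l) (μ := sz) (by fun_prop) (by fun_prop)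
    (fun a x l => by simp only [sz_pair, sz_cons]; omega) (.refl _) (.of_le ?_)
  · have h' : PolyTime (fun z : List β × List Unit => z.1.drop z.2.length) :=
      PT.congr_enc h fun z => by rw [e]
    have h2 := h'.comp (f := fun a => (l a, List.replicate (f a) ())) (by fun_prop)
    exact PT.congr_enc h2 fun a => by simp
  · rintro ⟨a, l⟩
    simp only [e]
    have := sz_sublist (List.drop_sublist l.length a)
    simp only [sz_pair]
    omega

@[fun_prop]
theorem PolyTime.sub {f g : α → ℕ} (hf : PolyTime f) (hg : PolyTime g) :
    PolyTime (fun a => f a - g a) := by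
  have : PolyTime (fun a => ((List.replicate (f a) ()).drop (g a)).length) := by fun_prop
  exact PT.congr_enc this fun a => by simp

@[fun_prop]
theorem PolyTime.ble {f g : α → ℕ} (hf : PolyTime f) (hg : PolyTime g) :
    PolyTime (fun a => (f a).ble (g a)) := by
  have : PolyTime (fun a => (List.replicate (f a - g a) ()).isEmpty) := by fun_prop
  refine PT.congr_enc this fun a => congrArg enc ?_
  rw [Bool.eq_iff_iff]
  simp
  omega

@[fun_prop]
theorem PolyTime.beqNat {f g : α → ℕ} (hf : PolyTime f) (hg : PolyTime g) :
    PolyTime (fun a => f a == g a) := by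
  have : PolyTime (fun a => (f a).ble (g a) && (g a).ble (f a)) := by fun_prop
  refine PT.congr_enc this fun a => congrArg enc ?_
  rw [Bool.eq_iff_iff]
  simp
  omega

@[fun_prop]
theorem PolyTime.getD {l : α → List β} {f : α → ℕ} {b : α → β} (hl : PolyTime l)
    (hf : PolyTime f) (hb : PolyTime b) : PolyTime (fun a => (l a).getD (f a) (b a)) := by
  have : PolyTime (fun a => ((l a).drop (f a)).headD (b a)) := by fun_prop
  exact PT.congr_enc this fun a => congrArg enc (by
    simp [List.getD_eq_getElem?_getD, List.head?_drop])

@[fun_prop]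
theorem PolyTime.reverse {l : α → List β} (hl : PolyTime l) : PolyTime (fun a => (l a).reverse) := by
  have e : ∀ l : List β, l.foldr (fun x r => r ++ [x]) [] = l.reverse := by
    intro l
    induction l with
    | nil => rfl
    | cons x l ih => rw [List.foldr_cons, ih, List.reverse_cons]
  have h := PolyTime.foldr (γ := List β) (f := fun _ x r => r ++ [x])
    (b := fun _ => []) (l := l) (by fun_prop) (by fun_prop) hl (.of_le ?_)
  · exact PT.congr_enc h fun a => by rw [e]
  · rintro ⟨a, l⟩
    simp only [e]
    have : sz l.reverse ≤ sz l := by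
      induction l with
      | nil => simp
      | cons x l ih =>
        have := sz_append l.reverse [x]
        rw [List.reverse_cons, sz_cons]
        simp only [sz_cons, sz_nil] at this
        omega
    simp only [sz_pair]
    omega

@[fun_prop]
theorem PolyTime.take {f : α → ℕ} {l : α → List β} (hf : PolyTime f) (hl : PolyTime l) :
    PolyTime (fun a => (l a).take (f a)) := by
  have : PolyTime (fun a => ((l a).reverse.drop ((l a).length - f a)).reverse) := by fun_prop
  exact PT.congr_enc this fun a => by
    rw [List.drop_reverse, List.reverse_reverse]
    rcases le_total (f a) (l a).length with h | h
    · rw [Nat.sub_sub_self h]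
    · rw [List.take_of_length_le h, Nat.sub_eq_zero_of_le h, Nat.sub_zero, List.take_length]

@[fun_prop]
theorem PolyTime.range {f : α → ℕ} (hf : PolyTime f) : PolyTime (fun a => List.range (f a)) := by
  have e : ∀ (k : List Unit), k.foldr (fun _ r => r ++ [r.length]) [] = List.range k.length := by
    intro k
    induction k with
    | nil => rfl
    | cons _ k ih => rw [List.foldr_cons, ih, List.length_cons, List.range_succ, List.length_range]
  have h := PT.foldr (α := Unit) (β := Unit) (γ := List ℕ) (f := fun _ _ r => r ++ [r.length])
    (b := fun _ => []) (μ := sz) (by fun_prop) (by fun_prop)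
    (fun a x l => by simp only [sz_pair, sz_cons]; omega) (.refl _) ?_
  · have h' : PolyTime (fun z : Unit × List Unit => List.range z.2.length) :=
      PT.congr_enc h fun z => by rw [e]
    have h2 := h'.comp (f := fun a => ((), List.replicate (f a) ())) (by fun_prop)
    exact PT.congr_enc h2 fun a => by simp
  · have h2 : PolyLE (fun z : Unit × List Unit => sz z * (2 * sz z + 2) + 1) sz :=
      ((PolyLE.refl _).mul (((PolyLE.const 2).mul (.refl _)).add (.const 2))).add (.const 1)
    refine h2.mono ?_
    rintro ⟨a, l⟩
    simp only [e]
    have h1 := length_lt_sz l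
    have h0 : sz l ≤ sz (a, l) := by rw [sz_pair]; omega
    have : sz (List.range l.length) ≤ _ := sz_list_le (k := 2 * sz (a, l) + 1) fun b hb => by
      rw [sz_nat]
      simp at hb
      omega
    refine this.trans ?_
    rw [List.length_range]
    gcongr
    omega

@[fun_prop]
theorem PolyTime.sum {l : α → List ℕ} (hl : PolyTime l) : PolyTime (fun a => (l a).sum) := by
  have h := PolyTime.foldr (γ := ℕ) (f := fun _ x r => x + r)
    (b := fun _ => 0) (l := l) (by fun_prop) (by fun_prop) hl (.of_le ?_)
  · exact PT.congr_enc h fun a => rfl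
  · rintro ⟨a, l⟩
    have : sz l.sum ≤ sz l := by
      induction l with
      | nil => simp [sz_nil, sz_nat]
      | cons x l ih => simp only [List.sum_cons, sz_cons, sz_nat] at *; omega
    exact this.trans (by simp only [sz_pair]; omega)

@[fun_prop]
theorem PolyTime.mul {f g : α → ℕ} (hf : PolyTime f) (hg : PolyTime g) :
    PolyTime (fun a => f a * g a) := by
  have : PolyTime (fun a => ((List.range (f a)).map (fun _ => g a)).sum) := by fun_prop
  exact PT.congr_enc this fun a => by simp

/-- A tree as a list of trees. -/
def Tree2.toList : Tree2 → List Tree2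
  | .nil => []
  | .cons a b => a :: b.toList

/-- Every tree already encodes a list of trees, so reading it as a list costs nothing. -/
theorem Tree2.enc_toList (t : Tree2) : enc t.toList = t := by
  induction t with
  | nil => rfl
  | cons a b _ ihb =>
    have : enc (Tree2.cons a b).toList = .cons a (enc b.toList) := rfl
    rw [this, ihb]

@[fun_prop]
theorem PolyTime.toList {f : α → Tree2} (hf : PolyTime f) : PolyTime (fun a => (f a).toList) :=
  PT.congr_enc hf fun a => (f a).enc_toList

end Library

/-! ### Formulas as data -/

/-- A formula with any number of colors and free variables. -/
structure AnyFormula where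
  {c v s : ℕ}
  φ : MSO1 c v s

instance : Enc AnyFormula := ⟨fun a => a.φ.encode⟩

namespace Tree2

theorem toList_ofList (l : List Tree2) : (ofList l).toList = l := by
  induction l with
  | nil => rfl
  | cons a l ih => exact congrArg (a :: ·) ih

theorem length_toList_ofNat (n : ℕ) : (ofNat n).toList.length = n := by
  induction n with
  | zero => rfl
  | succ n ih => exact congrArg (· + 1) ih

/-- The number at the head of the encoding of a formula. -/
def tag (t : Tree2) : ℕ := (t.toList.headD .nil).toList.length

/-- The arguments of the head symbol of a formula, as numbers. -/
def argNat (t : Tree2) (i : ℕ) : ℕ := (t.toList.tail.getD i .nil).toList.length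

/-- The encodings of the immediate subformulas. -/
def subformulas (t : Tree2) : List Tree2 := bif Nat.ble 4 t.tag then t.toList.tail else []

end Tree2

section

variable {α : Type} [Enc α]

@[fun_prop]
theorem PolyTime.tag {f : α → Tree2} (hf : PolyTime f) : PolyTime (fun a => (f a).tag) := by
  unfold Tree2.tag; fun_prop

@[fun_prop]
theorem PolyTime.argNat {f : α → Tree2} {i : α → ℕ} (hf : PolyTime f) (hi : PolyTime i) :
    PolyTime (fun a => (f a).argNat (i a)) := by
  unfold Tree2.argNat; fun_prop

@[fun_prop]
theorem PolyTime.subformulas {f : α → Tree2} (hf : PolyTime f) :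
    PolyTime (fun a => (f a).subformulas) := by
  unfold Tree2.subformulas; fun_prop

@[fun_prop]
theorem PolyTime.formulaTree {f : α → AnyFormula} (hf : PolyTime f) :
    PolyTime (fun a => (f a).φ.encode) :=
  PT.congr_enc hf fun _ => rfl

end

namespace MSO1

variable {c : ℕ}

/-- The number of nodes of the syntax tree of a formula. -/
def nodes : {v s : ℕ} → MSO1 c v s → ℕ
  | _, _, eq _ _ => 1
  | _, _, adj _ _ => 1
  | _, _, color _ _ => 1
  | _, _, mem _ _ => 1
  | _, _, not φ => φ.nodes + 1
  | _, _, and φ ψ => φ.nodes + ψ.nodes + 1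
  | _, _, or φ ψ => φ.nodes + ψ.nodes + 1
  | _, _, imp φ ψ => φ.nodes + ψ.nodes + 1
  | _, _, iff φ ψ => φ.nodes + ψ.nodes + 1
  | _, _, allV φ => φ.nodes + 1
  | _, _, exV φ => φ.nodes + 1
  | _, _, allS φ => φ.nodes + 1
  | _, _, exS φ => φ.nodes + 1

theorem one_le_nodes {v s : ℕ} (φ : MSO1 c v s) : 1 ≤ φ.nodes := by cases φ <;> simp [nodes]

theorem nodes_le_length {v s : ℕ} (φ : MSO1 c v s) : φ.nodes ≤ φ.length := by
  induction φ <;> simp only [nodes, length] <;> omega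

/-- The colors that occur in a formula. -/
def usedColors : {v s : ℕ} → MSO1 c v s → List ℕ
  | _, _, eq _ _ => []
  | _, _, adj _ _ => []
  | _, _, color a _ => [a]
  | _, _, mem _ _ => []
  | _, _, not φ => φ.usedColors
  | _, _, and φ ψ => φ.usedColors ++ ψ.usedColors
  | _, _, or φ ψ => φ.usedColors ++ ψ.usedColors
  | _, _, imp φ ψ => φ.usedColors ++ ψ.usedColors
  | _, _, iff φ ψ => φ.usedColors ++ ψ.usedColors
  | _, _, allV φ => φ.usedColors
  | _, _, exV φ => φ.usedColors
  | _, _, allS φ => φ.usedColors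
  | _, _, exS φ => φ.usedColors

theorem length_usedColors {v s : ℕ} (φ : MSO1 c v s) : φ.usedColors.length ≤ φ.nodes := by
  induction φ <;> simp only [nodes, usedColors, List.length_append, List.length_cons,
    List.length_nil] <;> omega

/-- The immediate subformulas. -/
def subs : {v s : ℕ} → MSO1 c v s → List AnyFormula
  | _, _, eq _ _ => []
  | _, _, adj _ _ => []
  | _, _, color _ _ => []
  | _, _, mem _ _ => []
  | _, _, not φ => [⟨φ⟩]
  | _, _, and φ ψ => [⟨φ⟩, ⟨ψ⟩]
  | _, _, or φ ψ => [⟨φ⟩, ⟨ψ⟩]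
  | _, _, imp φ ψ => [⟨φ⟩, ⟨ψ⟩]
  | _, _, iff φ ψ => [⟨φ⟩, ⟨ψ⟩]
  | _, _, allV φ => [⟨φ⟩]
  | _, _, exV φ => [⟨φ⟩]
  | _, _, allS φ => [⟨φ⟩]
  | _, _, exS φ => [⟨φ⟩]

/-- Tags `0` to `3` belong to the atomic formulas, whose arguments are numbers; from tag `4` on all
arguments are formulas. The types of the subformulas leave no trace in the trees. -/
theorem enc_subs {v s : ℕ} (φ : MSO1 c v s) : enc φ.subs = enc φ.encode.subformulas := by
  cases φ <;> rfl

theorem sz_of_mem_subs {v s : ℕ} {φ : MSO1 c v s} {ψ : AnyFormula} (h : ψ ∈ φ.subs) :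
    sz ψ + 1 ≤ sz (⟨φ⟩ : AnyFormula) := by
  cases φ <;> simp only [subs, List.mem_cons, List.not_mem_nil, or_false] at h <;>
    rcases h with rfl | rfl <;> simp [sz, enc, encode, Tree2.ofList, Tree2.size] <;> omega

theorem nodes_eq {v s : ℕ} (φ : MSO1 c v s) : φ.nodes = (φ.subs.map fun a => a.φ.nodes).sum + 1 := by
  cases φ <;> simp [nodes, subs]

theorem nodes_le_sz {v s : ℕ} (φ : MSO1 c v s) : φ.nodes ≤ sz (⟨φ⟩ : AnyFormula) := by
  induction φ with
  | eq | adj | color | mem => simp only [nodes]; exact sz_pos _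
  | not _ ih | allV _ ih | exV _ ih | allS _ ih | exS _ ih =>
    simp [nodes, sz, enc, encode, Tree2.ofList, Tree2.size] at *; omega
  | and _ _ ih ih' | or _ _ ih ih' | imp _ _ ih ih' | iff _ _ ih ih' =>
    simp [nodes, sz, enc, encode, Tree2.ofList, Tree2.size] at *; omega

theorem sz_usedColors {v s : ℕ} (φ : MSO1 c v s) : sz φ.usedColors ≤ sz (⟨φ⟩ : AnyFormula) := by
  induction φ with
  | eq | adj | mem => simp only [usedColors]; exact sz_pos _
  | color a i =>
    simp only [usedColors, sz_cons, sz_nil]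
    simp [sz, enc, encode, Tree2.ofList, Tree2.size]
    omega
  | not _ ih | allV _ ih | exV _ ih | allS _ ih | exS _ ih =>
    refine ih.trans (Nat.le_of_succ_le (sz_of_mem_subs (by simp [subs])))
  | and φ ψ ih ih' | or φ ψ ih ih' | imp φ ψ ih ih' | iff φ ψ ih ih' =>
    have := sz_append φ.usedColors ψ.usedColors
    simp only [usedColors]
    refine le_trans (b := sz (⟨φ⟩ : AnyFormula) + sz (⟨ψ⟩ : AnyFormula)) (by omega) ?_
    simp [sz, enc, encode, Tree2.ofList, Tree2.size]
    omega

end MSO1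

section

variable {α : Type} [Enc α]

@[fun_prop]
theorem PolyTime.subs {f : α → AnyFormula} (hf : PolyTime f) :
    PolyTime (fun a => (f a).φ.subs) :=
  PT.congr_enc (by fun_prop : PolyTime (fun a => (f a).φ.encode.subformulas)) fun a =>
    (f a).φ.enc_subs

@[fun_prop]
theorem PolyTime.nodes {f : α → AnyFormula} (hf : PolyTime f) :
    PolyTime (fun a => (f a).φ.nodes) := by
  have h : PolyTime (fun a : AnyFormula => a.φ.nodes) := by
    refine PT.recursion_polyTime (ch := fun a => a.φ.subs) (comb := fun z => z.2.sum + 1)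
      (N := fun a => a.φ.nodes) (fun a => a.φ.nodes_eq) (by fun_prop : PolyTime _) (by fun_prop)
      ?_ (.of_le fun a => a.φ.nodes_le_sz) ?_ (.refl _) ?_
    · intro a
      rw [a.φ.nodes_eq, add_comm]
    · intro a b hb
      exact Nat.le_of_succ_le (MSO1.sz_of_mem_subs hb)
    · refine PolyLE.mono (((PolyLE.const 2).mul (.refl _)).add (.const 1)) fun a => ?_
      have := a.φ.nodes_le_sz
      rw [sz_nat]
      exact Nat.add_le_add_right (Nat.mul_le_mul_left 2 this) 1
  exact h.comp hf

@[fun_prop]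
theorem PolyTime.usedColors {f : α → AnyFormula} (hf : PolyTime f) :
    PolyTime (fun a => (f a).φ.usedColors) := by
  have h : PolyTime (fun a : AnyFormula => a.φ.usedColors) := by
    refine PT.recursion_polyTime (ch := fun a => a.φ.subs)
      (comb := fun z => bif z.1.φ.encode.tag == 2 then [z.1.φ.encode.argNat 0] else z.2.flatten)
      (N := fun a => a.φ.nodes) ?_ (by fun_prop : PolyTime _) (by fun_prop)
      ?_ (.of_le fun a => a.φ.nodes_le_sz) ?_ (.refl _) (.of_le fun a => a.φ.sz_usedColors)
    · rintro ⟨φ⟩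
      cases φ
      case color a i =>
        change [(a : ℕ)] = [(Tree2.ofNat a).toList.length]
        rw [Tree2.length_toList_ofNat]
      all_goals simp [MSO1.usedColors, MSO1.subs, MSO1.encode, Tree2.tag, Tree2.toList_ofList,
        Tree2.length_toList_ofNat]
    · intro a
      rw [a.φ.nodes_eq, add_comm]
    · intro a b hb
      exact Nat.le_of_succ_le (MSO1.sz_of_mem_subs hb)
  exact h.comp hf

end

/-! ### Evaluation by brute force -/

/-- The bit with index `u` in a list of bits. -/
def bit (l : List Bool) (u : ℕ) : Bool := l.getD u false

/-- Adjacency in a graph that is given by the rows of its adjacency matrix. -/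
def adjB (g : List (List Bool)) (u v : ℕ) : Bool := bit (g.getD u []) v

section

variable {α : Type} [Enc α]

@[fun_prop]
theorem PolyTime.bit {f : α → List Bool} {u : α → ℕ} (hf : PolyTime f) (hu : PolyTime u) :
    PolyTime (fun a => bit (f a) (u a)) := by
  unfold _root_.bit; fun_prop

@[fun_prop]
theorem PolyTime.adjB {f : α → List (List Bool)} {u v : α → ℕ} (hf : PolyTime f) (hu : PolyTime u)
    (hv : PolyTime v) : PolyTime (fun a => adjB (f a) (u a) (v a)) := by
  unfold _root_.adjB; fun_prop

end

/-- The data for an evaluation: the domain of the vertex quantifiers, the domain of the set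
quantifiers, the rows of the adjacency matrix, and the colors. -/
abbrev EvalData := List ℕ × List (List ℕ) × List (List Bool) × List (List Bool)

namespace MSO1

variable {c : ℕ}

/-- Evaluation of a formula by brute force. -/
def evalB (Γ : EvalData) : {v s : ℕ} → MSO1 c v s → List ℕ → List (List ℕ) → Bool
  | _, _, eq i j, x, _ => x.getD i 0 == x.getD j 0
  | _, _, adj i j, x, _ => adjB Γ.2.2.1 (x.getD i 0) (x.getD j 0)
  | _, _, color a i, x, _ => bit (Γ.2.2.2.getD a []) (x.getD i 0)
  | _, _, mem j i, x, X => (X.getD j []).any fun u => u == x.getD i 0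
  | _, _, not φ, x, X => !φ.evalB Γ x X
  | _, _, and φ ψ, x, X => φ.evalB Γ x X && ψ.evalB Γ x X
  | _, _, or φ ψ, x, X => φ.evalB Γ x X || ψ.evalB Γ x X
  | _, _, imp φ ψ, x, X => !φ.evalB Γ x X || ψ.evalB Γ x X
  | _, _, iff φ ψ, x, X => φ.evalB Γ x X == ψ.evalB Γ x X
  | _, _, allV φ, x, X => Γ.1.all fun u => φ.evalB Γ (u :: x) X
  | _, _, exV φ, x, X => Γ.1.any fun u => φ.evalB Γ (u :: x) X
  | _, _, allS φ, x, X => Γ.2.1.all fun U => φ.evalB Γ x (U :: X)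
  | _, _, exS φ, x, X => Γ.2.1.any fun U => φ.evalB Γ x (U :: X)

end MSO1

/-- The arguments of the evaluation, over a type of (representations of) formulas. -/
abbrev EvalArg (Φ : Type) := Φ × EvalData × List ℕ × List (List ℕ)

/-- The recursive calls of the evaluation, given the subformulas. -/
def evalCalls {Φ : Type} (k : ℕ) (l : List Φ) (Γ : EvalData) (x : List ℕ) (X : List (List ℕ)) :
    List (EvalArg Φ) :=
  bif Nat.ble k 8 then l.map fun ψ => (ψ, Γ, x, X)
  else bif Nat.ble k 10 then l.flatMap fun ψ => Γ.1.map fun u => (ψ, Γ, u :: x, X)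
  else l.flatMap fun ψ => Γ.2.1.map fun U => (ψ, Γ, x, U :: X)

/-- The value of a formula from the values of the recursive calls. -/
def evalComb (t : Tree2) (Γ : EvalData) (x : List ℕ) (X : List (List ℕ)) (r : List Bool) : Bool :=
  bif t.tag == 0 then x.getD (t.argNat 0) 0 == x.getD (t.argNat 1) 0
  else bif t.tag == 1 then adjB Γ.2.2.1 (x.getD (t.argNat 0) 0) (x.getD (t.argNat 1) 0)
  else bif t.tag == 2 then bit (Γ.2.2.2.getD (t.argNat 0) []) (x.getD (t.argNat 1) 0)
  else bif t.tag == 3 then (X.getD (t.argNat 0) []).any fun u => u == x.getD (t.argNat 1) 0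
  else bif t.tag == 4 then !r.getD 0 false
  else bif t.tag == 5 then r.getD 0 false && r.getD 1 false
  else bif t.tag == 6 then r.getD 0 false || r.getD 1 false
  else bif t.tag == 7 then !r.getD 0 false || r.getD 1 false
  else bif t.tag == 8 then r.getD 0 false == r.getD 1 false
  else bif t.tag == 9 then r.all fun b => b
  else bif t.tag == 10 then r.any fun b => b
  else bif t.tag == 11 then r.all fun b => b
  else r.any fun b => b

theorem evalCalls_polyTime {α Φ : Type} [Enc α] [Enc Φ] {k : α → ℕ} {l : α → List Φ}
    {Γ : α → EvalData} {x : α → List ℕ} {X : α → List (List ℕ)} (hk : PolyTime k)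
    (hl : PolyTime l) (hΓ : PolyTime Γ) (hx : PolyTime x) (hX : PolyTime X) :
    PolyTime (fun a => evalCalls (k a) (l a) (Γ a) (x a) (X a)) := by
  unfold evalCalls; fun_prop

theorem evalComb_polyTime :
    PolyTime (fun z : EvalArg AnyFormula × List Bool =>
      evalComb z.1.1.φ.encode z.1.2.1 z.1.2.2.1 z.1.2.2.2 z.2) := by
  unfold evalComb; fun_prop

/-- The form that the recursion principle needs: the combination step sees the tag, the numeric
arguments and the list of results, where a quantifier has made one call for each element of its
domain. -/
theorem evalB_eq_evalComb (z : EvalArg AnyFormula) :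
    z.1.φ.evalB z.2.1 z.2.2.1 z.2.2.2 = evalComb z.1.φ.encode z.2.1 z.2.2.1 z.2.2.2
      ((evalCalls z.1.φ.encode.tag z.1.φ.subs z.2.1 z.2.2.1 z.2.2.2).map fun w =>
        w.1.φ.evalB w.2.1 w.2.2.1 w.2.2.2) := by
  obtain ⟨⟨φ⟩, Γ, x, X⟩ := z
  cases φ <;> simp [MSO1.evalB, evalComb, evalCalls, MSO1.encode, Tree2.tag, Tree2.argNat,
    Tree2.toList_ofList, Tree2.length_toList_ofNat, MSO1.subs, Function.comp_def, Bool.cond_eq_ite,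
    Nat.ble_eq]

/-- The measure for the evaluation. -/
def evalMeasure (z : EvalArg AnyFormula) : ℕ :=
  (z.2.1.1.length + z.2.1.2.1.length + 2) ^ z.1.φ.nodes + sz z.1 * sz z.2.1 + sz z

/-- With `M` equal to the sizes of both domains plus `2`, at most `M ^ nodes` calls occur. The
assignments grow along the recursion; the product `sz z.1 * sz z.2.1` in the measure pays for that,
since each call shrinks the formula and adds at most one element of a domain. -/
theorem evalB_pt :
    PT evalMeasure (fun z : EvalArg AnyFormula => z.1.φ.evalB z.2.1 z.2.2.1 z.2.2.2) := by
  have hsz : PolyLE (sz (α := EvalArg AnyFormula)) evalMeasure :=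
    .of_le fun z => by unfold evalMeasure; omega
  have hch : PolyTime (fun z : EvalArg AnyFormula =>
      evalCalls z.1.φ.encode.tag z.1.φ.subs z.2.1 z.2.2.1 z.2.2.2) :=
    evalCalls_polyTime (by fun_prop) (by fun_prop) (by fun_prop) (by fun_prop) (by fun_prop)
  refine PT.recursion_polyTime
    (N := fun z => (z.2.1.1.length + z.2.1.2.1.length + 2) ^ z.1.φ.nodes)
    evalB_eq_evalComb (hch.pt hsz) evalComb_polyTime ?_
    (.of_le fun z => by unfold evalMeasure; omega) ?_ hsz ((PolyLE.const 3).mono fun z => sz_bool _)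
  · rintro ⟨⟨φ⟩, Γ, x, X⟩
    -- `h1` counts the calls for a binary connective, `h2` those for `k` calls of a single
    -- subformula.
    have h1 : ∀ M a b : ℕ, 2 ≤ M → 1 ≤ a → 1 ≤ b → 1 + (M ^ a + M ^ b) ≤ M ^ (a + b + 1) := by
      intro M a b hM ha hb
      have e1 : M ^ a ≤ M ^ (a + b - 1) := Nat.pow_le_pow_right (by omega) (by omega)
      have e2 : M ^ b ≤ M ^ (a + b - 1) := Nat.pow_le_pow_right (by omega) (by omega)
      have e3 : M ^ (a + b + 1) = M ^ (a + b - 1) * M * M := by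
        rw [← pow_succ, ← pow_succ]; congr 1; omega
      have e4 : 1 ≤ M ^ (a + b - 1) := Nat.one_le_pow _ _ (by omega)
      have e5 : M ^ (a + b - 1) * 2 * 2 ≤ M ^ (a + b - 1) * M * M := by gcongr
      omega
    have h2 : ∀ M k a : ℕ, k + 1 ≤ M → 1 + k * M ^ a ≤ M ^ (a + 1) := by
      intro M k a hk
      have e4 : 1 ≤ M ^ a := Nat.one_le_pow _ _ (by omega)
      rw [pow_succ]
      nlinarith
    cases φ <;>
      simp [evalCalls, MSO1.encode, Tree2.tag, Tree2.toList_ofList, MSO1.subs, MSO1.nodes,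
        Tree2.length_toList_ofNat, Function.comp_def, Bool.cond_eq_ite, Nat.ble_eq]
    case not φ => simpa using h2 (Γ.1.length + Γ.2.1.length + 2) 1 φ.nodes (by omega)
    case and φ ψ => exact h1 _ _ _ (by omega) φ.one_le_nodes ψ.one_le_nodes
    case or φ ψ => exact h1 _ _ _ (by omega) φ.one_le_nodes ψ.one_le_nodes
    case imp φ ψ => exact h1 _ _ _ (by omega) φ.one_le_nodes ψ.one_le_nodes
    case iff φ ψ => exact h1 _ _ _ (by omega) φ.one_le_nodes ψ.one_le_nodes
    all_goals refine h2 _ _ _ ?_; omega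
  · rintro ⟨⟨φ⟩, Γ, x, X⟩ w hw
    have key : ∃ ψ ∈ φ.subs, w.1 = ψ ∧ w.2.1 = Γ ∧ sz w.2.2 ≤ sz (x, X) + sz Γ := by
      have g1 : sz Γ.1 + 1 ≤ sz Γ := by rw [sz_prod]; have := sz_pos Γ.2; omega
      have g2 : sz Γ.2.1 + 1 ≤ sz Γ := by
        rw [sz_prod, sz_prod Γ.2]; have := sz_pos Γ.2.2; omega
      unfold evalCalls at hw
      cases h8 : Nat.ble (MSO1.encode φ).tag 8 with
      | true =>
        simp only [h8, cond_true, List.mem_map] at hw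
        obtain ⟨ψ, hψ, rfl⟩ := hw
        exact ⟨ψ, hψ, rfl, rfl, by simp⟩
      | false =>
        cases h10 : Nat.ble (MSO1.encode φ).tag 10 with
        | true =>
          simp only [h8, h10, cond_true, cond_false, List.mem_flatMap, List.mem_map] at hw
          obtain ⟨ψ, hψ, u, hu, rfl⟩ := hw
          refine ⟨ψ, hψ, rfl, rfl, ?_⟩
          have := sz_mem hu
          simp only [sz_pair, sz_cons]
          omega
        | false =>
          simp only [h8, h10, cond_false, List.mem_flatMap, List.mem_map] at hw
          obtain ⟨ψ, hψ, u, hu, rfl⟩ := hw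
          refine ⟨ψ, hψ, rfl, rfl, ?_⟩
          have := sz_mem hu
          simp only [sz_pair, sz_cons]
          omega
    obtain ⟨ψ, hψ, e1, e2, e3⟩ := key
    have h1 := MSO1.sz_of_mem_subs hψ
    have h2 : ψ.φ.nodes ≤ φ.nodes := by
      rw [φ.nodes_eq]
      have := List.single_le_sum (l := φ.subs.map fun a => a.φ.nodes) (by simp) ψ.φ.nodes
        (List.mem_map.2 ⟨ψ, hψ, rfl⟩)
      omega
    have h3 := Nat.mul_le_mul_right (sz Γ) h1
    unfold evalMeasure
    rw [sz_prod w, sz_prod w.2, e1, e2]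
    simp only [sz_pair] at *
    have h4 : (Γ.1.length + Γ.2.1.length + 2) ^ ψ.φ.nodes ≤
      (Γ.1.length + Γ.2.1.length + 2) ^ φ.nodes := Nat.pow_le_pow_right (by omega) h2
    rw [add_mul] at h3
    omega

/-! ### Bounded solutions of linear systems -/

-- An entry of the adjugate is the determinant of `M` with one row replaced by a unit vector, whose
-- entry `1` requires `1 ≤ r`; the Leibniz formula bounds it.
open Matrix in
theorem abs_adjugate_le {q r : ℕ} (M : Matrix (Fin q) (Fin q) ℤ) (hr : 1 ≤ r)
    (hM : ∀ i j, |M i j| ≤ r) (i j : Fin q) : |M.adjugate i j| ≤ q.factorial * (r : ℤ) ^ q := by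
  rw [Matrix.adjugate_apply]
  have h := Matrix.det_le (A := M.updateRow j (Pi.single i 1)) (abv := AbsoluteValue.abs) (x := (r : ℤ))
    (by
      intro a b
      change |_| ≤ _
      rw [Matrix.updateRow_apply]
      split_ifs
      · by_cases hb : b = i
        · subst hb; simp; omega
        · simp [hb]
      · exact hM a b)
  simpa using h

theorem abs_det_le {q r : ℕ} (M : Matrix (Fin q) (Fin q) ℤ)
    (hM : ∀ i j, |M i j| ≤ r) : |M.det| ≤ q.factorial * (r : ℤ) ^ q := by
  have h := Matrix.det_le (A := M) (abv := AbsoluteValue.abs) (x := (r : ℤ)) hM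
  simpa using h

theorem abs_gram_le {ι : Type} [Fintype ι] {q r : ℕ} (A : Matrix ι (Fin q) ℤ)
    (hA : ∀ i j, |A i j| ≤ 1) (hr : Fintype.card ι ≤ r) (i j : Fin q) :
    |(A.transpose * A) i j| ≤ r := by
  rw [Matrix.mul_apply]
  refine (Finset.abs_sum_le_sum_abs _ _).trans ?_
  have : ∀ k ∈ Finset.univ, |A.transpose i k * A k j| ≤ (1 : ℤ) := by
    intro k _
    rw [abs_mul, Matrix.transpose_apply]
    exact mul_le_one₀ (hA _ _) (abs_nonneg _) (hA _ _)
  refine (Finset.sum_le_card_nsmul _ _ _ this).trans ?_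
  simp
  exact_mod_cast hr

/-- An integer matrix with small entries has a small vector in its kernel, or a nonsingular Gram
matrix. -/
theorem exists_small_kernel_or_gram {ι : Type} [Fintype ι] {r : ℕ} (hr : Fintype.card ι ≤ r)
    (hr1 : 1 ≤ r) : ∀ {q : ℕ} (A : Matrix ι (Fin q) ℤ), (∀ i j, |A i j| ≤ 1) →
    (∃ δ : Fin q → ℤ, δ ≠ 0 ∧ A.mulVec δ = 0 ∧ ∀ j, |δ j| ≤ q.factorial * (r : ℤ) ^ q) ∨
      (A.transpose * A).det ≠ 0
  | 0, A, _ => Or.inr (by simp)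
  | q + 1, A, hA => by
    by_cases hdet : (A.transpose * A).det = 0
    · left
      -- Induction on the number of columns: a small kernel vector of the last `q` columns is
      -- extended by `0`.
      rcases exists_small_kernel_or_gram hr hr1 (A.submatrix id Fin.succ) (fun i j => hA _ _) with
        ⟨δ, h0, hk, hb⟩ | h
      · refine ⟨Fin.cons 0 δ, ?_, ?_, ?_⟩
        · intro h
          refine h0 (funext fun j => ?_)
          simpa using congrFun h j.succ
        · funext i
          have := congrFun hk i
          simp only [Matrix.mulVec, dotProduct, Fin.sum_univ_succ, Fin.cons_zero, Fin.cons_succ] at *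
          simpa using this
        · intro j
          refine Fin.cases ?_ (fun j => ?_) j
          · simp; positivity
          · simp only [Fin.cons_succ]
            refine (hb j).trans ?_
            have h1 : q.factorial ≤ (q + 1).factorial := Nat.factorial_le (by omega)
            have h2 : r ^ q ≤ r ^ (q + 1) := Nat.pow_le_pow_right hr1 (by omega)
            exact_mod_cast Nat.mul_le_mul h1 h2
      -- Since the Gram matrix is singular, the columns of its adjugate lie in its kernel, and `Aᵀ A
      -- δ = 0` implies `A δ = 0`. Column `0` does not vanish, because its entry `0` is the Gram
      -- determinant of the other columns.
      · refine ⟨fun j => (A.transpose * A).adjugate j 0, ?_, ?_, ?_⟩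
        · intro h0
          apply h
          have := congrFun h0 0
          rw [Matrix.adjugate_fin_succ_eq_det_submatrix] at this
          simp at this
          rw [← this]
          congr 1
        · rw [← Matrix.conjTranspose_mul_self_mulVec_eq_zero]
          have h2 : A.conjTranspose = A.transpose := by ext; simp
          rw [h2]
          have h3 := Matrix.mul_adjugate (A.transpose * A)
          rw [hdet, zero_smul] at h3
          funext i
          exact congrFun (congrFun h3 i) 0
        · intro j
          exact abs_adjugate_le _ hr1 (abs_gram_le A hA hr) j 0
    · exact Or.inr hdet

/-- A system of linear equations with small coefficients has a small nontrivial solution of the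
homogeneous system, or its unknowns are determined with small coefficients. -/
theorem exists_small_kernel_or_inverse {ι κ : Type} [Fintype ι] [Fintype κ] [DecidableEq κ]
    {r q R : ℕ} (hr : Fintype.card ι ≤ r) (hr1 : 1 ≤ r) (hq : Fintype.card κ = q)
    (hR : q.factorial * r ^ q ≤ R) (A : Matrix ι κ ℤ) (hA : ∀ i j, |A i j| ≤ 1) :
    (∃ δ : κ → ℤ, δ ≠ 0 ∧ A.mulVec δ = 0 ∧ ∀ j, |δ j| ≤ R) ∨
      ∃ (D : ℤ) (C : Matrix κ ι ℤ), 1 ≤ D ∧ D ≤ R ∧ (∀ j i, |C j i| ≤ q * R) ∧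
        ∀ x : κ → ℤ, ∀ j, D * x j = ∑ i, C j i * A.mulVec x i := by
  let e : κ ≃ Fin q := Fintype.equivFinOfCardEq hq
  have hR' : (q.factorial : ℤ) * (r : ℤ) ^ q ≤ R := by exact_mod_cast hR
  let A' : Matrix ι (Fin q) ℤ := A.submatrix id e.symm
  have hmul : ∀ δ : κ → ℤ, A.mulVec δ = A'.mulVec (δ ∘ e.symm) := by
    intro δ
    funext i
    simp only [Matrix.mulVec, dotProduct, A', Matrix.submatrix_apply, id, Function.comp]
    exact (Equiv.sum_comp e.symm fun k => A i k * δ k).symm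
  rcases exists_small_kernel_or_gram hr hr1 A' (fun i j => hA _ _) with ⟨δ, h0, hk, hb⟩ | h
  · refine Or.inl ⟨δ ∘ e, ?_, ?_, fun j => (hb _).trans hR'⟩
    · intro h
      refine h0 (funext fun j => ?_)
      simpa using congrFun h (e.symm j)
    · rw [hmul]
      simpa [Function.comp_assoc] using hk
  · right
    set M := A'.transpose * A' with hM
    have hMb := abs_gram_le A' (fun i j => hA _ _) hr
    -- Cramer's rule in the form `det M * x = adj M * Aᵀ * (A x)`; the sign makes the factor of `x`
    -- positive.
    refine ⟨|M.det|, fun j i => SignType.sign M.det * (M.adjugate * A'.transpose) (e j) i,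
      ?_, (abs_det_le M hMb).trans hR', ?_, ?_⟩
    · exact Int.one_le_abs h
    · intro j i
      rw [abs_mul]
      have h1 : |((SignType.sign M.det : SignType) : ℤ)| ≤ 1 := by
        rcases lt_trichotomy M.det 0 with h | h | h <;> simp [h]
      have h2 : |(M.adjugate * A'.transpose) (e j) i| ≤ q * R := by
        rw [Matrix.mul_apply]
        refine (Finset.abs_sum_le_sum_abs _ _).trans ?_
        have : ∀ k ∈ Finset.univ, |M.adjugate (e j) k * A'.transpose k i| ≤ (R : ℤ) := by
          intro k _
          rw [abs_mul]
          calc _ ≤ |M.adjugate (e j) k| * 1 := by gcongr; exact hA _ _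
            _ ≤ R := by rw [mul_one]; exact (abs_adjugate_le M hr1 hMb _ _).trans hR'
        refine (Finset.sum_le_card_nsmul _ _ _ this).trans ?_
        simp
      calc _ ≤ 1 * |(M.adjugate * A'.transpose) (e j) i| := by gcongr
        _ ≤ _ := by rwa [one_mul]
    · intro x j
      have h1 : (M.adjugate * A'.transpose).mulVec (A.mulVec x) (e j) = M.det * x j := by
        rw [hmul, Matrix.mulVec_mulVec, Matrix.mul_assoc, ← hM, Matrix.adjugate_mul,
          Matrix.smul_mulVec, Matrix.one_mulVec]
        simp
      have h2 : |M.det| = SignType.sign M.det * M.det := (sign_mul_self M.det).symm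
      rw [h2, mul_assoc, ← h1, Matrix.mulVec, dotProduct, Finset.mul_sum]
      exact Finset.sum_congr rfl fun i _ => by ring

/-! ### Walks of integer vectors -/

section Walks

variable {p : ℕ}

/-- One unit moves from one coordinate to another. -/
def UnitMove (x y : Fin p → ℤ) : Prop :=
  ∃ i j, i ≠ j ∧ y i = x i + 1 ∧ y j = x j - 1 ∧ ∀ l, l ≠ i → l ≠ j → y l = x l

/-- There is a walk with `n` unit moves inside `A` from `x` to `y`. -/
def Walk (A : (Fin p → ℤ) → Prop) : ℕ → (Fin p → ℤ) → (Fin p → ℤ) → Prop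
  | 0, x, y => A x ∧ x = y
  | n + 1, x, y => A x ∧ ∃ z, UnitMove x z ∧ Walk A n z y

theorem Walk.trans {A : (Fin p → ℤ) → Prop} {n k : ℕ} {x y z : Fin p → ℤ} (h : Walk A n x y)
    (h' : Walk A k y z) : Walk A (n + k) x z := by
  induction n generalizing x with
  | zero => obtain ⟨-, rfl⟩ := h; simpa using h'
  | succ n ih =>
    obtain ⟨hx, w, hw, h⟩ := h
    rw [Nat.succ_add]
    exact ⟨hx, w, hw, ih h⟩

/-- The distance in the sum norm. -/
def sumDist (x y : Fin p → ℤ) : ℤ := ∑ i, |x i - y i|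

theorem sumDist_nonneg (x y : Fin p → ℤ) : 0 ≤ sumDist x y :=
  Finset.sum_nonneg fun _ _ => abs_nonneg _

theorem sumDist_triangle (x y z : Fin p → ℤ) : sumDist x z ≤ sumDist x y + sumDist y z := by
  unfold sumDist
  rw [← Finset.sum_add_distrib]
  exact Finset.sum_le_sum fun i _ => abs_sub_le _ _ _

theorem UnitMove.sum_eq {x y : Fin p → ℤ} (h : UnitMove x y) : ∑ i, x i = ∑ i, y i := by
  obtain ⟨i, j, hij, hi, hj, hl⟩ := h
  have : ∀ l, y l = x l + (if l = i then 1 else 0) - (if l = j then 1 else 0) := by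
    intro l
    by_cases h1 : l = i
    · subst h1; simp [hij, hi]
    · by_cases h2 : l = j
      · subst h2; simp [h1, hj]
      · simp [h1, h2, hl l h1 h2]
  simp only [this, Finset.sum_sub_distrib, Finset.sum_add_distrib]
  simp

theorem UnitMove.sumDist_eq {x y : Fin p → ℤ} (h : UnitMove x y) : sumDist x y = 2 := by
  obtain ⟨i, j, hij, hi, hj, hl⟩ := h
  have : ∀ l, |x l - y l| = (if l = i then 1 else 0) + (if l = j then 1 else 0) := by
    intro l
    by_cases h1 : l = i
    · subst h1; simp [hij, hi]
    · by_cases h2 : l = j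
      · subst h2; simp [h1, hj]
      · simp [h1, h2, hl l h1 h2]
  simp only [sumDist, this, Finset.sum_add_distrib]
  simp

theorem UnitMove.abs_le {x y : Fin p → ℤ} (h : UnitMove x y) (l : Fin p) : |x l - y l| ≤ 1 := by
  obtain ⟨i, j, hij, hi, hj, hl⟩ := h
  by_cases h1 : l = i
  · subst h1; simp [hi]
  · by_cases h2 : l = j
    · subst h2; simp [hj]
    · simp [hl l h1 h2]

/-- Two vectors with the same sum are connected by a walk of the minimum length that stays between
them, and in which at any time all but two coordinates belong to one of the two vectors. -/
theorem exists_walk_between {G : Fin p → ℤ → Prop} (v : Fin p → ℤ) (hv : ∀ l, G l (v l)) :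
    ∀ (n : ℕ) (x u : Fin p → ℤ) (i j : Fin p), ∑ l, u l = ∑ l, v l → sumDist u v = 2 * n →
      u i ≤ v i → v j ≤ u j → (∀ l, l ≠ i → l ≠ j → G l (u l)) →
      (∀ l, (x l ≤ u l ∧ u l ≤ v l) ∨ (v l ≤ u l ∧ u l ≤ x l)) →
      Walk (fun w => (∃ i j, ∀ l, l ≠ i → l ≠ j → G l (w l)) ∧
        ∀ l, (x l ≤ w l ∧ w l ≤ v l) ∨ (v l ≤ w l ∧ w l ≤ x l)) n u v
  | 0, x, u, i, j, _, hd, _, _, hg, hb => by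
    refine ⟨⟨⟨i, j, hg⟩, hb⟩, funext fun l => ?_⟩
    have h := (Finset.sum_eq_zero_iff_of_nonneg (fun i _ => abs_nonneg (u i - v i))).1
      (by simpa [sumDist] using hd) l (Finset.mem_univ l)
    have := abs_eq_zero.1 h
    omega
  | n + 1, x, u, i, j, hs, hd, hi, hj, hg, hb => by
    have hne : ∃ l, u l ≠ v l := by
      by_contra! h
      have : sumDist u v = 0 := by simp [sumDist, h]
      omega
    have hup : ∃ l, u l < v l := by
      by_contra! h
      obtain ⟨l, hl⟩ := hne
      have := Finset.sum_lt_sum (s := Finset.univ) (f := v) (g := u) (fun l _ => h l)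
        ⟨l, Finset.mem_univ l, lt_of_le_of_ne (h l) (Ne.symm hl)⟩
      omega
    have hdown : ∃ l, v l < u l := by
      by_contra! h
      obtain ⟨l, hl⟩ := hne
      have := Finset.sum_lt_sum (s := Finset.univ) (f := u) (g := v) (fun l _ => h l)
        ⟨l, Finset.mem_univ l, lt_of_le_of_ne (h l) hl⟩
      omega
    -- Coordinate `i` is raised until it reaches `v i`, and only then a new one is taken up; a
    -- finished coordinate is good by `hv`. Likewise `j` is lowered to `v j`.
    obtain ⟨i', hi', gi⟩ : ∃ i', u i' < v i' ∧ ∀ l, l ≠ i' → l ≠ j → G l (u l) := by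
      rcases hi.lt_or_eq with h | h
      · exact ⟨i, h, hg⟩
      · obtain ⟨a, ha⟩ := hup
        refine ⟨a, ha, fun l _ h2 => ?_⟩
        by_cases hl : l = i
        · subst hl; rw [h]; exact hv l
        · exact hg l hl h2
    obtain ⟨j', hj', gj⟩ : ∃ j', v j' < u j' ∧ ∀ l, l ≠ i' → l ≠ j' → G l (u l) := by
      rcases hj.lt_or_eq with h | h
      · exact ⟨j, h, gi⟩
      · obtain ⟨a, ha⟩ := hdown
        refine ⟨a, ha, fun l h1 _ => ?_⟩
        by_cases hl : l = j
        · subst hl; rw [← h]; exact hv l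
        · exact gi l h1 hl
    have hij : i' ≠ j' := by rintro rfl; omega
    let w : Fin p → ℤ := fun l => if l = i' then u l + 1 else if l = j' then u l - 1 else u l
    have wi : w i' = u i' + 1 := by simp [w]
    have wj : w j' = u j' - 1 := by simp [w, hij.symm]
    have wl : ∀ l, l ≠ i' → l ≠ j' → w l = u l := fun l h1 h2 => by simp [w, h1, h2]
    have hmove : UnitMove u w := ⟨i', j', hij, wi, wj, wl⟩
    have hdist : sumDist w v = 2 * n := by
      have h1 : ∀ l, |w l - v l| = |u l - v l| - (if l = i' then 1 else 0)
          - (if l = j' then 1 else 0) := by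
        intro l
        by_cases h1 : l = i'
        · subst h1
          rw [wi, abs_of_nonpos (by omega), abs_of_neg (by omega)]
          simp [hij]
          ring
        · by_cases h2 : l = j'
          · subst h2
            rw [wj, abs_of_nonneg (by omega), abs_of_pos (by omega)]
            simp [h1]
            omega
          · simp [h1, h2, wl l h1 h2]
      have h2 : sumDist w v = sumDist u v - 1 - 1 := by
        simp only [sumDist, h1, Finset.sum_sub_distrib]
        simp
      push_cast at hd
      omega
    refine ⟨⟨⟨i', j', gj⟩, hb⟩, w, hmove, ?_⟩
    refine exists_walk_between v hv n x w i' j' (hmove.sum_eq.symm.trans hs) hdist (by omega)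
      (by omega) (fun l h1 h2 => by rw [wl l h1 h2]; exact gj l h1 h2) fun l => ?_
    by_cases h1 : l = i'
    · subst h1; have := hb l; omega
    · by_cases h2 : l = j'
      · subst h2; have := hb l; omega
      · rw [wl l h1 h2]; exact hb l

/-! ### Chains of vectors of the same shape -/

/-- Two vectors agree except for coordinates that have distance at least `θ` from their bounds. -/
def SameShape (θ : ℕ) (m : Fin p → ℕ) (x y : Fin p → ℤ) : Prop :=
  ∀ i, x i = y i ∨ ((θ : ℤ) ≤ x i ∧ x i + θ ≤ m i ∧ (θ : ℤ) ≤ y i ∧ y i + θ ≤ m i)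

/-- A finite sequence of vectors in `A` with constant sum in which consecutive vectors have the same
shape or differ by a unit move. -/
structure ShapeChain (θ : ℕ) (m : Fin p → ℕ) (A : (Fin p → ℤ) → Prop) (s s' : Fin p → ℤ) (N : ℕ)
    (x : ℕ → Fin p → ℤ) : Prop where
  start : x 0 = s
  finish : x N = s'
  mem : ∀ t ≤ N, A (x t)
  sum_eq : ∀ t < N, ∑ i, x t i = ∑ i, x (t + 1) i
  link : ∀ t < N, SameShape θ m (x t) (x (t + 1)) ∨ UnitMove (x t) (x (t + 1))

/-- The length of a sequence of vectors in the sum norm. -/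
def chainLength (N : ℕ) (x : ℕ → Fin p → ℤ) : ℤ := ∑ t ∈ Finset.range N, sumDist (x t) (x (t + 1))

theorem chainLength_nonneg (N : ℕ) (x : ℕ → Fin p → ℤ) : 0 ≤ chainLength N x :=
  Finset.sum_nonneg fun _ _ => sumDist_nonneg _ _

variable {θ : ℕ} {m : Fin p → ℕ} {A : (Fin p → ℤ) → Prop} {s s' : Fin p → ℤ}

theorem Walk.exists_shapeChain {n : ℕ} (h : Walk A n s s') :
    ∃ x, ShapeChain θ m A s s' n x ∧ chainLength n x = 2 * n := by
  induction n generalizing s with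
  | zero =>
    obtain ⟨hs, rfl⟩ := h
    exact ⟨fun _ => s, ⟨rfl, rfl, fun _ _ => hs, by simp, by simp⟩, by simp [chainLength]⟩
  | succ n ih =>
    obtain ⟨hs, z, hz, h⟩ := h
    obtain ⟨x, hx, hl⟩ := ih h
    refine ⟨fun t => Nat.casesOn t s x, ⟨rfl, hx.finish, ?_, ?_, ?_⟩, ?_⟩
    · rintro (_ | t) ht
      · exact hs
      · exact hx.mem t (by omega)
    · rintro (_ | t) ht
      · simpa [hx.start] using hz.sum_eq
      · exact hx.sum_eq t (by omega)
    · rintro (_ | t) ht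
      · simpa [hx.start] using Or.inr hz
      · exact hx.link t (by omega)
    · have h0 : sumDist s (x 0) = 2 := by rw [hx.start]; exact hz.sumDist_eq
      have hl' : ∑ t ∈ Finset.range n, sumDist (x t) (x (t + 1)) = 2 * n := hl
      rw [chainLength, Finset.sum_range_succ']
      push_cast
      change (∑ t ∈ Finset.range n, sumDist (x t) (x (t + 1))) + sumDist s (x 0) = _
      rw [h0, hl']
      ring

theorem sumDist_le_sum (x : ℕ → Fin p → ℤ) (a k : ℕ) :
    sumDist (x a) (x (a + k)) ≤ ∑ t ∈ Finset.range k, sumDist (x (a + t)) (x (a + t + 1)) := by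
  induction k with
  | zero => simp [sumDist]
  | succ k ih =>
    rw [Finset.sum_range_succ]
    have := sumDist_triangle (x a) (x (a + k)) (x (a + (k + 1)))
    rw [← add_assoc] at *
    omega

/-- A chain is shortened between two vectors of the same shape. -/
theorem ShapeChain.shorten {a k b : ℕ} {x : ℕ → Fin p → ℤ}
    (hx : ShapeChain θ m A s s' (a + (k + 2) + b) x) (h : SameShape θ m (x a) (x (a + (k + 2)))) :
    ∃ y, ShapeChain θ m A s s' (a + 1 + b) y ∧
      chainLength (a + 1 + b) y ≤ chainLength (a + (k + 2) + b) x := by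
  -- The vectors strictly between the indices `a` and `a + (k + 2)` are removed.
  let y : ℕ → Fin p → ℤ := fun t => if t ≤ a then x t else x (t + (k + 1))
  have y1 : ∀ t ≤ a, y t = x t := fun t ht => if_pos ht
  have y2 : ∀ t, y (a + 1 + t) = x (a + (k + 2) + t) := fun t => by
    simp only [y]
    rw [if_neg (by omega)]
    congr 1
    omega
  have hsum : ∀ t ≤ a + (k + 2) + b, ∑ i, x t i = ∑ i, x 0 i := by
    intro t
    induction t with
    | zero => simp
    | succ t ih => intro ht; rw [← hx.sum_eq t (by omega), ih (by omega)]
  have hcase : ∀ t < a + 1 + b, t < a ∨ t = a ∨ ∃ u < b, t = a + 1 + u := by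
    intro t ht
    rcases lt_trichotomy t a with h | h | h
    · exact .inl h
    · exact .inr (.inl h)
    · exact .inr (.inr ⟨t - (a + 1), by omega, by omega⟩)
  refine ⟨y, ⟨?_, ?_, ?_, ?_, ?_⟩, ?_⟩
  · rw [y1 0 (by omega)]; exact hx.start
  · rw [y2]; exact hx.finish
  · intro t ht
    rcases Nat.lt_or_ge a t with h | h
    · obtain ⟨u, rfl⟩ : ∃ u, t = a + 1 + u := ⟨t - (a + 1), by omega⟩
      rw [y2]; exact hx.mem _ (by omega)
    · rw [y1 t h]; exact hx.mem t (by omega)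
  · intro t ht
    rcases hcase t ht with h | rfl | ⟨u, hu, rfl⟩
    · rw [y1 t h.le, y1 (t + 1) h]; exact hx.sum_eq t (by omega)
    · have := y2 0
      rw [add_zero, add_zero] at this
      rw [y1 t le_rfl, this, hsum t (by omega), hsum (t + (k + 2)) (by omega)]
    · rw [add_assoc (a + 1) u 1, y2, y2]; exact hx.sum_eq _ (by omega)
  · intro t ht
    rcases hcase t ht with h | rfl | ⟨u, hu, rfl⟩
    · rw [y1 t h.le, y1 (t + 1) h]; exact hx.link t (by omega)
    · have := y2 0
      rw [add_zero, add_zero] at this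
      rw [y1 t le_rfl, this]
      exact .inl h
    · rw [add_assoc (a + 1) u 1, y2, y2]; exact hx.link _ (by omega)
  · unfold chainLength
    rw [Finset.sum_range_add _ (a + 1) b, Finset.sum_range_add _ a 1, Finset.sum_range_add _ (a + (k + 2)) b,
      Finset.sum_range_add _ a (k + 2), Finset.sum_range_one]
    have e1 : ∑ t ∈ Finset.range a, sumDist (y t) (y (t + 1)) =
        ∑ t ∈ Finset.range a, sumDist (x t) (x (t + 1)) := by
      refine Finset.sum_congr rfl fun t ht => ?_
      have := Finset.mem_range.1 ht
      rw [y1 t (by omega), y1 (t + 1) (by omega)]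
    have e2 : ∑ t ∈ Finset.range b, sumDist (y (a + 1 + t)) (y (a + 1 + t + 1)) =
        ∑ t ∈ Finset.range b, sumDist (x (a + (k + 2) + t)) (x (a + (k + 2) + t + 1)) := by
      refine Finset.sum_congr rfl fun t _ => ?_
      rw [add_assoc (a + 1) t 1, y2, y2, add_assoc (a + (k + 2)) t 1]
    have e3 := sumDist_le_sum x a (k + 2)
    have e4 := y2 0
    rw [add_zero, add_zero] at e4
    rw [e1, e2, add_zero, e4, y1 a le_rfl]
    omega

/-- A code for the shape of a number. -/
def shapeCode (θ m : ℕ) (z : ℤ) : ℤ :=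
  if z < θ then z else if m < z + θ then θ + (m - z) else 2 * θ

/-- There are `(2 * θ + 1) ^ p` codes, and equal codes mean the same shape. If the chain is longer
than twice this number, some code occurs at least three times; its first and last occurrence are
then at least two steps apart, so that joining them directly removes a vector. -/
theorem ShapeChain.exists_short (hA : ∀ x, A x → ∀ i, 0 ≤ x i ∧ x i ≤ m i) {n : ℕ}
    {x : ℕ → Fin p → ℤ} (hx : ShapeChain θ m A s s' n x) :
    ∃ N y, N + 1 ≤ 2 * (2 * θ + 1) ^ p ∧ ShapeChain θ m A s s' N y ∧
      chainLength N y ≤ chainLength n x := by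
  induction n using Nat.strong_induction_on generalizing x with
  | _ n ih =>
    by_cases hn : n + 1 ≤ 2 * (2 * θ + 1) ^ p
    · exact ⟨n, x, hn, hx, le_rfl⟩
    · let code : ℕ → Fin p → ℤ := fun t i => shapeCode θ (m i) (x t i)
      let T : Finset (Fin p → ℤ) := Fintype.piFinset fun _ => Finset.Ico (0 : ℤ) (2 * θ + 1)
      have hT : T.card = (2 * θ + 1) ^ p := by
        rw [Fintype.card_piFinset]
        simp
        norm_cast
      have hmaps : ∀ t ∈ Finset.range (n + 1), code t ∈ T := by
        intro t ht
        rw [Fintype.mem_piFinset]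
        intro i
        have := hA _ (hx.mem t (by have := Finset.mem_range.1 ht; omega)) i
        rw [Finset.mem_Ico]
        simp only [code, shapeCode]
        split_ifs <;> omega
      obtain ⟨c, -, hc⟩ := Finset.exists_lt_card_fiber_of_mul_lt_card_of_maps_to hmaps
        (n := 2) (by rw [hT, Finset.card_range]; omega)
      set F := (Finset.range (n + 1)).filter fun t => code t = c with hF
      have hne : F.Nonempty := Finset.card_pos.1 (by omega)
      have hsub : F ⊆ Finset.Icc (F.min' hne) (F.max' hne) := fun t ht =>
        Finset.mem_Icc.2 ⟨F.min'_le t ht, F.le_max' t ht⟩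
      have hcard := Finset.card_le_card hsub
      rw [Nat.card_Icc] at hcard
      have ha := Finset.mem_filter.1 (F.min'_mem hne)
      have hb := Finset.mem_filter.1 (F.max'_mem hne)
      generalize F.min' hne = a at *
      generalize F.max' hne = d at *
      have hd : d ≤ n := by have := Finset.mem_range.1 hb.1; omega
      obtain ⟨k, hk⟩ : ∃ k, d = a + (k + 2) := ⟨d - a - 2, by omega⟩
      obtain ⟨b, rfl⟩ : ∃ b, n = a + (k + 2) + b := ⟨n - d, by omega⟩
      have hshape : SameShape θ m (x a) (x (a + (k + 2))) := by
        intro i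
        have h1 : code a i = code (a + (k + 2)) i := by rw [← hk, ha.2, hb.2]
        have h2 := hA _ (hx.mem a (by omega)) i
        have h3 := hA _ (hx.mem (a + (k + 2)) (by omega)) i
        simp only [code, shapeCode] at h1
        split_ifs at h1 <;> omega
      obtain ⟨y, hy, hl⟩ := hx.shorten hshape
      obtain ⟨N, z, h1, h2, h3⟩ := ih _ (by omega) hy
      exact ⟨N, z, h1, h2, h3.trans hl⟩

end Walks

/-! ### Extremal chains -/

section Extremal

variable {p : ℕ} {θ : ℕ} {m : Fin p → ℕ} {A : (Fin p → ℤ) → Prop} {s s' : Fin p → ℤ}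

/-- `z` is an integer combination of the numbers `m i` and `1` with coefficients at most `B`. -/
def IsCombo (m : Fin p → ℕ) (B : ℕ) (z : ℤ) : Prop :=
  ∃ (a : Fin p → ℤ) (b : ℤ), (∀ i, |a i| ≤ B) ∧ |b| ≤ B ∧ z = ∑ i, a i * m i + b

theorem IsCombo.mono {B B' : ℕ} {z : ℤ} (h : IsCombo m B z) (hB : B ≤ B') : IsCombo m B' z := by
  obtain ⟨a, b, ha, hb, hz⟩ := h
  have : (B : ℤ) ≤ B' := by exact_mod_cast hB
  exact ⟨a, b, fun i => (ha i).trans this, hb.trans this, hz⟩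

theorem IsCombo.of_abs_le {B : ℕ} {z : ℤ} (h : |z| ≤ B) : IsCombo m B z :=
  ⟨0, z, by simp, h, by simp⟩

theorem IsCombo.of_sub {B : ℕ} {z : ℤ} (i : Fin p) (hB : 1 ≤ B) (h : |z - m i| ≤ B) :
    IsCombo m B z := by
  refine ⟨Pi.single i 1, z - m i, fun j => ?_, h, ?_⟩
  · by_cases hj : j = i
    · subst hj; simp; omega
    · simp [hj]
  · simp [Pi.single_apply]

theorem IsCombo.sum {ι : Type} [Fintype ι] {B C r : ℕ} (hr : Fintype.card ι ≤ r) {c z : ι → ℤ}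
    (hc : ∀ k, |c k| ≤ C) (hz : ∀ k, IsCombo m B (z k)) :
    IsCombo m (r * C * B) (∑ k, c k * z k) := by
  choose a b ha hb he using hz
  have bound : ∀ f : ι → ℤ, (∀ k, |f k| ≤ B) → |∑ k, c k * f k| ≤ ((r * C * B : ℕ) : ℤ) := by
    intro f hf
    refine (Finset.abs_sum_le_sum_abs _ _).trans ?_
    have : ∀ k ∈ Finset.univ, |c k * f k| ≤ (C * B : ℤ) := by
      intro k _
      rw [abs_mul]
      exact mul_le_mul (hc k) (hf k) (abs_nonneg _) (by positivity)
    refine (Finset.sum_le_card_nsmul _ _ _ this).trans ?_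
    rw [nsmul_eq_mul, Finset.card_univ]
    push_cast
    rw [mul_assoc]
    gcongr
  refine ⟨fun i => ∑ k, c k * a k i, ∑ k, c k * b k, fun i => bound _ fun k => ha k i,
    bound _ hb, ?_⟩
  simp only [he, mul_add, Finset.sum_add_distrib, Finset.sum_mul, Finset.mul_sum]
  rw [Finset.sum_comm]
  simp only [mul_assoc]

/-- Bound for the entries of a small solution of the linear system of a chain with `n` vectors. -/
def kernelBound (n p : ℕ) : ℕ := (n * p * (n + 2 * (n * p))) ^ (n * p)

/-- Bound for the coefficients of the coordinates of an extremal chain with `n` vectors. -/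
def comboBound (θ n p : ℕ) : ℕ :=
  (n + 2 * (n * p)) * (n * p * kernelBound n p) * (θ + 2 * kernelBound n p + 1) + kernelBound n p

theorem one_le_kernelBound {n : ℕ} (p : ℕ) (hn : 1 ≤ n) : 1 ≤ kernelBound n p := by
  unfold kernelBound
  rcases Nat.eq_zero_or_pos p with rfl | hp
  · simp
  · exact Nat.one_le_pow _ _ (by positivity)

/-- A multiple of `z` by a number at most `B` is a combination with coefficients at most `B`. -/
def IsRatCombo (m : Fin p → ℕ) (B : ℕ) (z : ℤ) : Prop :=
  ∃ D : ℤ, 1 ≤ D ∧ D ≤ B ∧ IsCombo m B (D * z)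

theorem IsRatCombo.mono {B B' : ℕ} {z : ℤ} (h : IsRatCombo m B z) (hB : B ≤ B') :
    IsRatCombo m B' z := by
  obtain ⟨D, h1, h2, h3⟩ := h
  exact ⟨D, h1, h2.trans (by exact_mod_cast hB), h3.mono hB⟩

/-- The perturbations that do not change the shape of a chain. -/
structure Perturbation (θ : ℕ) (m : Fin p → ℕ) (R N : ℕ) (x δ : ℕ → Fin p → ℤ) : Prop where
  sum_eq : ∀ t ≤ N, ∑ i, δ t i = 0
  ends : ∀ i, δ 0 i = 0 ∧ δ N i = 0
  bounded : ∀ t i, |δ t i| ≤ R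
  deep : ∀ t ≤ N, ∀ i, δ t i = 0 ∨ ((θ + R : ℤ) ≤ x t i ∧ x t i + θ + R ≤ m i)
  tight : ∀ t < N, ∀ i, |x t i - x (t + 1) i| ≤ 2 * R → δ t i = δ (t + 1) i

theorem Perturbation.neg {R N : ℕ} {x δ : ℕ → Fin p → ℤ} (h : Perturbation θ m R N x δ) :
    Perturbation θ m R N x (-δ) where
  sum_eq t ht := by simp [h.sum_eq t ht]
  ends i := by simp [h.ends i]
  bounded t i := by simpa using h.bounded t i
  deep t ht i := by simpa using h.deep t ht i
  tight t ht i hti := by simpa using h.tight t ht i hti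

/-- Only coordinates at distance at least `θ + R` from both bounds change, by at most `R`, so every
vector keeps its shape. Differences up to `2 * R` are preserved, in particular those of equal
coordinates and, as `1 ≤ R`, those in unit moves. -/
theorem Perturbation.shapeChain {R N : ℕ} {x δ : ℕ → Fin p → ℤ} (h : Perturbation θ m R N x δ)
    (hR : 1 ≤ R) (hA : ∀ x y, A x → SameShape θ m x y → A y) (hx : ShapeChain θ m A s s' N x) :
    ShapeChain θ m A s s' N (x + δ) where
  start := by rw [← hx.start]; funext i; simp [(h.ends i).1]
  finish := by rw [← hx.finish]; funext i; simp [(h.ends i).2]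
  mem t ht := by
    refine hA _ _ (hx.mem t ht) fun i => ?_
    have h1 := abs_le.1 (h.bounded t i)
    have h2 := h.deep t ht i
    simp only [Pi.add_apply]
    omega
  sum_eq t ht := by
    simp only [Pi.add_apply, Finset.sum_add_distrib, h.sum_eq t ht.le, h.sum_eq (t + 1) ht,
      hx.sum_eq t ht]
  link t ht := by
    rcases hx.link t ht with hl | hl
    · refine .inl fun i => ?_
      have h1 := abs_le.1 (h.bounded t i)
      have h2 := h.deep t ht.le i
      have h3 := abs_le.1 (h.bounded (t + 1) i)
      have h4 := h.deep (t + 1) ht i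
      have h5 := h.tight t ht i
      simp only [Pi.add_apply]
      rcases hl i with h6 | h6
      · rw [h6, sub_self] at h5
        have := h5 (by simp)
        omega
      · omega
    · right
      have hδ : ∀ i, δ t i = δ (t + 1) i := fun i =>
        h.tight t ht i ((hl.abs_le i).trans (by omega))
      obtain ⟨i, j, hij, hi, hj, h0⟩ := hl
      refine ⟨i, j, hij, ?_, ?_, fun l h1 h2 => ?_⟩
      · simp only [Pi.add_apply, hi, hδ]; ring
      · simp only [Pi.add_apply, hj, hδ]; ring
      · simp only [Pi.add_apply, h0 l h1 h2, hδ]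

/-- A difference up to `2 * R` does not change at all. A larger one keeps its sign because both of
its terms move by at most `R`, so its absolute value is affine in the perturbation. -/
theorem Perturbation.chainLength_add {R N : ℕ} {x δ : ℕ → Fin p → ℤ}
    (h : Perturbation θ m R N x δ) :
    chainLength N (x + δ) + chainLength N (x + -δ) = 2 * chainLength N x := by
  unfold chainLength sumDist
  rw [← Finset.sum_add_distrib, Finset.mul_sum]
  refine Finset.sum_congr rfl fun t ht => ?_
  rw [← Finset.sum_add_distrib, Finset.mul_sum]
  refine Finset.sum_congr rfl fun i _ => ?_
  have ht := Finset.mem_range.1 ht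
  simp only [Pi.add_apply, Pi.neg_apply]
  by_cases hti : |x t i - x (t + 1) i| ≤ 2 * R
  · rw [h.tight t ht i hti]
    ring_nf
  · have h1 := abs_le.1 (h.bounded t i)
    have h3 := abs_le.1 (h.bounded (t + 1) i)
    push Not at hti
    rcases lt_abs.1 hti with h4 | h4
    · rw [abs_of_pos (by omega), abs_of_pos (by omega), abs_of_pos (by omega)]
      ring
    · rw [abs_of_neg (by omega), abs_of_neg (by omega), abs_of_neg (by omega)]
      ring

theorem exists_argmin {α : Type} {P : α → Prop} (h : ∃ a, P a) (f : α → ℕ) :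
    ∃ a, P a ∧ ∀ b, P b → f a ≤ f b := by
  classical
  have h' : ∃ n, ∃ a, P a ∧ f a = n := let ⟨a, ha⟩ := h; ⟨_, a, ha, rfl⟩
  obtain ⟨a, ha, hn⟩ := Nat.find_spec h'
  exact ⟨a, ha, fun b hb => hn ▸ Nat.find_min' h' ⟨b, hb, rfl⟩⟩

/-- There is a shortest chain that has no nontrivial perturbation. -/
theorem ShapeChain.exists_extremal (hA : ∀ x y, A x → SameShape θ m x y → A y)
    (hm : ∀ x, A x → ∀ i, 0 ≤ x i ∧ x i ≤ m i) {R N : ℕ} (hR : 1 ≤ R) {x : ℕ → Fin p → ℤ}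
    (hx : ShapeChain θ m A s s' N x) :
    ∃ y, ShapeChain θ m A s s' N y ∧ chainLength N y ≤ chainLength N x ∧
      ∀ δ, Perturbation θ m R N y δ → ∀ t ≤ N, ∀ i, δ t i = 0 := by
  obtain ⟨x₁, hx₁, hmin⟩ := exists_argmin ⟨x, hx⟩ fun y => (chainLength N y).toNat
  -- The sum of squares decides between shortest chains. By the parallelogram identity one of `y +
  -- δ` and `y - δ` exceeds `y` unless `δ` vanishes. The bound `M` turns maximization into
  -- minimization over natural numbers.
  let sq : (ℕ → Fin p → ℤ) → ℤ := fun y => ∑ t ∈ Finset.range (N + 1), ∑ i, y t i ^ 2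
  let M : ℤ := ∑ t ∈ Finset.range (N + 1), ∑ i, (m i : ℤ) ^ 2
  have hsq : ∀ y, ShapeChain θ m A s s' N y → sq y ≤ M := by
    intro y hy
    refine Finset.sum_le_sum fun t ht => Finset.sum_le_sum fun i _ => ?_
    have := hm _ (hy.mem t (by have := Finset.mem_range.1 ht; omega)) i
    exact pow_le_pow_left₀ this.1 this.2 2
  obtain ⟨y, ⟨hy, hyl⟩, hmax⟩ := exists_argmin
    (P := fun y => ShapeChain θ m A s s' N y ∧ chainLength N y ≤ chainLength N x₁)
    ⟨x₁, hx₁, le_rfl⟩ fun y => (M - sq y).toNat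
  have hmin' : ∀ z, ShapeChain θ m A s s' N z → chainLength N x₁ ≤ chainLength N z := by
    intro z hz
    have h1 := hmin z hz
    have h2 := chainLength_nonneg N x₁
    have h3 := chainLength_nonneg N z
    omega
  refine ⟨y, hy, hyl.trans (hmin' x hx), fun δ hδ => ?_⟩
  have c1 := hδ.shapeChain hR hA hy
  have c2 := hδ.neg.shapeChain hR hA hy
  have hl := hδ.chainLength_add
  have l1 := hmin' _ c1
  have l2 := hmin' _ c2
  have m1 := hmax _ ⟨c1, by omega⟩
  have m2 := hmax _ ⟨c2, by omega⟩
  have s1 := hsq _ c1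
  have s2 := hsq _ c2
  have s3 := hsq _ hy
  have hsum : sq (y + δ) + sq (y + -δ) = 2 * sq y + 2 * sq δ := by
    simp only [sq, Finset.mul_sum, ← Finset.sum_add_distrib]
    refine Finset.sum_congr rfl fun t _ => Finset.sum_congr rfl fun i _ => ?_
    simp only [Pi.add_apply, Pi.neg_apply]
    ring
  have hle : sq δ ≤ 0 := by
    omega
  have h0 : sq δ = 0 :=
    le_antisymm hle (Finset.sum_nonneg fun t _ => Finset.sum_nonneg fun i _ => sq_nonneg _)
  intro t ht i
  have h1 := (Finset.sum_eq_zero_iff_of_nonneg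
    (fun t _ => Finset.sum_nonneg fun i _ => sq_nonneg (δ t i))).1 h0 t
      (Finset.mem_range.2 (by omega))
  have h2 := (Finset.sum_eq_zero_iff_of_nonneg (fun i _ => sq_nonneg (δ t i))).1 h1 i
    (Finset.mem_univ i)
  exact pow_eq_zero_iff (two_ne_zero) |>.1 h2

open Classical in
/-- The linear system of a chain: the sum of each vector, the coordinates near a bound or in an end
of the chain, and the small differences between consecutive vectors. -/
noncomputable def chainMatrix (N : ℕ) (pin tgt : Fin (N + 1) → Fin p → Prop) :
    Matrix (Fin (N + 1) ⊕ (Fin (N + 1) × Fin p) ⊕ (Fin (N + 1) × Fin p)) (Fin (N + 1) × Fin p) ℤ :=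
  fun row col => match row with
    | .inl t => if col.1 = t then 1 else 0
    | .inr (.inl k) => if pin k.1 k.2 ∧ col = k then 1 else 0
    | .inr (.inr k) => if tgt k.1 k.2 then
        (if col = k then 1 else 0) - (if col.1.val = k.1.val + 1 ∧ col.2 = k.2 then 1 else 0) else 0

/-- A small kernel vector of the linear system would be a perturbation of the extremal chain, so the
system determines the chain. Its right-hand sides have short descriptions: the constant sum is a sum
of some `m i` because `s` is a corner, a pinned coordinate is close to `0` or to `m j`, and the
remaining entries are small differences. Cramer's rule carries this over to the coordinates. -/
theorem ShapeChain.exists_isRatCombo (hA : ∀ x y, A x → SameShape θ m x y → A y)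
    (hm : ∀ x, A x → ∀ i, 0 ≤ x i ∧ x i ≤ m i) (hs : ∀ i, s i = 0 ∨ s i = m i)
    (hs' : ∀ i, s' i = 0 ∨ s' i = m i) {N : ℕ} {x : ℕ → Fin p → ℤ}
    (hx : ShapeChain θ m A s s' N x) :
    ∃ y, ShapeChain θ m A s s' N y ∧ chainLength N y ≤ chainLength N x ∧
      ∀ t ≤ N, ∀ i, IsRatCombo m (comboBound θ (N + 1) p) (y t i) := by
  classical
  set R := kernelBound (N + 1) p with hRdef
  have hR : 1 ≤ R := one_le_kernelBound p (by omega)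
  obtain ⟨y, hy, hyl, hext⟩ := hx.exists_extremal hA hm hR
  refine ⟨y, hy, hyl, ?_⟩
  -- The coordinates at which `Perturbation.ends` or `Perturbation.deep` forces a perturbation to
  -- vanish.
  let pin : Fin (N + 1) → Fin p → Prop := fun t i =>
    t.val = 0 ∨ t.val = N ∨ y t i < θ + R ∨ (m i : ℤ) < y t i + θ + R
  let tgt : Fin (N + 1) → Fin p → Prop := fun t i =>
    t.val < N ∧ |y t i - y (t.val + 1) i| ≤ 2 * R
  let M := chainMatrix N pin tgt
  have hM1 : ∀ row col, |M row col| ≤ 1 := by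
    intro row col
    rcases row with t | k | k <;> simp only [M, chainMatrix] <;> split_ifs <;> simp
  have row1 : ∀ (v : Fin (N + 1) × Fin p → ℤ) t, M.mulVec v (.inl t) = ∑ i, v (t, i) := by
    intro v t
    simp [M, chainMatrix, Matrix.mulVec, dotProduct, Fintype.sum_prod_type]
    rw [Finset.sum_comm]
    simp
  have row2 : ∀ (v : Fin (N + 1) × Fin p → ℤ) k,
      M.mulVec v (.inr (.inl k)) = if pin k.1 k.2 then v k else 0 := by
    intro v k
    by_cases h : pin k.1 k.2
    · simp [M, chainMatrix, Matrix.mulVec, dotProduct, h]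
    · simp [M, chainMatrix, Matrix.mulVec, dotProduct, h]
  have row3 : ∀ (v : Fin (N + 1) × Fin p → ℤ) (t : Fin (N + 1)) (i : Fin p) (h : tgt t i),
      M.mulVec v (.inr (.inr (t, i))) = v (t, i) - v (⟨t.val + 1, by have := h.1; omega⟩, i) := by
    intro v t i h
    have e : ∀ col : Fin (N + 1) × Fin p, (col.1.val = t.val + 1 ∧ col.2 = i) ↔
        col = (⟨t.val + 1, by have := h.1; omega⟩, i) := by
      intro col
      rw [Prod.ext_iff]
      exact and_congr_left fun _ => (Fin.ext_iff (b := ⟨t.val + 1, by have := h.1; omega⟩)).symm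
    simp [M, chainMatrix, Matrix.mulVec, dotProduct, h, e, sub_mul]
  have row4 : ∀ (v : Fin (N + 1) × Fin p → ℤ) (t : Fin (N + 1)) (i : Fin p), ¬ tgt t i →
      M.mulVec v (.inr (.inr (t, i))) = 0 := by
    intro v t i h
    simp [M, chainMatrix, Matrix.mulVec, dotProduct, h]
  have hcols : Fintype.card (Fin (N + 1) × Fin p) = (N + 1) * p := by simp
  have hrows : Fintype.card (Fin (N + 1) ⊕ (Fin (N + 1) × Fin p) ⊕ (Fin (N + 1) × Fin p)) ≤
      N + 1 + 2 * ((N + 1) * p) := by simp; omega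
  -- With `q` columns and a bound `r` on the number of rows, `kernelBound` is `(q * r) ^ q`, and `q!
  -- ≤ q ^ q`.
  have hfac : ((N + 1) * p).factorial * (N + 1 + 2 * ((N + 1) * p)) ^ ((N + 1) * p) ≤ R := by
    rw [hRdef, kernelBound, mul_pow]
    exact Nat.mul_le_mul_right _ (Nat.factorial_le_pow _)
  rcases exists_small_kernel_or_inverse hrows (by omega) hcols hfac M hM1 with
    ⟨δ, h0, hk, hb⟩ | ⟨D, C, hD, hDR, hC, hinv⟩
  · exfalso
    let δ' : ℕ → Fin p → ℤ := fun t i => if h : t < N + 1 then δ (⟨t, h⟩, i) else 0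
    have hδ' : ∀ t (h : t < N + 1) i, δ' t i = δ (⟨t, h⟩, i) := fun t h i => dif_pos h
    have hpin : ∀ t (h : t < N + 1) i, pin ⟨t, h⟩ i → δ' t i = 0 := by
      intro t h i hp
      have := congrFun hk (.inr (.inl (⟨t, h⟩, i)))
      rw [row2, if_pos hp] at this
      rw [hδ' t h]; exact this
    have hpert : Perturbation θ m R N y δ' := by
      refine ⟨?_, ?_, ?_, ?_, ?_⟩
      · intro t ht
        have := congrFun hk (.inl ⟨t, by omega⟩)
        rw [row1] at this
        simpa [hδ' t (by omega)] using this
      · intro i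
        exact ⟨hpin 0 (by omega) i (.inl rfl), hpin N (by omega) i (.inr (.inl rfl))⟩
      · intro t i
        simp only [δ']
        split_ifs
        · exact hb _
        · simp
      · intro t ht i
        by_cases hp : pin ⟨t, by omega⟩ i
        · exact .inl (hpin t (by omega) i hp)
        · right
          simp only [pin] at hp
          omega
      · intro t ht i hti
        have := congrFun hk (.inr (.inr (⟨t, by omega⟩, i)))
        rw [row3 _ _ _ ⟨ht, hti⟩] at this
        rw [hδ' t (by omega), hδ' (t + 1) (by omega)]
        simpa [sub_eq_zero] using this
    apply h0
    funext ⟨t, i⟩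
    rw [← hδ' t.val t.isLt i]
    exact hext δ' hpert t.val (by omega) i
  · intro t ht i
    -- The summand `kernelBound` of `comboBound` takes care of the denominator `D`, the product of
    -- the coefficients.
    have hDB : R ≤ comboBound θ (N + 1) p := by unfold comboBound; omega
    refine ⟨D, hD, hDR.trans (by exact_mod_cast hDB), ?_⟩
    have hval := hinv (fun k => y k.1 k.2) (⟨t, by omega⟩, i)
    simp only at hval
    rw [hval]
    refine (IsCombo.sum hrows (C := (N + 1) * p * R) (B := θ + 2 * R + 1) (m := m)
      (fun k => by exact_mod_cast hC _ k) ?_).mono (by rw [comboBound, ← hRdef]; omega)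
    rintro (u | ⟨u, j⟩ | ⟨u, j⟩)
    · rw [row1]
      have hsum : ∀ u ≤ N, ∑ i, y u i = ∑ i, s i := by
        intro u
        induction u with
        | zero => intro _; rw [hy.start]
        | succ u ih => intro hu; rw [← hy.sum_eq u (by omega), ih (by omega)]
      simp only
      rw [hsum u (by omega)]
      -- The common sum consists of the `m i` for which the corner `s` is nonzero.
      refine ⟨fun i => if s i = 0 then 0 else 1, 0, ?_, by simp; omega, ?_⟩
      · intro i
        dsimp only
        split_ifs
        · rw [abs_zero]; positivity
        · rw [abs_one]; push_cast; omega
      · simp only [add_zero]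
        refine Finset.sum_congr rfl fun i _ => ?_
        rcases hs i with h | h
        · simp [h]
        · rw [h]
          split_ifs with h'
          · simp [h']
          · simp
    · rw [row2]
      simp only
      split_ifs with hp
      · have hr := hm _ (hy.mem u (by omega)) j
        have hend : ∀ z : ℤ, z = 0 ∨ z = m j → IsCombo m (θ + 2 * R + 1) z := by
          rintro z (rfl | rfl)
          · exact .of_abs_le (by simp; omega)
          · exact .of_sub j (by omega) (by simp; omega)
        rcases hp with h | h | h | h
        · rw [h, hy.start]; exact hend _ (hs j)
        · rw [h, hy.finish]; exact hend _ (hs' j)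
        · exact .of_abs_le (by rw [abs_of_nonneg hr.1]; push_cast; omega)
        · refine .of_sub j (by omega) ?_
          rw [abs_of_nonpos (by omega)]; push_cast; omega
      · exact .of_abs_le (by simp; omega)
    · by_cases h : tgt u j
      · rw [row3 _ _ _ h]
        exact .of_abs_le (h.2.trans (by push_cast; omega))
      · rw [row4 _ _ _ h]
        exact .of_abs_le (by simp; omega)

/-- If there is a walk between two corners, then there is one that is not longer and in which at
any time all but two coordinates have a short description. -/
theorem Walk.exists_restricted (hA : ∀ x y, A x → SameShape θ m x y → A y)
    (hm : ∀ x, A x → ∀ i, 0 ≤ x i ∧ x i ≤ m i) (hs : ∀ i, s i = 0 ∨ s i = m i)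
    (hs' : ∀ i, s' i = 0 ∨ s' i = m i) {n : ℕ} (h : Walk A n s s') {B : ℕ}
    (hB : ∀ k ≤ 2 * (2 * θ + 1) ^ p, comboBound θ k p ≤ B) :
    ∃ n' ≤ n, Walk (fun x => A x ∧ ∃ b : Finset (Fin p), b.card ≤ 2 ∧
      ∀ l ∉ b, IsRatCombo m B (x l)) n' s s' := by
  obtain ⟨x₀, hx₀, hl₀⟩ := h.exists_shapeChain (θ := θ) (m := m)
  obtain ⟨N, x₁, hN, hx₁, hl₁⟩ := hx₀.exists_short hm
  obtain ⟨x, hx, hl, hc⟩ := hx₁.exists_isRatCombo hA hm hs hs'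
  set Q : (Fin p → ℤ) → Prop := fun x => A x ∧ ∃ b : Finset (Fin p), b.card ≤ 2 ∧
      ∀ l ∉ b, IsRatCombo m B (x l) with hQ
  have hgood : ∀ t ≤ N, ∀ i, IsRatCombo m B (x t i) := fun t ht i => (hc t ht i).mono (hB _ hN)
  have hmemQ : ∀ t ≤ N, Q (x t) := fun t ht =>
    ⟨hx.mem t ht, ∅, by simp, fun l _ => hgood t ht l⟩
  have hmono : ∀ {P P' : (Fin p → ℤ) → Prop} {n : ℕ} {u v : Fin p → ℤ}, (∀ w, P w → P' w) →
      Walk P n u v → Walk P' n u v := by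
    intro P P' n u v hP
    induction n generalizing u with
    | zero => exact fun h => ⟨hP _ h.1, h.2⟩
    | succ n ih => rintro ⟨h1, z, h2, h3⟩; exact ⟨hP _ h1, z, h2, ih h3⟩
  have hstep : ∀ t < N, ∃ k : ℕ, sumDist (x t) (x (t + 1)) = 2 * k ∧
      Walk Q k (x t) (x (t + 1)) := by
    intro t ht
    rcases hx.link t ht with hl | hl
    -- Each `|d|` has the parity of `d`, and the differences `d` of two vectors with equal sums add
    -- up to `0`.
    · have heven : ∃ k : ℕ, sumDist (x t) (x (t + 1)) = 2 * k := by
        have h1 : Even (sumDist (x t) (x (t + 1)) - ∑ i, (x t i - x (t + 1) i)) := by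
          rw [sumDist, ← Finset.sum_sub_distrib]
          refine Finset.even_sum _ fun i _ => ?_
          rcases abs_choice (x t i - x (t + 1) i) with h | h <;> rw [h]
          · simp
          · exact ⟨-(x t i - x (t + 1) i), by ring⟩
        rw [Finset.sum_sub_distrib, hx.sum_eq t ht, sub_self, sub_zero] at h1
        obtain ⟨k, hk⟩ := h1
        have := sumDist_nonneg (x t) (x (t + 1))
        exact ⟨k.toNat, by omega⟩
      obtain ⟨k, hk⟩ := heven
      refine ⟨k, hk, ?_⟩
      -- Without coordinates there is no initial pair `i`, `j` for the straight walk.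
      by_cases hp : p = 0
      · subst hp
        have hk0 : k = 0 := by
          have : sumDist (x t) (x (t + 1)) = 0 := by simp [sumDist]
          omega
        subst hk0
        exact ⟨hmemQ t ht.le, Subsingleton.elim _ _⟩
      · have hex : ∃ i j, x t i ≤ x (t + 1) i ∧ x (t + 1) j ≤ x t j := by
          have hne : (Finset.univ : Finset (Fin p)).Nonempty := ⟨⟨0, by omega⟩, Finset.mem_univ _⟩
          obtain ⟨i, -, hi⟩ := Finset.exists_le_of_sum_le hne (hx.sum_eq t ht).le
          obtain ⟨j, -, hj⟩ := Finset.exists_le_of_sum_le hne (hx.sum_eq t ht).ge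
          exact ⟨i, j, hi, hj⟩
        obtain ⟨i, j, hi, hj⟩ := hex
        refine hmono ?_ (exists_walk_between (G := fun _ => IsRatCombo m B) (x (t + 1))
          (hgood (t + 1) ht) k (x t) (x t) i j (hx.sum_eq t ht) hk hi hj
          (fun l _ _ => hgood t ht.le l) fun l => by omega)
        rintro w ⟨⟨a, b, hab⟩, hw⟩
        -- A number between two numbers of the same shape has this shape too, so the straight walk
        -- does not leave `A`.
        refine ⟨hA _ _ (hx.mem t ht.le) fun l => ?_, {a, b}, Finset.card_le_two, fun l hl => ?_⟩
        · have h1 := hl l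
          have h2 := hw l
          omega
        · simp only [Finset.mem_insert, Finset.mem_singleton, not_or] at hl
          exact hab l hl.1 hl.2
    · exact ⟨1, by simpa using hl.sumDist_eq, hmemQ t ht.le, _, hl, hmemQ (t + 1) ht, rfl⟩
  have hall : ∀ u ≤ N, ∃ k : ℕ, chainLength u x = 2 * k ∧ Walk Q k (x 0) (x u) := by
    intro u
    induction u with
    | zero => exact fun _ => ⟨0, by simp [chainLength], hmemQ 0 (by omega), rfl⟩
    | succ u ih =>
      intro hu
      obtain ⟨k, hk, hw⟩ := ih (by omega)
      obtain ⟨k', hk', hw'⟩ := hstep u (by omega)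
      refine ⟨k + k', ?_, hw.trans hw'⟩
      rw [chainLength, Finset.sum_range_succ, hk']
      rw [chainLength] at hk
      rw [hk]
      push_cast
      ring
  obtain ⟨k, hk, hw⟩ := hall N le_rfl
  rw [hx.start, hx.finish] at hw
  -- Both `2 * k` and `2 * n` are lengths of chains in the sum norm, and no construction has
  -- increased this length.
  exact ⟨k, by omega, hw⟩

end Extremal

/-! ### Formulas cannot count far -/

namespace MSO1

/-- Truth of a formula with quantifiers restricted to a set of vertices. -/
def HoldsOn {n c : ℕ} (G : ColoredGraph n c) (K : Finset (Fin n)) :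
    {v s : ℕ} → MSO1 c v s → (Fin v → Fin n) → (Fin s → Finset (Fin n)) → Prop
  | _, _, eq i j, x, _ => x i = x j
  | _, _, adj i j, x, _ => G.graph.Adj (x i) (x j)
  | _, _, color a i, x, _ => x i ∈ G.color a
  | _, _, mem j i, x, X => x i ∈ X j
  | _, _, not φ, x, X => ¬ φ.HoldsOn G K x X
  | _, _, and φ ψ, x, X => φ.HoldsOn G K x X ∧ ψ.HoldsOn G K x X
  | _, _, or φ ψ, x, X => φ.HoldsOn G K x X ∨ ψ.HoldsOn G K x X
  | _, _, imp φ ψ, x, X => φ.HoldsOn G K x X → ψ.HoldsOn G K x X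
  | _, _, iff φ ψ, x, X => (φ.HoldsOn G K x X ↔ ψ.HoldsOn G K x X)
  | _, _, allV φ, x, X => ∀ u ∈ K, φ.HoldsOn G K (Fin.cons u x) X
  | _, _, exV φ, x, X => ∃ u ∈ K, φ.HoldsOn G K (Fin.cons u x) X
  | _, _, allS φ, x, X => ∀ U ⊆ K, φ.HoldsOn G K x (Fin.cons U X)
  | _, _, exS φ, x, X => ∃ U ⊆ K, φ.HoldsOn G K x (Fin.cons U X)

theorem holdsOn_univ {n c : ℕ} (G : ColoredGraph n c) {v s : ℕ} (φ : MSO1 c v s)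
    (x : Fin v → Fin n) (X : Fin s → Finset (Fin n)) :
    φ.HoldsOn G Finset.univ x X ↔ φ.Holds G x X := by
  induction φ with
  | eq | adj | color | mem => rfl
  | not _ ih => simp only [HoldsOn, Holds, ih]
  | and _ _ ih ih' => simp only [HoldsOn, Holds, ih, ih']
  | or _ _ ih ih' => simp only [HoldsOn, Holds, ih, ih']
  | imp _ _ ih ih' => simp only [HoldsOn, Holds, ih, ih']
  | iff _ _ ih ih' => simp only [HoldsOn, Holds, ih, ih']
  | allV _ ih => simp [HoldsOn, Holds, ih]
  | exV _ ih => simp [HoldsOn, Holds, ih]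
  | allS _ ih => simp [HoldsOn, Holds, ih]
  | exS _ ih => simp [HoldsOn, Holds, ih]

end MSO1

section Similarity

variable {n c : ℕ} {T : Type}

/-- The type `ty u` of a vertex determines its adjacencies to other vertices, and the colors in
`C`. -/
structure IsTyping (G : ColoredGraph n c) (C : List ℕ) (ty : Fin n → T) : Prop where
  adj : ∀ u v u' v', u ≠ v → u' ≠ v' → ty u = ty u' → ty v = ty v' →
    (G.graph.Adj u v ↔ G.graph.Adj u' v')
  color : ∀ a : Fin c, (a : ℕ) ∈ C → ∀ u u', ty u = ty u' → (u ∈ G.color a ↔ u' ∈ G.color a)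

open Classical in
/-- The vertices of `K` of a given type and in given sets, except the values of variables. -/
noncomputable def cell (ty : Fin n → T) (K : Finset (Fin n)) {v s : ℕ} (x : Fin v → Fin n)
    (X : Fin s → Finset (Fin n)) (τ : T) (P : Fin s → Prop) : Finset (Fin n) :=
  K.filter fun u => (∀ i, x i ≠ u) ∧ ty u = τ ∧ ∀ j, (u ∈ X j ↔ P j)

theorem mem_cell {ty : Fin n → T} {K : Finset (Fin n)} {v s : ℕ} {x : Fin v → Fin n}
    {X : Fin s → Finset (Fin n)} {τ : T} {P : Fin s → Prop} {u : Fin n} :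
    u ∈ cell ty K x X τ P ↔ u ∈ K ∧ (∀ i, x i ≠ u) ∧ ty u = τ ∧ ∀ j, (u ∈ X j ↔ P j) := by
  simp only [cell, Finset.mem_filter]

/-- Two assignments that agree up to the sizes of large cells. -/
structure CellSimilar (ty : Fin n → T) (θ : ℕ) {v s : ℕ}
    (K : Finset (Fin n)) (x : Fin v → Fin n) (X : Fin s → Finset (Fin n))
    (K' : Finset (Fin n)) (x' : Fin v → Fin n) (X' : Fin s → Finset (Fin n)) : Prop where
  ty_eq : ∀ i, ty (x i) = ty (x' i)
  eq_iff : ∀ i j, x i = x j ↔ x' i = x' j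
  mem_iff : ∀ i j, x i ∈ X j ↔ x' i ∈ X' j
  card : ∀ τ P, (cell ty K x X τ P).card = (cell ty K' x' X' τ P).card ∨
    (θ ≤ (cell ty K x X τ P).card ∧ θ ≤ (cell ty K' x' X' τ P).card)

namespace CellSimilar

variable {ty : Fin n → T} {θ : ℕ} {v s : ℕ}
  {K : Finset (Fin n)} {x : Fin v → Fin n} {X : Fin s → Finset (Fin n)}
  {K' : Finset (Fin n)} {x' : Fin v → Fin n} {X' : Fin s → Finset (Fin n)}

theorem symm (h : CellSimilar ty θ K x X K' x' X') : CellSimilar ty θ K' x' X' K x X where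
  ty_eq i := (h.ty_eq i).symm
  eq_iff i j := (h.eq_iff i j).symm
  mem_iff i j := (h.mem_iff i j).symm
  card τ P := (h.card τ P).imp Eq.symm And.symm

theorem mono {θ' : ℕ} (h : CellSimilar ty θ K x X K' x' X') (hθ : θ' ≤ θ) :
    CellSimilar ty θ' K x X K' x' X' where
  ty_eq := h.ty_eq
  eq_iff := h.eq_iff
  mem_iff := h.mem_iff
  card τ P := (h.card τ P).imp_right fun ⟨h₁, h₂⟩ => ⟨hθ.trans h₁, hθ.trans h₂⟩

theorem cell_cons (u : Fin n) (τ : T) (P : Fin s → Prop) :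
    cell ty K (Fin.cons u x : Fin (v + 1) → Fin n) X τ P = (cell ty K x X τ P).erase u := by
  ext w
  simp only [cell, Finset.mem_filter, Finset.mem_erase, Fin.forall_fin_succ, Fin.cons_zero,
    Fin.cons_succ]
  tauto

/-- A round of the Ehrenfeucht-Fraïssé game. If `u` is the value of a variable, the same variable
provides the answer. Otherwise any element of the corresponding cell does; this cell is not empty
since the threshold is positive, and on each side one element leaves one cell, which costs `1` of
the threshold. -/
theorem vertex (h : CellSimilar ty (θ + 1) K x X K' x' X') {u : Fin n} (hu : u ∈ K) :
    ∃ u' ∈ K' ∪ Finset.univ.image x', CellSimilar ty θ K (Fin.cons u x : Fin (v + 1) → Fin n) X K'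
      (Fin.cons u' x' : Fin (v + 1) → Fin n) X' := by
  by_cases hx : ∃ i, x i = u
  · obtain ⟨i, rfl⟩ := hx
    refine ⟨x' i, by simp, ⟨?_, ?_, ?_, ?_⟩⟩
    · exact Fin.cases (by simpa using h.ty_eq i) fun j => by simpa using h.ty_eq j
    · refine Fin.cases (Fin.cases (by simp) fun j => ?_) fun j => Fin.cases ?_ fun k => ?_
      · simpa using h.eq_iff i j
      · simpa using h.eq_iff j i
      · simpa using h.eq_iff j k
    · exact Fin.cases (by simpa using h.mem_iff i) fun j => by simpa using h.mem_iff j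
    · intro τ P
      have h1 : x i ∉ cell ty K x X τ P := by simp [cell]
      have h2 : x' i ∉ cell ty K' x' X' τ P := by simp [cell]
      rw [cell_cons, cell_cons, Finset.erase_eq_of_notMem h1, Finset.erase_eq_of_notMem h2]
      have := h.card τ P
      omega
  · push Not at hx
    have hmem : u ∈ cell ty K x X (ty u) (fun j => u ∈ X j) := by
      exact mem_cell.2 ⟨hu, hx, rfl, fun j => Iff.rfl⟩
    have hpos : 0 < (cell ty K' x' X' (ty u) fun j => u ∈ X j).card := by
      have h1 := Finset.card_pos.2 ⟨u, hmem⟩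
      have h2 := h.card (ty u) fun j => u ∈ X j
      omega
    obtain ⟨u', hu'⟩ := Finset.card_pos.1 hpos
    simp only [cell, Finset.mem_filter] at hu'
    obtain ⟨hK', hx', hty, hX⟩ := hu'
    refine ⟨u', by simp [hK'], ⟨?_, ?_, ?_, ?_⟩⟩
    · exact Fin.cases (by simpa using hty.symm) fun j => by simpa using h.ty_eq j
    · refine Fin.cases (Fin.cases (by simp) fun j => ?_) fun j => Fin.cases ?_ fun k => ?_
      · simp [(hx j).symm, (hx' j).symm]
      · simp [hx j, hx' j]
      · simpa using h.eq_iff j k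
    · exact Fin.cases (fun j => by simpa using (hX j).symm) fun j => by simpa using h.mem_iff j
    · intro τ P
      have hiff : u ∈ cell ty K x X τ P ↔ u' ∈ cell ty K' x' X' τ P := by
        simp only [cell, Finset.mem_filter, hu, hK', hty, hX]
        exact ⟨fun h => ⟨trivial, hx', h.2.2⟩, fun h => ⟨trivial, hx, h.2.2⟩⟩
      rw [cell_cons, cell_cons, Finset.card_erase_eq_ite, Finset.card_erase_eq_ite]
      have := h.card τ P
      by_cases hm : u ∈ cell ty K x X τ P
      · rw [if_pos hm, if_pos (hiff.1 hm)]
        omega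
      · rw [if_neg hm, if_neg (mt hiff.2 hm)]
        omega

/-- The set `U` splits every cell in two. If the corresponding cell has the same size, it is split
alike. Otherwise both have at least `2 * θ` elements, so at most one part is smaller than `θ`: it is
copied exactly, and at least `θ` elements remain for the other part. -/
theorem set (h : CellSimilar ty (2 * θ) K x X K' x' X') (U : Finset (Fin n)) :
    ∃ U' ⊆ K' ∪ Finset.univ.image x', CellSimilar ty θ K x (Fin.cons U X : Fin (s + 1) → Finset (Fin n))
      K' x' (Fin.cons U' X' : Fin (s + 1) → Finset (Fin n)) := by
  classical
  have hsub : ∀ τ P, ∃ Z ⊆ cell ty K' x' X' τ P,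
      ((cell ty K x X τ P ∩ U).card = Z.card ∨ (θ ≤ (cell ty K x X τ P ∩ U).card ∧ θ ≤ Z.card)) ∧
      ((cell ty K x X τ P \ U).card = (cell ty K' x' X' τ P \ Z).card ∨
        (θ ≤ (cell ty K x X τ P \ U).card ∧ θ ≤ (cell ty K' x' X' τ P \ Z).card)) := by
    intro τ P
    have h1 := Finset.card_inter_add_card_sdiff (cell ty K x X τ P) U
    have h2 := h.card τ P
    obtain ⟨k, hk, h3⟩ : ∃ k ≤ (cell ty K' x' X' τ P).card,
        ((cell ty K x X τ P ∩ U).card = k ∨ (θ ≤ (cell ty K x X τ P ∩ U).card ∧ θ ≤ k)) ∧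
        ((cell ty K x X τ P \ U).card = (cell ty K' x' X' τ P).card - k ∨
        (θ ≤ (cell ty K x X τ P \ U).card ∧ θ ≤ (cell ty K' x' X' τ P).card - k)) := by
      generalize (cell ty K x X τ P ∩ U).card = a at *
      generalize (cell ty K x X τ P \ U).card = b at *
      generalize (cell ty K' x' X' τ P).card = d at *
      rcases h2 with h2 | h2
      · exact ⟨a, by omega, by omega, by omega⟩
      · by_cases ha : a < θ
        · exact ⟨a, by omega, by omega, by omega⟩
        · by_cases hb : b < θ
          · exact ⟨d - b, by omega, by omega, by omega⟩
          · exact ⟨θ, by omega, by omega, by omega⟩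
    obtain ⟨Z, hZ, rfl⟩ := Finset.exists_subset_card_eq hk
    exact ⟨Z, hZ, by rwa [Finset.card_sdiff_of_subset hZ]⟩
  choose Z hZ h1 h2 using hsub
  -- The choices for the single cells are put together; the type and the memberships of `w` tell its
  -- cell. The values of variables belong to no cell and are treated by the first alternative.
  let U' := (K' ∪ Finset.univ.image x').filter fun w => (∃ i, x' i = w ∧ x i ∈ U) ∨
    w ∈ Z (ty w) fun j => w ∈ X' j
  have hx' : ∀ i τ P, x' i ∉ Z τ P := fun i τ P hi => by
    have := hZ τ P hi
    simp only [cell, Finset.mem_filter] at this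
    exact this.2.1 i rfl
  have hU'x : ∀ i, x' i ∈ U' ↔ x i ∈ U := by
    intro i
    simp only [U', Finset.mem_filter, hx', or_false]
    constructor
    · rintro ⟨-, j, hj, hU⟩
      rwa [← (h.eq_iff j i).2 hj]
    · exact fun hi => ⟨by simp, i, rfl, hi⟩
  have hU'c : ∀ τ P, ∀ w ∈ cell ty K' x' X' τ P, (w ∈ U' ↔ w ∈ Z τ P) := by
    intro τ P w hw
    simp only [cell, Finset.mem_filter] at hw
    obtain ⟨hK, hxw, rfl, hP⟩ := hw
    have hP' : (fun j => w ∈ X' j) = P := funext fun j => propext (hP j)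
    simp only [U', Finset.mem_filter, hP', Finset.mem_union, hK, true_or, true_and]
    constructor
    · rintro (⟨i, hi, -⟩ | hw)
      · exact absurd hi (hxw i)
      · exact hw
    · exact Or.inr
  refine ⟨U', Finset.filter_subset _ _, ⟨h.ty_eq, h.eq_iff, ?_, ?_⟩⟩
  · intro i
    exact Fin.cases (by simpa using (hU'x i).symm) fun j => by simpa using h.mem_iff i j
  · intro τ P
    have e : ∀ (K : Finset (Fin n)) (x : Fin v → Fin n) (X : Fin s → Finset (Fin n)) U,
        cell ty K x (Fin.cons U X : Fin (s + 1) → Finset (Fin n)) τ P =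
        (cell ty K x X τ fun j => P j.succ).filter fun w => w ∈ U ↔ P 0 := by
      intro K x X U
      ext w
      simp only [cell, Finset.mem_filter, Fin.forall_fin_succ, Fin.cons_zero, Fin.cons_succ]
      tauto
    rw [e, e]
    have e2 : ((cell ty K' x' X' τ fun j => P j.succ).filter fun w => w ∈ U' ↔ P 0) =
        (cell ty K' x' X' τ fun j => P j.succ).filter fun w => w ∈ (Z τ fun j => P j.succ) ↔ P 0 := by
      refine Finset.filter_congr fun w hw => ?_
      rw [hU'c τ _ w hw]
    rw [e2]
    by_cases hP : P 0
    · simp only [hP, iff_true, Finset.filter_mem_eq_inter]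
      rw [Finset.inter_eq_right.2 (hZ τ _)]
      exact h1 τ _
    · simp only [hP, iff_false, Finset.filter_notMem_eq_sdiff]
      exact h2 τ _

end CellSimilar

/-- A formula does not distinguish similar assignments. -/
theorem MSO1.holdsOn_congr {G : ColoredGraph n c} {C : List ℕ} {ty : Fin n → T}
    (hty : IsTyping G C ty) {v s : ℕ} (φ : MSO1 c v s) (hC : ∀ a ∈ φ.usedColors, a ∈ C)
    {K : Finset (Fin n)} {x : Fin v → Fin n} {X : Fin s → Finset (Fin n)}
    {K' : Finset (Fin n)} {x' : Fin v → Fin n} {X' : Fin s → Finset (Fin n)}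
    (h : CellSimilar ty (2 ^ φ.nodes) K x X K' x' X') (hx : ∀ i, x i ∈ K) (hx' : ∀ i, x' i ∈ K') :
    φ.HoldsOn G K x X ↔ φ.HoldsOn G K' x' X' := by
  have union_eq : ∀ {v : ℕ} {K : Finset (Fin n)} {x : Fin v → Fin n}, (∀ i, x i ∈ K) →
      K ∪ Finset.univ.image x = K := by
    intro v K x hx
    rw [Finset.union_eq_left]
    intro w hw
    obtain ⟨i, -, rfl⟩ := Finset.mem_image.1 hw
    exact hx i
  have hcons : ∀ {v : ℕ} {K : Finset (Fin n)} {x : Fin v → Fin n} {u}, (∀ i, x i ∈ K) → u ∈ K →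
      ∀ i, (Fin.cons u x : Fin (v + 1) → Fin n) i ∈ K :=
    fun hx hu => Fin.cases hu hx
  -- A vertex quantifier lowers the threshold by `1` and a set quantifier halves it; going from `2 ^
  -- (k + 1)` to `2 ^ k` allows for both.
  have hpow : ∀ k : ℕ, 2 ^ k + 1 ≤ 2 ^ (k + 1) := fun k => by
    have := Nat.one_le_two_pow (n := k)
    rw [pow_succ]
    omega
  induction φ generalizing K K' with
  | eq i j => exact h.eq_iff i j
  | adj i j =>
    simp only [HoldsOn]
    -- Types determine adjacency between distinct vertices only: in a class that is a clique, `x i =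
    -- x j` has to be excluded.
    by_cases hij : x i = x j
    · rw [hij, (h.eq_iff i j).1 hij]
      simp
    · exact hty.adj _ _ _ _ hij (mt (h.eq_iff i j).2 hij) (h.ty_eq i) (h.ty_eq j)
  | color a i => exact hty.color a (hC a (by simp [usedColors])) _ _ (h.ty_eq i)
  | mem j i => exact h.mem_iff i j
  | not φ ih =>
    exact not_congr (ih hC (h.mono (Nat.pow_le_pow_right (by omega) (by simp [nodes]))) hx hx')
  | and φ ψ ih ih' =>
    simp only [usedColors, List.mem_append] at hC
    exact and_congr
      (ih (fun a ha => hC a (.inl ha)) (h.mono (Nat.pow_le_pow_right (by omega) (by simp [nodes]; omega))) hx hx')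
      (ih' (fun a ha => hC a (.inr ha)) (h.mono (Nat.pow_le_pow_right (by omega) (by simp [nodes]; omega))) hx hx')
  | or φ ψ ih ih' =>
    simp only [usedColors, List.mem_append] at hC
    exact or_congr
      (ih (fun a ha => hC a (.inl ha)) (h.mono (Nat.pow_le_pow_right (by omega) (by simp [nodes]; omega))) hx hx')
      (ih' (fun a ha => hC a (.inr ha)) (h.mono (Nat.pow_le_pow_right (by omega) (by simp [nodes]; omega))) hx hx')
  | imp φ ψ ih ih' =>
    simp only [usedColors, List.mem_append] at hC
    exact imp_congr
      (ih (fun a ha => hC a (.inl ha)) (h.mono (Nat.pow_le_pow_right (by omega) (by simp [nodes]; omega))) hx hx')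
      (ih' (fun a ha => hC a (.inr ha)) (h.mono (Nat.pow_le_pow_right (by omega) (by simp [nodes]; omega))) hx hx')
  | iff φ ψ ih ih' =>
    simp only [usedColors, List.mem_append] at hC
    exact iff_congr
      (ih (fun a ha => hC a (.inl ha)) (h.mono (Nat.pow_le_pow_right (by omega) (by simp [nodes]; omega))) hx hx')
      (ih' (fun a ha => hC a (.inr ha)) (h.mono (Nat.pow_le_pow_right (by omega) (by simp [nodes]; omega))) hx hx')
  | allV φ ih =>
    have h' := h.mono (hpow φ.nodes)
    constructor
    · intro hall u' hu'
      obtain ⟨u, hu, hs⟩ := h'.symm.vertex hu'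
      rw [union_eq hx] at hu
      exact (ih hC hs.symm (hcons hx hu) (hcons hx' hu')).1 (hall u hu)
    · intro hall u hu
      obtain ⟨u', hu', hs⟩ := h'.vertex hu
      rw [union_eq hx'] at hu'
      exact (ih hC hs (hcons hx hu) (hcons hx' hu')).2 (hall u' hu')
  | exV φ ih =>
    have h' := h.mono (hpow φ.nodes)
    constructor
    · rintro ⟨u, hu, hφ⟩
      obtain ⟨u', hu', hs⟩ := h'.vertex hu
      rw [union_eq hx'] at hu'
      exact ⟨u', hu', (ih hC hs (hcons hx hu) (hcons hx' hu')).1 hφ⟩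
    · rintro ⟨u', hu', hφ⟩
      obtain ⟨u, hu, hs⟩ := h'.symm.vertex hu'
      rw [union_eq hx] at hu
      exact ⟨u, hu, (ih hC hs.symm (hcons hx hu) (hcons hx' hu')).2 hφ⟩
  | allS φ ih =>
    have h' := h.mono (show 2 * 2 ^ φ.nodes ≤ 2 ^ (φ.nodes + 1) by rw [pow_succ, mul_comm])
    constructor
    · intro hall U' hU'
      obtain ⟨U, hU, hs⟩ := h'.symm.set U'
      rw [union_eq hx] at hU
      exact (ih hC hs.symm hx hx').1 (hall U hU)
    · intro hall U hU
      obtain ⟨U', hU', hs⟩ := h'.set U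
      rw [union_eq hx'] at hU'
      exact (ih hC hs hx hx').2 (hall U' hU')
  | exS φ ih =>
    have h' := h.mono (show 2 * 2 ^ φ.nodes ≤ 2 ^ (φ.nodes + 1) by rw [pow_succ, mul_comm])
    constructor
    · rintro ⟨U, hU, hφ⟩
      obtain ⟨U', hU', hs⟩ := h'.set U
      rw [union_eq hx'] at hU'
      exact ⟨U', hU', (ih hC hs hx hx').1 hφ⟩
    · rintro ⟨U', hU', hφ⟩
      obtain ⟨U, hU, hs⟩ := h'.symm.set U'
      rw [union_eq hx] at hU
      exact ⟨U, hU, (ih hC hs.symm hx hx').2 hφ⟩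

end Similarity

/-! ### Correctness of the evaluation -/

/-- A subset of `K'` is represented by the sublist of `K` that consists of its elements, and every
sublist represents a subset. This is why the sublists of `K` serve as the domain of the set
quantifiers. -/
theorem MSO1.evalB_iff {n c : ℕ} {G : ColoredGraph n c} {g cols : List (List Bool)} {K : List ℕ}
    {K' : Finset (Fin n)} (hg : ∀ u v : Fin n, adjB g u v = true ↔ G.graph.Adj u v)
    (hcols : ∀ (a : Fin c) (u : Fin n), bit (cols.getD a []) u = true ↔ u ∈ G.color a)
    (hKn : ∀ k ∈ K, k < n) (hK : ∀ u : Fin n, (u : ℕ) ∈ K ↔ u ∈ K') {v s : ℕ} (φ : MSO1 c v s)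
    {x : List ℕ} {X : List (List ℕ)} {x' : Fin v → Fin n} {X' : Fin s → Finset (Fin n)}
    (hx : ∀ i : Fin v, x.getD i 0 = x' i)
    (hX : ∀ (j : Fin s) (u : Fin n), (u : ℕ) ∈ X.getD j [] ↔ u ∈ X' j) :
    φ.evalB (K, K.sublists', g, cols) x X = true ↔ φ.HoldsOn G K' x' X' := by
  have hxc : ∀ {v : ℕ} {x : List ℕ} {x' : Fin v → Fin n}, (∀ i : Fin v, x.getD i 0 = x' i) →
      ∀ u : Fin n, ∀ i : Fin (v + 1), ((u : ℕ) :: x).getD i 0 = (Fin.cons u x' : Fin (v + 1) → Fin n) i :=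
    fun hx u => Fin.cases (by simp) fun i => by simpa using hx i
  have hXc : ∀ {s : ℕ} {X : List (List ℕ)} {X' : Fin s → Finset (Fin n)},
      (∀ (j : Fin s) (u : Fin n), (u : ℕ) ∈ X.getD j [] ↔ u ∈ X' j) →
      ∀ (U : List ℕ) (U' : Finset (Fin n)), (∀ u : Fin n, (u : ℕ) ∈ U ↔ u ∈ U') →
      ∀ (j : Fin (s + 1)) (u : Fin n), (u : ℕ) ∈ (U :: X).getD j [] ↔
        u ∈ (Fin.cons U' X' : Fin (s + 1) → Finset (Fin n)) j :=
    fun hX U U' hU => Fin.cases (fun u => by simpa using hU u) fun j u => by simpa using hX j u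
  have toFinset : ∀ U : List ℕ, U ∈ K.sublists' → ∃ U' ⊆ K', ∀ u : Fin n, (u : ℕ) ∈ U ↔ u ∈ U' := by
    intro U hU
    rw [List.mem_sublists'] at hU
    refine ⟨Finset.univ.filter fun u : Fin n => (u : ℕ) ∈ U, ?_, by simp⟩
    intro u hu
    simp only [Finset.mem_filter] at hu
    exact (hK u).1 (hU.subset hu.2)
  have ofFinset : ∀ U' ⊆ K', ∃ U ∈ K.sublists', ∀ u : Fin n, (u : ℕ) ∈ U ↔ u ∈ U' := by
    classical
    intro U' hU'
    refine ⟨K.filter fun k => ∃ u ∈ U', (u : ℕ) = k, ?_, ?_⟩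
    · rw [List.mem_sublists']; exact List.filter_sublist
    · intro u
      simp only [List.mem_filter, decide_eq_true_eq]
      constructor
      · rintro ⟨-, w, hw, h⟩
        rwa [← Fin.ext h]
      · exact fun hu => ⟨(hK u).2 (hU' hu), u, hu, rfl⟩
  induction φ generalizing x X with
  | eq i j => simp only [evalB, HoldsOn, hx, Fin.ext_iff]; simp
  | adj i j => simp only [evalB, HoldsOn, hx]; exact hg _ _
  | color a i => simp only [evalB, HoldsOn, hx]; exact hcols _ _
  | mem j i => simp only [evalB, HoldsOn, hx, ← hX]; simp
  | not φ ih => simp only [evalB, HoldsOn, ← ih hx hX]; simp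
  | and φ ψ ih ih' => simp only [evalB, HoldsOn, ← ih hx hX, ← ih' hx hX]; simp
  | or φ ψ ih ih' => simp only [evalB, HoldsOn, ← ih hx hX, ← ih' hx hX]; simp
  | imp φ ψ ih ih' =>
    simp only [evalB, HoldsOn, ← ih hx hX, ← ih' hx hX]
    cases evalB (K, K.sublists', g, cols) φ x X <;> simp
  | iff φ ψ ih ih' =>
    simp only [evalB, HoldsOn, ← ih hx hX, ← ih' hx hX]
    cases evalB (K, K.sublists', g, cols) φ x X <;> simp
  | allV φ ih =>
    simp only [evalB, HoldsOn, List.all_eq_true]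
    constructor
    · intro h u hu
      exact (ih (hxc hx u) hX).1 (h u ((hK u).2 hu))
    · intro h k hk
      exact (ih (hxc hx ⟨k, hKn k hk⟩) hX).2 (h _ ((hK _).1 hk))
  | exV φ ih =>
    simp only [evalB, HoldsOn, List.any_eq_true]
    constructor
    · rintro ⟨k, hk, h⟩
      exact ⟨⟨k, hKn k hk⟩, (hK _).1 hk, (ih (hxc hx ⟨k, hKn k hk⟩) hX).1 h⟩
    · rintro ⟨u, hu, h⟩
      exact ⟨u, (hK u).2 hu, (ih (hxc hx u) hX).2 h⟩
  | allS φ ih =>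
    simp only [evalB, HoldsOn, List.all_eq_true]
    constructor
    · intro h U' hU'
      obtain ⟨U, hU, he⟩ := ofFinset U' hU'
      exact (ih hx (hXc hX U U' he)).1 (h U hU)
    · intro h U hU
      obtain ⟨U', hU', he⟩ := toFinset U hU
      exact (ih hx (hXc hX U U' he)).2 (h U' hU')
  | exS φ ih =>
    simp only [evalB, HoldsOn, List.any_eq_true]
    constructor
    · rintro ⟨U, hU, h⟩
      obtain ⟨U', hU', he⟩ := toFinset U hU
      exact ⟨U', hU', (ih hx (hXc hX U U' he)).1 h⟩
    · rintro ⟨U', hU', h⟩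
      obtain ⟨U, hU, he⟩ := ofFinset U' hU'
      exact ⟨U, hU, (ih hx (hXc hX U U' he)).2 h⟩

/-! ### Functions with exponential measures -/

section Exponential

/-- Numbers are unary, so the value itself must appear in the measure. The base `z.1 + 1` makes the
measure monotone in the exponent even if `z.1 = 0`. -/
theorem pow_pt : PT (fun z : ℕ × ℕ => (z.1 + 1) ^ z.2 + sz z) (fun z : ℕ × ℕ => z.1 ^ z.2) := by
  have h1 : PT (fun z : ℕ × List Unit => (z.1 + 1) ^ z.2.length + sz z)
      (fun z : ℕ × List Unit => z.2.foldr (fun _ r => z.1 * r) 1) := by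
    refine PT.foldr (f := fun a _ r => a * r) (b := fun _ => 1) (by fun_prop) (by fun_prop)
      (fun a x l => ?_) (.of_le fun z => Nat.le_add_left _ _) ?_
    · have : (a + 1) ^ l.length ≤ (a + 1) ^ (l.length + 1) := Nat.pow_le_pow_right (by omega) (by omega)
      simp only [sz_pair, sz_cons, List.length_cons]
      omega
    · refine PolyLE.mono (f := fun z : ℕ × List Unit => 2 * ((z.1 + 1) ^ z.2.length + sz z) + 1)
        (((PolyLE.const 2).mul (.refl _)).add (.const 1)) fun z => ?_
      have : z.2.foldr (fun _ r => z.1 * r) 1 = z.1 ^ z.2.length := by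
        induction z.2 with
        | nil => rfl
        | cons a l ih => rw [List.foldr_cons, ih, List.length_cons, pow_succ, mul_comm]
      rw [this, sz_nat]
      have : z.1 ^ z.2.length ≤ (z.1 + 1) ^ z.2.length := Nat.pow_le_pow_left (by omega) _
      omega
  have h2 : PolyTime (fun z : ℕ × ℕ => (z.1, List.replicate z.2 ())) := by fun_prop
  have h3 := PT.comp (μ := fun z : ℕ × ℕ => (z.1 + 1) ^ z.2 + sz z) h1
    (h2.pt (.of_le fun z => Nat.le_add_left _ _)) (.of_le fun z => by
      have : sz (List.replicate z.2 ()) = sz z.2 := by unfold sz; rw [enc_replicate_unit]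
      rw [List.length_replicate, sz_pair, sz_prod z, this])
  refine PT.congr_enc h3 fun z => ?_
  congr 1
  show _ = (List.replicate z.2 ()).foldr (fun _ r => z.1 * r) 1
  induction z.2 with
  | zero => rfl
  | succ n ih => rw [List.replicate_succ, List.foldr_cons, ← ih, pow_succ, mul_comm]

theorem sublists_pt {β : Type} [Enc β] :
    PT (fun l : List β => 2 ^ l.length + sz l) (fun l : List β => l.sublists') := by
  have e : ∀ l : List β, l.foldr (fun a r => r ++ r.map (a :: ·)) [[]] = l.sublists' := by
    intro l
    induction l with
    | nil => rfl
    | cons a l ih => rw [List.foldr_cons, ih, List.sublists'_cons]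
  have h1 : PT (fun z : Unit × List β => 2 ^ z.2.length + sz z)
      (fun z : Unit × List β => z.2.foldr (fun a r => r ++ r.map (a :: ·)) [[]]) := by
    refine PT.foldr (γ := List (List β)) (f := fun _ a r => r ++ r.map (a :: ·))
      (b := fun _ => [[]]) (by fun_prop)
      (by fun_prop) (fun a x l => ?_) (.of_le fun z => Nat.le_add_left _ _) ?_
    · have : 2 ^ l.length ≤ 2 ^ (l.length + 1) := Nat.pow_le_pow_right (by omega) (by omega)
      simp only [sz_pair, sz_cons, List.length_cons]
      omega
    · refine PolyLE.mono (f := fun z : Unit × List β => (2 ^ z.2.length + sz z) *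
          ((2 ^ z.2.length + sz z) + 1) + 1)
        (((PolyLE.refl _).mul ((PolyLE.refl _).add (.const 1))).add (.const 1)) fun z => ?_
      rw [e]
      refine (sz_list_le (k := sz z.2) fun a ha => sz_sublist (List.mem_sublists'.1 ha)).trans ?_
      rw [List.length_sublists', sz_prod]
      have := sz_pos z.1
      have h2 : 0 < 2 ^ z.2.length := by positivity
      generalize 2 ^ z.2.length = t at *
      gcongr ?_ * (?_ + 1) + 1 <;> omega
  have h2 : PolyTime (fun l : List β => ((), l)) := by fun_prop
  have h3 := PT.comp (μ := fun l : List β => 2 ^ l.length + sz l) h1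
    (h2.pt (.of_le fun z => Nat.le_add_left _ _)) (PolyLE.mono (((PolyLE.refl _).add (.const 2)))
      fun z => by
        have : sz () = 1 := rfl
        rw [sz_pair, this]
        show 2 ^ z.length + _ ≤ 2 ^ z.length + sz z + 2
        omega)
  exact PT.congr_enc h3 fun l => by rw [e]

end Exponential

/-! ### Bounded combinations of numbers -/

/-- The sums `∑ cᵢ bᵢ` with `0 ≤ cᵢ ≤ B`. -/
def sums (B : ℕ) (l : List ℕ) : List ℕ :=
  l.foldr (fun b r => (List.range (B + 1)).flatMap fun c => r.map fun w => c * b + w) [0]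

theorem sums_cons (B b : ℕ) (l : List ℕ) : sums B (b :: l) =
    (List.range (B + 1)).flatMap fun c => (sums B l).map fun w => c * b + w := rfl

theorem length_sums (B : ℕ) (l : List ℕ) : (sums B l).length = (B + 1) ^ l.length := by
  induction l with
  | nil => rfl
  | cons b l ih => simp [sums_cons, List.length_flatMap, ih, pow_succ, mul_comm]

theorem le_of_mem_sums {B : ℕ} {l : List ℕ} {w : ℕ} (h : w ∈ sums B l) : w ≤ B * l.sum := by
  induction l generalizing w with
  | nil => simp [sums] at h; simp [h]
  | cons b l ih =>
    simp only [sums_cons, List.mem_flatMap, List.mem_range, List.mem_map] at h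
    obtain ⟨c, hc, w, hw, rfl⟩ := h
    rw [List.sum_cons, mul_add]
    exact add_le_add (Nat.mul_le_mul_right _ (by omega)) (ih hw)

theorem sum_lt_sz (l : List ℕ) : l.sum < sz l := by
  induction l with
  | nil => simp [sz_nil]
  | cons a l ih => rw [List.sum_cons, sz_cons, sz_nat]; omega

theorem sums_pt : PT (fun z : ℕ × List ℕ => (z.1 + 1) ^ z.2.length + sz z)
    (fun z : ℕ × List ℕ => sums z.1 z.2) := by
  refine PT.foldr (f := fun B b r => (List.range (B + 1)).flatMap fun c => r.map fun w => c * b + w)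
    (b := fun _ => [0]) (by fun_prop) (by fun_prop) (fun a x l => ?_)
    (.of_le fun z => Nat.le_add_left _ _) ?_
  · have : (a + 1) ^ l.length ≤ (a + 1) ^ (l.length + 1) := Nat.pow_le_pow_right (by omega) (by omega)
    simp only [sz_pair, sz_cons, List.length_cons]
    omega
  · have h : PolyLE (fun z : ℕ × List ℕ => ((z.1 + 1) ^ z.2.length + sz z))
      (fun z : ℕ × List ℕ => (z.1 + 1) ^ z.2.length + sz z) := .refl _
    refine PolyLE.mono (h.mul (((PolyLE.const 2).mul (h.mul h)).add (.const 2)) |>.add (.const 1))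
      fun z => ?_
    have h1 : sz (sums z.1 z.2) ≤ _ := sz_list_le (k := 2 * (sz z * sz z) + 1) fun w hw => by
      rw [sz_nat]
      have h2 := le_of_mem_sums hw
      have h3 : z.1 * z.2.sum ≤ sz z * sz z := by
        have := sum_lt_sz z.2
        have h4 := sz_nat z.1
        have h5 := sz_prod z
        gcongr <;> omega
      omega
    rw [length_sums] at h1
    refine h1.trans ?_
    have h2 : sz z ≤ (z.1 + 1) ^ z.2.length + sz z := Nat.le_add_left _ _
    have h3 := Nat.mul_le_mul h2 h2
    gcongr ?_ * ?_ + 1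
    · omega
    · omega

/-- Whether a positive multiple `D * z` with `D ≤ B` is a difference of two elements of `l`. -/
def isQuot (B : ℕ) (l : List ℕ) (z : ℕ) : Bool :=
  (List.range (B + 1)).any fun D => Nat.ble 1 D && l.any fun N => l.any fun P => D * z + N == P

theorem isQuot_iff {B : ℕ} {l : List ℕ} {z : ℕ} :
    isQuot B l z = true ↔ ∃ D, 1 ≤ D ∧ D ≤ B ∧ ∃ N ∈ l, ∃ P ∈ l, D * z + N = P := by
  simp only [isQuot, List.any_eq_true, List.mem_range, Bool.and_eq_true, Nat.ble_eq, beq_iff_eq]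
  constructor
  · rintro ⟨D, h1, h2, h3⟩
    exact ⟨D, h2, by omega, h3⟩
  · rintro ⟨D, h1, h2, h3⟩
    exact ⟨D, by omega, h1, h3⟩

/-- Each `z` is recovered from its witnesses as `(P - N) / D`. Thus the number of candidates does
not depend on the size `m` of the class. -/
theorem length_filter_isQuot (B : ℕ) (l : List ℕ) (m : ℕ) :
    ((List.range m).filter (isQuot B l)).length ≤ (B + 1) * (l.length * l.length) := by
  rw [← List.toFinset_card_of_nodup (List.nodup_range.filter _)]
  calc _ ≤ ((Finset.range (B + 1) ×ˢ l.toFinset ×ˢ l.toFinset).image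
        fun t : ℕ × ℕ × ℕ => (t.2.2 - t.2.1) / t.1).card := by
        refine Finset.card_le_card fun z hz => ?_
        rw [List.mem_toFinset, List.mem_filter] at hz
        obtain ⟨D, h1, h2, N, hN, P, hP, he⟩ := isQuot_iff.1 hz.2
        refine Finset.mem_image.2 ⟨(D, N, P), ?_, ?_⟩
        · simp only [Finset.mem_product, Finset.mem_range, List.mem_toFinset]
          exact ⟨by omega, hN, hP⟩
        · show (P - N) / D = z
          rw [← he, Nat.add_sub_cancel, Nat.mul_div_cancel_left _ (by omega)]
    _ ≤ _ := by
        refine Finset.card_image_le.trans ?_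
        rw [Finset.card_product, Finset.card_product, Finset.card_range]
        have := List.toFinset_card_le l
        gcongr

/-! ### Vectors with few arbitrary coordinates -/

/-- All vectors with first coordinate in `w` and remaining coordinates in `l`. -/
def consAll (w : List ℕ) (l : List (List ℕ)) : List (List ℕ) := w.flatMap fun a => l.map (a :: ·)

/-- The vectors with at most 0, 1, and 2 coordinates that are not in the first but in the second
of the given lists. -/
def sparse (l : List (List ℕ × List ℕ)) : List (List ℕ) × List (List ℕ) × List (List ℕ) :=
  l.foldr (fun w e => (consAll w.1 e.1, consAll w.1 e.2.1 ++ consAll w.2 e.1,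
    consAll w.1 e.2.2 ++ consAll w.2 e.2.1)) ([[]], [[]], [[]])

theorem mem_consAll {w : List ℕ} {l : List (List ℕ)} {x : List ℕ} :
    x ∈ consAll w l ↔ ∃ a ∈ w, ∃ y ∈ l, x = a :: y := by
  simp [consAll, eq_comm]

theorem length_consAll (w : List ℕ) (l : List (List ℕ)) :
    (consAll w l).length = w.length * l.length := by
  simp [consAll, List.length_flatMap]

/-- The factor `w.1.length + 1` counts the regular values of a coordinate and one option
"arbitrary", so the positions of the arbitrary coordinates are accounted for; each of these then has
at most `R` values. -/
theorem length_sparse (l : List (List ℕ × List ℕ)) {R : ℕ} (hR : 1 ≤ R)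
    (h : ∀ w ∈ l, w.2.length ≤ R) :
    (sparse l).1.length ≤ (l.map fun w => w.1.length + 1).prod ∧
    (sparse l).2.1.length ≤ (l.map fun w => w.1.length + 1).prod * R ∧
    (sparse l).2.2.length ≤ (l.map fun w => w.1.length + 1).prod * (R * R) := by
  induction l with
  | nil => exact ⟨by simp [sparse], by simpa [sparse] using hR, show 1 ≤ 1 * (R * R) by nlinarith⟩
  | cons w l ih =>
    obtain ⟨h0, h1, h2⟩ := ih fun w hw => h w (by simp [hw])
    have hw := h w (by simp)
    simp only [sparse, List.foldr_cons, List.length_append, length_consAll, List.map_cons,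
      List.prod_cons] at *
    generalize (List.map (fun w : List ℕ × List ℕ => w.1.length + 1) l).prod = M at *
    refine ⟨?_, ?_, ?_⟩
    · gcongr; omega
    · have a1 := Nat.mul_le_mul_left w.1.length h1
      have a2 := Nat.mul_le_mul hw h0
      linarith
    · have a1 := Nat.mul_le_mul_left w.1.length h2
      have a2 := Nat.mul_le_mul hw h1
      linarith

theorem sz_of_forall₂ {l : List (List ℕ × List ℕ)} {x : List ℕ}
    (h : List.Forall₂ (fun a w => a ∈ w.1 ∨ a ∈ w.2) x l) : sz x ≤ sz l := by
  induction h with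
  | nil => exact le_rfl
  | @cons a w x l ha _ ih =>
    rw [sz_cons, sz_cons, sz_prod w]
    rcases ha with ha | ha <;> have := sz_mem ha <;> omega

theorem sparse_forall₂ {l : List (List ℕ × List ℕ)} {x : List ℕ}
    (hx : x ∈ (sparse l).1 ∨ x ∈ (sparse l).2.1 ∨ x ∈ (sparse l).2.2) :
    List.Forall₂ (fun a w => a ∈ w.1 ∨ a ∈ w.2) x l := by
  induction l generalizing x with
  | nil => simpa [sparse] using hx
  | cons w l ih =>
    have ih' := fun y => ih (x := y)
    simp only [sparse, List.foldr_cons, List.mem_append, mem_consAll] at hx ih'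
    rcases hx with ⟨a, ha, y, hy, rfl⟩ | (⟨a, ha, y, hy, rfl⟩ | ⟨a, ha, y, hy, rfl⟩) |
      (⟨a, ha, y, hy, rfl⟩ | ⟨a, ha, y, hy, rfl⟩)
    · exact .cons (.inl ha) (ih' y (.inl hy))
    · exact .cons (.inl ha) (ih' y (.inr (.inl hy)))
    · exact .cons (.inr ha) (ih' y (.inl hy))
    · exact .cons (.inl ha) (ih' y (.inr (.inr hy)))
    · exact .cons (.inr ha) (ih' y (.inr (.inl hy)))

theorem mem_sparse {l : List (List ℕ × List ℕ)} {x : List ℕ}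
    (hx : List.Forall₂ (fun a w => a ∈ w.2) x l) :
    ((∀ b ∈ List.zip x l, b.1 ∈ b.2.1) → x ∈ (sparse l).1) ∧
    (((List.zip x l).countP fun b => decide (b.1 ∉ b.2.1)) ≤ 1 → x ∈ (sparse l).2.1) ∧
    (((List.zip x l).countP fun b => decide (b.1 ∉ b.2.1)) ≤ 2 → x ∈ (sparse l).2.2) := by
  induction hx with
  | nil => simp [sparse]
  | @cons a w x l ha _ ih =>
    obtain ⟨h0, h1, h2⟩ := ih
    simp only [sparse, List.foldr_cons, List.mem_append, mem_consAll, List.zip_cons_cons,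
      List.mem_cons, List.countP_cons, forall_eq_or_imp] at *
    have h00 : ((List.zip x l).countP fun b => decide (b.1 ∉ b.2.1)) = 0 →
        ∀ b ∈ List.zip x l, b.1 ∈ b.2.1 := by
      intro h b hb
      simpa using List.countP_eq_zero.1 h b hb
    by_cases haw : a ∈ w.1
    · refine ⟨fun h => ⟨a, haw, x, h0 h.2, rfl⟩, fun h => .inl ⟨a, haw, x, h1 ?_, rfl⟩,
        fun h => .inl ⟨a, haw, x, h2 ?_, rfl⟩⟩ <;> simpa [haw] using h
    · refine ⟨fun h => absurd h.1 haw, fun h => .inr ⟨a, ha, x, h0 (h00 ?_), rfl⟩,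
        fun h => .inr ⟨a, ha, x, h1 ?_, rfl⟩⟩ <;> simpa [haw] using h

/-- The measure for the enumeration of sparse vectors. -/
def sparseMeasure (l : List (List ℕ × List ℕ)) : ℕ := (l.map fun w => w.1.length + 1).prod + sz l

theorem sz_sparse (l : List (List ℕ × List ℕ)) :
    sz (sparse l) ≤ 3 * (sparseMeasure l * (sparseMeasure l * sparseMeasure l) *
      (sparseMeasure l + 1) + 1) + 2 := by
  have hR : ∀ w ∈ l, w.2.length ≤ sz l := fun w hw => by
    have h1 := sz_mem hw
    have h2 := length_lt_sz w.2
    rw [sz_prod] at h1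
    omega
  have hP : 1 ≤ (l.map fun w => w.1.length + 1).prod := by
    refine List.one_le_prod_of_one_le fun a ha => ?_
    obtain ⟨w, -, rfl⟩ := List.mem_map.1 ha
    omega
  obtain ⟨h0, h1, h2⟩ := length_sparse l (sz_pos l) hR
  have e0 : sz (sparse l).1 ≤ _ := sz_list_le fun x hx => sz_of_forall₂ (sparse_forall₂ (.inl hx))
  have e1 : sz (sparse l).2.1 ≤ _ :=
    sz_list_le fun x hx => sz_of_forall₂ (sparse_forall₂ (.inr (.inl hx)))
  have e2 : sz (sparse l).2.2 ≤ _ :=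
    sz_list_le fun x hx => sz_of_forall₂ (sparse_forall₂ (.inr (.inr hx)))
  have hs := sz_pos l
  unfold sparseMeasure
  rw [sz_prod, sz_prod (sparse l).2]
  generalize (List.map (fun w : List ℕ × List ℕ => w.1.length + 1) l).prod = M at *
  generalize sz l = R at *
  have g0 : (sparse l).1.length * (R + 1) ≤ (M + R) * ((M + R) * (M + R)) * (M + R + 1) := by
    have : (sparse l).1.length ≤ (M + R) * ((M + R) * (M + R)) :=
      calc _ ≤ M * (1 * 1) := by simpa using h0
        _ ≤ _ := by gcongr <;> omega
    gcongr; omega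
  have g1 : (sparse l).2.1.length * (R + 1) ≤ (M + R) * ((M + R) * (M + R)) * (M + R + 1) := by
    have : (sparse l).2.1.length ≤ (M + R) * ((M + R) * (M + R)) :=
      calc _ ≤ M * (1 * R) := by simpa using h1
        _ ≤ _ := by gcongr <;> omega
    gcongr; omega
  have g2 : (sparse l).2.2.length * (R + 1) ≤ (M + R) * ((M + R) * (M + R)) * (M + R + 1) := by
    have : (sparse l).2.2.length ≤ (M + R) * ((M + R) * (M + R)) :=
      calc _ ≤ M * (R * R) := h2
        _ ≤ _ := by gcongr <;> omega
    gcongr; omega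
  omega

theorem sparse_pt : PT sparseMeasure sparse := by
  have h1 : PT (fun z : Unit × List (List ℕ × List ℕ) => sparseMeasure z.2 + 2)
      (fun z : Unit × List (List ℕ × List ℕ) => sparse z.2) := by
    refine PT.foldr (f := fun _ (w : List ℕ × List ℕ)
      (e : List (List ℕ) × List (List ℕ) × List (List ℕ)) =>
      (consAll w.1 e.1, consAll w.1 e.2.1 ++ consAll w.2 e.1,
      consAll w.1 e.2.2 ++ consAll w.2 e.2.1)) (b := fun _ => ([[]], [[]], [[]]))
      (by unfold consAll; fun_prop) (by fun_prop) (fun a x l => ?_) (.of_le fun z => ?_) ?_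
    · have : (l.map fun w : List ℕ × List ℕ => w.1.length + 1).prod ≤
          (x.1.length + 1) * (l.map fun w : List ℕ × List ℕ => w.1.length + 1).prod :=
        Nat.le_mul_of_pos_left _ (by omega)
      simp only [sparseMeasure, sz_cons, List.map_cons, List.prod_cons]
      omega
    · have : sz () = 1 := rfl
      rw [sz_prod, this, sparseMeasure]
      omega
    · have h : PolyLE (fun z : Unit × List (List ℕ × List ℕ) => sparseMeasure z.2)
        (fun z : Unit × List (List ℕ × List ℕ) => sparseMeasure z.2 + 2) :=
        .of_le fun z => by omega
      exact ((((PolyLE.const 3).mul (((h.mul (h.mul h)).mul (h.add (.const 1))).add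
        (.const 1))).add (.const 2))).mono fun z => sz_sparse z.2
  have h2 : PolyTime (fun l : List (List ℕ × List ℕ) => ((), l)) := by fun_prop
  exact PT.comp (f := fun l : List (List ℕ × List ℕ) => ((), l)) h1
    (h2.pt (.of_le fun z => Nat.le_add_left _ _)) ((PolyLE.refl _).add (.const 2))

/-! ### The classes of vertices -/

/-- Whether two vertices have the same neighbors apart from themselves. -/
def twinB (g : List (List Bool)) (u v : ℕ) : Bool :=
  (List.range g.length).all fun w => w == u || w == v || (adjB g u w == adjB g v w)

/-- Whether two vertices are twins and in the same sets among `labels`. -/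
def sameType (g labels : List (List Bool)) (u v : ℕ) : Bool :=
  twinB g u v && labels.all fun L => bit L u == bit L v

/-- The first vertices of the classes of `sameType`. -/
def classReps (g labels : List (List Bool)) : List ℕ :=
  (List.range g.length).filter fun u => !(List.range u).any fun w => sameType g labels w u

/-- The classes of `sameType`. -/
def vertexClasses (g labels : List (List Bool)) : List (List ℕ) :=
  (classReps g labels).map fun r => (List.range g.length).filter fun u => sameType g labels r u

/-- The numbers of elements of a set in the classes. -/
def classCounts (cl : List (List ℕ)) (L : List Bool) : List ℕ :=
  cl.map fun c => (c.filter fun u => bit L u).length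

/-- At most `θ` of the first `x i` elements of each class. -/
def coreIn (cl : List (List ℕ)) (θ : ℕ) (x : List ℕ) : List ℕ :=
  (List.range cl.length).flatMap fun i => ((cl.getD i []).take (x.getD i 0)).take θ

/-- At most `θ` of the other elements of each class. -/
def coreOut (cl : List (List ℕ)) (θ : ℕ) (x : List ℕ) : List ℕ :=
  (List.range cl.length).flatMap fun i => ((cl.getD i []).drop (x.getD i 0)).take θ

/-- The set that consists of the first `x i` elements of each class, as a list of bits. -/
def canonBits (n : ℕ) (cl : List (List ℕ)) (x : List ℕ) : List Bool :=
  (List.range n).map fun u => (List.range cl.length).any fun i =>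
    ((cl.getD i []).take (x.getD i 0)).any fun w => w == u

/-- The formula, the graph, the colors, the classes and the threshold. -/
abbrev TestData := AnyFormula × List (List Bool) × List (List Bool) × List (List ℕ) × ℕ

/-- Whether the formula holds for the sets with `x i` elements in each class. -/
def allowed (z : TestData) (x : List ℕ) : Bool :=
  z.1.φ.evalB (coreIn z.2.2.2.1 z.2.2.2.2 x ++ coreOut z.2.2.2.1 z.2.2.2.2 x,
    (coreIn z.2.2.2.1 z.2.2.2.2 x ++ coreOut z.2.2.2.1 z.2.2.2.2 x).sublists', z.2.1, z.2.2.1) []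
    [coreIn z.2.2.2.1 z.2.2.2.2 x]

/-! ### Search for a shortest walk -/

/-- Whether one unit moves from one coordinate to another. -/
def unitMoveB (p : ℕ) (x y : List ℕ) : Bool :=
  (List.range p).any fun i => (List.range p).any fun j => !(i == j) &&
    (y.getD i 0 == x.getD i 0 + 1) && (y.getD j 0 + 1 == x.getD j 0) &&
    (List.range p).all fun l => l == i || l == j || y.getD l 0 == x.getD l 0

/-- Whether the first `p` coordinates agree. -/
def vecEqB (p : ℕ) (x y : List ℕ) : Bool :=
  (List.range p).all fun l => x.getD l 0 == y.getD l 0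

/-- From walks to walks with one more vector of `Q` in front. -/
def extendWalks (p : ℕ) (Q : List (List ℕ)) (l : List (List (List ℕ))) : List (List (List ℕ)) :=
  Q.flatMap fun q => ((l.filter fun P => unitMoveB p q (P.headD [])).take 1).map fun P => q :: P

/-- One round of the search: the walks found that start in `s`, and the walks of the present
length. -/
def searchStep (p : ℕ) (Q : List (List ℕ)) (s : List ℕ)
    (e : List (List (List ℕ)) × List (List (List ℕ))) :
    List (List (List ℕ)) × List (List (List ℕ)) :=
  (bif e.1.isEmpty then (extendWalks p Q e.2).filter fun P => vecEqB p (P.headD []) s else e.1,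
    extendWalks p Q e.2)

/-- The walks of length zero to `s'`. -/
def trivialWalks (p : ℕ) (Q : List (List ℕ)) (s' : List ℕ) : List (List (List ℕ)) :=
  ((Q.filter fun q => vecEqB p q s').take 1).map fun q => [q]

/-- The state of the search after some rounds. -/
def searchState (p : ℕ) (Q : List (List ℕ)) (s s' : List ℕ) (l : List Unit) :
    List (List (List ℕ)) × List (List (List ℕ)) :=
  l.foldr (fun _ e => searchStep p Q s e)
    ((trivialWalks p Q s').filter fun P => vecEqB p (P.headD []) s, trivialWalks p Q s')

/-- A list of shortest walks in `Q` from `s` to `s'`, empty only if there is no such walk. -/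
def search (p : ℕ) (Q : List (List ℕ)) (s s' : List ℕ) : List (List (List ℕ)) :=
  (searchState p Q s s' (List.replicate Q.length ())).1

/-! ### Polynomial time of the classification and of the search -/

section Time

variable {α : Type} [Enc α]

@[fun_prop]
theorem PolyTime.sameType {g l : α → List (List Bool)} {u v : α → ℕ} (hg : PolyTime g)
    (hl : PolyTime l) (hu : PolyTime u) (hv : PolyTime v) :
    PolyTime (fun a => sameType (g a) (l a) (u a) (v a)) := by
  unfold _root_.sameType twinB; fun_prop

@[fun_prop]
theorem PolyTime.classReps {g l : α → List (List Bool)} (hg : PolyTime g)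
    (hl : PolyTime l) : PolyTime (fun a => classReps (g a) (l a)) := by
  unfold _root_.classReps; fun_prop

@[fun_prop]
theorem PolyTime.vertexClasses {g l : α → List (List Bool)} (hg : PolyTime g)
    (hl : PolyTime l) : PolyTime (fun a => vertexClasses (g a) (l a)) := by
  unfold _root_.vertexClasses; fun_prop

@[fun_prop]
theorem PolyTime.classCounts {cl : α → List (List ℕ)} {L : α → List Bool} (hc : PolyTime cl)
    (hL : PolyTime L) : PolyTime (fun a => classCounts (cl a) (L a)) := by
  unfold _root_.classCounts; fun_prop

@[fun_prop]
theorem PolyTime.coreIn {cl : α → List (List ℕ)} {θ : α → ℕ} {x : α → List ℕ} (hc : PolyTime cl)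
    (hθ : PolyTime θ) (hx : PolyTime x) : PolyTime (fun a => coreIn (cl a) (θ a) (x a)) := by
  unfold _root_.coreIn; fun_prop

@[fun_prop]
theorem PolyTime.coreOut {cl : α → List (List ℕ)} {θ : α → ℕ} {x : α → List ℕ} (hc : PolyTime cl)
    (hθ : PolyTime θ) (hx : PolyTime x) : PolyTime (fun a => coreOut (cl a) (θ a) (x a)) := by
  unfold _root_.coreOut; fun_prop

@[fun_prop]
theorem PolyTime.canonBits {n : α → ℕ} {cl : α → List (List ℕ)} {x : α → List ℕ} (hn : PolyTime n)
    (hc : PolyTime cl) (hx : PolyTime x) : PolyTime (fun a => canonBits (n a) (cl a) (x a)) := by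
  unfold _root_.canonBits; fun_prop

@[fun_prop]
theorem PolyTime.unitMoveB {p : α → ℕ} {x y : α → List ℕ} (hp : PolyTime p) (hx : PolyTime x)
    (hy : PolyTime y) : PolyTime (fun a => unitMoveB (p a) (x a) (y a)) := by
  unfold _root_.unitMoveB; fun_prop

@[fun_prop]
theorem PolyTime.vecEqB {p : α → ℕ} {x y : α → List ℕ} (hp : PolyTime p) (hx : PolyTime x)
    (hy : PolyTime y) : PolyTime (fun a => vecEqB (p a) (x a) (y a)) := by
  unfold _root_.vecEqB; fun_prop

@[fun_prop]
theorem PolyTime.extendWalks {p : α → ℕ} {Q : α → List (List ℕ)} {l : α → List (List (List ℕ))}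
    (hp : PolyTime p) (hQ : PolyTime Q) (hl : PolyTime l) :
    PolyTime (fun a => extendWalks (p a) (Q a) (l a)) := by
  unfold _root_.extendWalks; fun_prop

@[fun_prop]
theorem PolyTime.trivialWalks {p : α → ℕ} {Q : α → List (List ℕ)} {s : α → List ℕ}
    (hp : PolyTime p) (hQ : PolyTime Q) (hs : PolyTime s) :
    PolyTime (fun a => trivialWalks (p a) (Q a) (s a)) := by
  unfold _root_.trivialWalks; fun_prop

theorem length_flatMap_take_one_le {β γ : Type} (Q : List β) (f : β → List γ) :
    (Q.flatMap fun q => (f q).take 1).length ≤ Q.length := by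
  induction Q with
  | nil => simp
  | cons q Q ih =>
    simp only [List.flatMap_cons, List.length_append, List.length_take, List.length_cons]
    omega

/-- Only one walk is kept for each entry of `Q`, whereas the number of all walks may grow
exponentially with their length. -/
theorem length_extendWalks (p : ℕ) (Q : List (List ℕ)) (l : List (List (List ℕ))) :
    (extendWalks p Q l).length ≤ Q.length := by
  unfold extendWalks
  simp only [List.map_take]
  exact length_flatMap_take_one_le Q _

theorem searchState_size (p : ℕ) (Q : List (List ℕ)) (s s' : List ℕ) (l : List Unit) :
    ((searchState p Q s s' l).1.length ≤ Q.length ∧ (searchState p Q s s' l).2.length ≤ Q.length) ∧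
      ∀ P, P ∈ (searchState p Q s s' l).1 ∨ P ∈ (searchState p Q s s' l).2 →
        P.length ≤ l.length + 1 ∧ ∀ q ∈ P, q ∈ Q := by
  induction l with
  | nil =>
    have h1 : (trivialWalks p Q s').length ≤ Q.length := by
      simp only [trivialWalks, List.length_map, List.length_take]
      exact (min_le_right _ _).trans (List.length_filter_le _ _)
    refine ⟨⟨(List.length_filter_le _ _).trans h1, h1⟩, fun P hP => ?_⟩
    have h2 : P ∈ trivialWalks p Q s' := hP.elim (fun h => (List.mem_filter.1 h).1) fun h => h
    simp only [trivialWalks, List.mem_map] at h2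
    obtain ⟨q, hq, rfl⟩ := h2
    have := List.mem_of_mem_take hq
    simp only [List.mem_filter] at this
    simpa using this.1
  | cons u l ih =>
    obtain ⟨⟨h1, h2⟩, h3⟩ := ih
    have e : searchState p Q s s' (u :: l) = searchStep p Q s (searchState p Q s s' l) := rfl
    rw [e]
    generalize searchState p Q s s' l = st at *
    have h4 : ∀ P ∈ extendWalks p Q st.2, P.length ≤ (u :: l).length + 1 ∧ ∀ q ∈ P, q ∈ Q := by
      intro P hP
      simp only [extendWalks, List.mem_flatMap, List.mem_map] at hP
      obtain ⟨q, hq, P, hP, rfl⟩ := hP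
      have h5 := List.mem_of_mem_take hP
      simp only [List.mem_filter] at h5
      obtain ⟨h6, h7⟩ := h3 P (.inr h5.1)
      simp only [List.length_cons, List.mem_cons, forall_eq_or_imp]
      exact ⟨by omega, hq, h7⟩
    refine ⟨⟨?_, length_extendWalks _ _ _⟩, fun P hP => ?_⟩
    · cases h : st.1.isEmpty
      · simpa [searchStep, h] using h1
      · simp only [searchStep, h, cond_true]
        exact (List.length_filter_le _ _).trans (length_extendWalks _ _ _)
    · rcases hP with hP | hP
      · cases h : st.1.isEmpty
        · simp only [searchStep, h, cond_false] at hP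
          obtain ⟨h6, h7⟩ := h3 P (.inl hP)
          exact ⟨by simp only [List.length_cons]; omega, h7⟩
        · simp only [searchStep, h, cond_true, List.mem_filter] at hP
          exact h4 P hP.1
      · exact h4 P hP

@[fun_prop]
theorem PolyTime.search {p : α → ℕ} {Q : α → List (List ℕ)} {s s' : α → List ℕ}
    (hp : PolyTime p) (hQ : PolyTime Q) (hs : PolyTime s) (hs' : PolyTime s') :
    PolyTime (fun a => search (p a) (Q a) (s a) (s' a)) := by
  have h : PolyTime (fun z : ℕ × List (List ℕ) × List ℕ × List ℕ =>
      (List.replicate z.2.1.length ()).foldr (fun _ e => searchStep z.1 z.2.1 z.2.2.1 e)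
        ((_root_.trivialWalks z.1 z.2.1 z.2.2.2).filter fun P =>
          _root_.vecEqB z.1 (P.headD []) z.2.2.1, _root_.trivialWalks z.1 z.2.1 z.2.2.2)) := by
    refine PolyTime.foldr (β := Unit)
      (f := fun (z : ℕ × List (List ℕ) × List ℕ × List ℕ) _ e => searchStep z.1 z.2.1 z.2.2.1 e)
      (b := fun z => ((_root_.trivialWalks z.1 z.2.1 z.2.2.2).filter fun P =>
          _root_.vecEqB z.1 (P.headD []) z.2.2.1, _root_.trivialWalks z.1 z.2.1 z.2.2.2))
      (by unfold searchStep; fun_prop) (by fun_prop) (by fun_prop) ?_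
    have r : PolyLE (sz (α := (ℕ × List (List ℕ) × List ℕ × List ℕ) × List Unit)) sz := .refl _
    refine PolyLE.mono ((((PolyLE.const 2).mul ((r.mul (((r.add (.const 1)).mul
      (r.add (.const 1))).add (.const 2))).add (.const 1)))).add (.const 1)) fun z => ?_
    have e1 : ∀ l : List (List (List ℕ)), l.length ≤ z.1.2.1.length →
        (∀ P ∈ l, P.length ≤ z.2.length + 1 ∧ ∀ q ∈ P, q ∈ z.1.2.1) →
        sz l ≤ sz z * ((sz z + 1) * (sz z + 1) + 2) + 1 := by
      intro l h1 h2
      have hz1 := sz_prod z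
      have hz2 := sz_prod z.1
      have hz3 := sz_prod z.1.2
      have hz4 := length_lt_sz z.2
      have hz5 := length_lt_sz z.1.2.1
      refine (sz_list_le (k := (sz z + 1) * (sz z + 1) + 1) fun P hP => ?_).trans ?_
      · obtain ⟨h3, h4⟩ := h2 P hP
        refine (sz_list_le (k := sz z) fun q hq => ?_).trans ?_
        · have := sz_mem (h4 q hq)
          omega
        · gcongr
          omega
      · have : l.length ≤ sz z := by omega
        gcongr
    obtain ⟨⟨h1, h2⟩, h3⟩ := searchState_size z.1.1 z.1.2.1 z.1.2.2.1 z.1.2.2.2 z.2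
    show sz (searchState z.1.1 z.1.2.1 z.1.2.2.1 z.1.2.2.2 z.2) ≤ _
    rw [sz_prod]
    have a1 := e1 _ h1 fun P hP => h3 P (.inl hP)
    have a2 := e1 _ h2 fun P hP => h3 P (.inr hP)
    omega
  exact (h.fst).comp (f := fun a => (p a, Q a, s a, s' a)) (by fun_prop)

end Time

/-- The measure for the tests of a list of vectors. -/
def testMeasure (z : TestData) : ℕ :=
  (2 * (z.2.2.2.1.length * z.2.2.2.2) + 2 ^ (2 * (z.2.2.2.1.length * z.2.2.2.2)) + 2) ^ z.1.φ.nodes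

theorem length_flatMap_range_le {β : Type} (f : ℕ → List β) {θ : ℕ} (h : ∀ i, (f i).length ≤ θ)
    (p : ℕ) : ((List.range p).flatMap f).length ≤ p * θ := by
  induction p with
  | zero => simp
  | succ p ih =>
    have := h p
    rw [List.range_succ, List.flatMap_append, List.length_append, add_mul]
    rw [List.flatMap_singleton]
    omega

theorem length_core_le (cl : List (List ℕ)) (θ : ℕ) (x : List ℕ) :
    (coreIn cl θ x ++ coreOut cl θ x).length ≤ 2 * (cl.length * θ) := by
  have h1 : (coreIn cl θ x).length ≤ cl.length * θ :=
    length_flatMap_range_le _ (fun i => List.length_take_le _ _) _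
  have h2 : (coreOut cl θ x).length ≤ cl.length * θ :=
    length_flatMap_range_le _ (fun i => List.length_take_le _ _) _
  rw [List.length_append]
  omega

/-- The core has at most `θ` vertices of each class on either side, so the sizes of both quantifier
domains are bounded in terms of the number of classes and `θ`. -/
theorem allowed_pt : PT (fun z : TestData × List ℕ => testMeasure z.1 + sz z)
    (fun z : TestData × List ℕ => allowed z.1 z.2) := by
  let μ : TestData × List ℕ → ℕ := fun z => testMeasure z.1 + sz z
  let K : TestData × List ℕ → List ℕ := fun z =>
    coreIn z.1.2.2.2.1 z.1.2.2.2.2 z.2 ++ coreOut z.1.2.2.2.1 z.1.2.2.2.2 z.2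
  have hsz : PolyLE sz μ := .of_le fun z => Nat.le_add_left _ _
  have htest : PolyLE (fun z : TestData × List ℕ => testMeasure z.1) μ :=
    .of_le fun z => Nat.le_add_right _ _
  have hK : PolyTime K := by fun_prop
  have hpow : ∀ z, 2 ^ (K z).length ≤ testMeasure z.1 := fun z => by
    have h1 : 2 ^ (K z).length ≤ 2 ^ (2 * (z.1.2.2.2.1.length * z.1.2.2.2.2)) :=
      Nat.pow_le_pow_right (by omega) (length_core_le _ _ _)
    refine le_trans ?_ (Nat.le_self_pow (by have := z.1.1.φ.one_le_nodes; omega) _)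
    omega
  have hsub : PT μ fun z => (K z).sublists' :=
    PT.comp sublists_pt (hK.pt hsz) ((htest.mono hpow).add (hK.size.trans hsz))
  have hΓ : PT μ fun z : TestData × List ℕ => (K z, (K z).sublists', z.1.2.1, z.1.2.2.1) :=
    (hK.pt hsz).pair (hsub.pair (PolyTime.pt (by fun_prop) hsz))
  have hφ : PT μ fun z : TestData × List ℕ => z.1.1 := PolyTime.pt (by fun_prop) hsz
  have harg : PT μ fun z : TestData × List ℕ => (z.1.1,
      (K z, (K z).sublists', z.1.2.1, z.1.2.2.1), ([] : List ℕ),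
        [coreIn z.1.2.2.2.1 z.1.2.2.2.2 z.2]) :=
    hφ.pair (hΓ.pair (PolyTime.pt (by fun_prop) hsz))
  refine PT.comp evalB_pt harg (((htest.mono fun z => ?_).add (hφ.size.mul hΓ.size)).add harg.size)
  refine Nat.pow_le_pow_left ?_ _
  show (K z).length + (K z).sublists'.length + 2 ≤ _
  have h1 : (K z).length ≤ _ := length_core_le z.1.2.2.2.1 z.1.2.2.2.2 z.2
  have h2 : 2 ^ (K z).length ≤ 2 ^ (2 * (z.1.2.2.2.1.length * z.1.2.2.2.2)) :=
    Nat.pow_le_pow_right (by omega) h1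
  rw [List.length_sublists']
  omega

theorem filter_allowed_pt : PT (fun z : TestData × List (List ℕ) => testMeasure z.1 + sz z)
    (fun z : TestData × List (List ℕ) => z.2.filter (allowed z.1)) := by
  refine PT.filter allowed_pt (fun a x l => ?_) (fun a x l => ?_) fun z => Nat.le_add_left _ _ <;>
  · simp only [sz_pair, sz_cons]
    omega

/-! ### Correctness of the search -/

section Search

variable {p : ℕ}

/-- The vector of the first `p` entries of a list. -/
def toVec (p : ℕ) (x : List ℕ) : Fin p → ℤ := fun i => (x.getD i 0 : ℤ)

theorem unitMoveB_iff {x y : List ℕ} :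
    unitMoveB p x y = true ↔ UnitMove (toVec p x) (toVec p y) := by
  simp only [unitMoveB, List.any_eq_true, List.mem_range, Bool.and_eq_true, Bool.not_eq_true',
    beq_eq_false_iff_ne, beq_iff_eq, List.all_eq_true, Bool.or_eq_true, UnitMove, toVec]
  constructor
  · rintro ⟨i, hi, j, hj, ⟨⟨h1, h2⟩, h3⟩, h4⟩
    refine ⟨⟨i, hi⟩, ⟨j, hj⟩, by simpa using h1, by exact_mod_cast h2,
      show (y.getD j 0 : ℤ) = x.getD j 0 - 1 by omega, fun l hli hlj => ?_⟩
    have h5 : (l : ℕ) ≠ i := fun h => hli (Fin.ext h)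
    have h6 : (l : ℕ) ≠ j := fun h => hlj (Fin.ext h)
    rcases h4 l l.2 with (h | h) | h
    · exact absurd h h5
    · exact absurd h h6
    · exact_mod_cast h
  · rintro ⟨i, j, h1, h2, h3, h4⟩
    refine ⟨i, i.2, j, j.2, ⟨⟨fun h => h1 (Fin.ext h), by exact_mod_cast h2⟩, by omega⟩,
      fun l hl => ?_⟩
    by_cases hli : l = i
    · exact .inl (.inl hli)
    · by_cases hlj : l = j
      · exact .inl (.inr hlj)
      · have := h4 ⟨l, hl⟩ (fun h => hli (congrArg Fin.val h)) (fun h => hlj (congrArg Fin.val h))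
        exact .inr (by exact_mod_cast this)

theorem vecEqB_iff {x y : List ℕ} : vecEqB p x y = true ↔ toVec p x = toVec p y := by
  simp only [vecEqB, List.all_eq_true, List.mem_range, beq_iff_eq, toVec, funext_iff, Fin.forall_iff]
  exact forall₂_congr fun i hi => by norm_cast

/-- If the walk visits `x`, its part from that visit on is a walk from `x`. This cuts off loops in
`Walk.lt_card`. -/
theorem Walk.avoid_or_exists {A : (Fin p → ℤ) → Prop} {n : ℕ} {z y : Fin p → ℤ} (x : Fin p → ℤ)
    (h : Walk A n z y) : Walk (fun w => A w ∧ w ≠ x) n z y ∨ ∃ k ≤ n, Walk A k x y := by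
  by_cases hx : z = x
  · subst hx
    exact .inr ⟨n, le_rfl, h⟩
  · induction n generalizing z with
    | zero => exact .inl ⟨⟨h.1, hx⟩, h.2⟩
    | succ n ih =>
      obtain ⟨hz, w, hw, h⟩ := h
      by_cases hwx : w = x
      · subst hwx
        exact .inr ⟨n, by omega, h⟩
      · rcases ih h hwx with h' | ⟨k, hk, h'⟩
        · exact .inl ⟨⟨hz, hx⟩, w, hw, h'⟩
        · exact .inr ⟨k, by omega, h'⟩

theorem Walk.imp {A A' : (Fin p → ℤ) → Prop} (hA : ∀ x, A x → A' x) {n : ℕ} {x y : Fin p → ℤ}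
    (h : Walk A n x y) : Walk A' n x y := by
  induction n generalizing x with
  | zero => exact ⟨hA _ h.1, h.2⟩
  | succ n ih =>
    obtain ⟨hx, z, hz, h⟩ := h
    exact ⟨hA _ hx, z, hz, ih h⟩

/-- A shortest walk does not repeat vectors. -/
theorem Walk.lt_card {A : (Fin p → ℤ) → Prop} {F : Finset (Fin p → ℤ)} (hF : ∀ x, A x → x ∈ F)
    {n : ℕ} {x y : Fin p → ℤ} (h : Walk A n x y) (hmin : ∀ k, Walk A k x y → n ≤ k) :
    n < F.card := by
  classical
  induction n generalizing A F x with
  | zero => exact Finset.card_pos.2 ⟨x, hF _ h.1⟩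
  | succ n ih =>
    obtain ⟨hx, z, hz, h⟩ := h
    rcases h.avoid_or_exists x with h' | ⟨k, hk, h'⟩
    · have h2 := ih (A := fun w => A w ∧ w ≠ x) (F := F.erase x)
        (fun w hw => Finset.mem_erase.2 ⟨hw.2, hF _ hw.1⟩) h' fun k hk => by
          have := hmin (k + 1) ⟨hx, z, hz, hk.imp fun _ h => h.1⟩
          omega
      rw [Finset.card_erase_of_mem (hF _ hx)] at h2
      omega
    · have := hmin k h'
      omega

/-- The list `P` represents a walk in `Q` with the last vector `t`. -/
structure IsVecWalk (p : ℕ) (Q : List (List ℕ)) (t : Fin p → ℤ) (P : List (List ℕ)) : Prop where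
  mem : ∀ q ∈ P, q ∈ Q
  chain : P.IsChain fun x y => UnitMove (toVec p x) (toVec p y)
  last : ∃ q, P.getLast? = some q ∧ toVec p q = t

theorem IsVecWalk.exists_cons {Q : List (List ℕ)} {t : Fin p → ℤ} {P : List (List ℕ)}
    (h : IsVecWalk p Q t P) : ∃ q P', P = q :: P' := by
  cases P with
  | nil => obtain ⟨q, hq, -⟩ := h.last; simp at hq
  | cons q P' => exact ⟨q, P', rfl⟩

/-- The vectors that are represented in a list. -/
def VecMem (p : ℕ) (Q : List (List ℕ)) (x : Fin p → ℤ) : Prop := ∃ q ∈ Q, toVec p q = x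

theorem exists_mem_take_one_filter {β : Type} {l : List β} {f : β → Bool} {a : β} (ha : a ∈ l)
    (hf : f a = true) : ∃ b ∈ (l.filter f).take 1, b ∈ l ∧ f b = true := by
  have : a ∈ l.filter f := List.mem_filter.2 ⟨ha, hf⟩
  cases h : l.filter f with
  | nil => simp [h] at this
  | cons b l' =>
    have hb : b ∈ l.filter f := by simp [h]
    exact ⟨b, by simp, List.mem_filter.1 hb⟩

theorem mem_extendWalks {Q : List (List ℕ)} {t : Fin p → ℤ} {l : List (List (List ℕ))}
    (hl : ∀ P ∈ l, IsVecWalk p Q t P) {P : List (List ℕ)} (hP : P ∈ extendWalks p Q l) :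
    IsVecWalk p Q t P ∧ ∃ P' ∈ l, P.length = P'.length + 1 := by
  simp only [extendWalks, List.mem_flatMap, List.mem_map] at hP
  obtain ⟨q, hq, P, hP, rfl⟩ := hP
  have h1 := List.mem_filter.1 (List.mem_of_mem_take hP)
  have h2 := hl P h1.1
  obtain ⟨q', P', rfl⟩ := h2.exists_cons
  refine ⟨⟨?_, ?_, ?_⟩, _, h1.1, rfl⟩
  · simpa [hq] using h2.mem
  · exact List.isChain_cons_cons.2 ⟨unitMoveB_iff.1 h1.2, h2.chain⟩
  · rw [List.getLast?_cons_cons]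
    exact h2.last

theorem exists_mem_extendWalks {Q : List (List ℕ)} {l : List (List (List ℕ))} {x z : Fin p → ℤ}
    (hx : VecMem p Q x) (hz : UnitMove x z) (h : ∃ P ∈ l, toVec p (P.headD []) = z) :
    ∃ P ∈ extendWalks p Q l, toVec p (P.headD []) = x := by
  obtain ⟨q, hq, rfl⟩ := hx
  obtain ⟨P, hP, rfl⟩ := h
  obtain ⟨P', h1, h2, h3⟩ := exists_mem_take_one_filter
    (f := fun P => unitMoveB p q (P.headD [])) hP (unitMoveB_iff.2 hz)
  refine ⟨q :: P', ?_, rfl⟩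
  simp only [extendWalks, List.mem_flatMap, List.mem_map]
  exact ⟨q, hq, P', h1, rfl⟩

/-- Soundness and completeness of both components. The second one holds, for every vector from which
a walk of exactly the present length exists, such a walk. The first one is filled in the first round
in which a walk starts in `s` and is frozen afterwards, which is why its walks are shortest. -/
theorem searchState_spec (Q : List (List ℕ)) (s s' : List ℕ) (l : List Unit) :
    (∀ P ∈ (searchState p Q s s' l).2,
      IsVecWalk p Q (toVec p s') P ∧ P.length = l.length + 1) ∧
    (∀ x, Walk (VecMem p Q) l.length x (toVec p s') →
      ∃ P ∈ (searchState p Q s s' l).2, toVec p (P.headD []) = x) ∧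
    (∀ P ∈ (searchState p Q s s' l).1, IsVecWalk p Q (toVec p s') P ∧
      toVec p (P.headD []) = toVec p s ∧
      ∀ k, Walk (VecMem p Q) k (toVec p s) (toVec p s') → P.length ≤ k + 1) ∧
    ∀ k ≤ l.length, Walk (VecMem p Q) k (toVec p s) (toVec p s') →
      (searchState p Q s s' l).1 ≠ [] := by
  induction l with
  | nil =>
    have ha : ∀ P ∈ trivialWalks p Q s', IsVecWalk p Q (toVec p s') P ∧ P.length = 0 + 1 := by
      intro P hP
      simp only [trivialWalks, List.mem_map] at hP
      obtain ⟨q, hq, rfl⟩ := hP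
      have h1 := List.mem_filter.1 (List.mem_of_mem_take hq)
      exact ⟨⟨by simpa using h1.1, by simp, q, by simp, vecEqB_iff.1 h1.2⟩, rfl⟩
    have hb : ∀ x, Walk (VecMem p Q) 0 x (toVec p s') →
        ∃ P ∈ trivialWalks p Q s', toVec p (P.headD []) = x := by
      rintro x ⟨⟨q, hq, rfl⟩, hx⟩
      obtain ⟨q', h1, h2, h3⟩ := exists_mem_take_one_filter
        (f := fun q => vecEqB p q s') hq (vecEqB_iff.2 hx)
      refine ⟨[q'], List.mem_map.2 ⟨q', h1, rfl⟩, ?_⟩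
      rw [hx]
      exact vecEqB_iff.1 h3
    refine ⟨ha, hb, fun P hP => ?_, fun k hk hw => ?_⟩
    · have h1 := List.mem_filter.1 hP
      have h2 := ha P h1.1
      exact ⟨h2.1, vecEqB_iff.1 h1.2, fun k _ => by omega⟩
    · obtain rfl : k = 0 := by simpa using hk
      obtain ⟨P, hP, he⟩ := hb _ hw
      exact List.ne_nil_of_mem (List.mem_filter.2 ⟨hP, vecEqB_iff.2 he⟩)
  | cons u l ih =>
    obtain ⟨ha, hb, hc, hd⟩ := ih
    have e : searchState p Q s s' (u :: l) = searchStep p Q s (searchState p Q s s' l) := rfl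
    rw [e, List.length_cons]
    generalize searchState p Q s s' l = st at *
    have ha' : ∀ P ∈ extendWalks p Q st.2,
        IsVecWalk p Q (toVec p s') P ∧ P.length = l.length + 1 + 1 := by
      intro P hP
      obtain ⟨h1, P', h2, h3⟩ := mem_extendWalks (fun P hP => (ha P hP).1) hP
      exact ⟨h1, by rw [h3, (ha P' h2).2]⟩
    have hb' : ∀ x, Walk (VecMem p Q) (l.length + 1) x (toVec p s') →
        ∃ P ∈ extendWalks p Q st.2, toVec p (P.headD []) = x := by
      rintro x ⟨hx, z, hz, h⟩
      exact exists_mem_extendWalks hx hz (hb z h)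
    refine ⟨ha', hb', ?_⟩
    cases h : st.1.isEmpty
    · have e : (searchStep p Q s st).1 = st.1 := by simp [searchStep, h]
      rw [e]
      exact ⟨hc, fun k hk hw h' => by simp [h'] at h⟩
    · have e : (searchStep p Q s st).1 =
          (extendWalks p Q st.2).filter fun P => vecEqB p (P.headD []) s := by
        simp [searchStep, h]
      have hne : ∀ k ≤ l.length, ¬ Walk (VecMem p Q) k (toVec p s) (toVec p s') :=
        fun k hk hw => hd k hk hw (by simpa using h)
      rw [e]
      refine ⟨fun P hP => ?_, fun k hk hw => ?_⟩
      · have h1 := List.mem_filter.1 hP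
        have h2 := ha' P h1.1
        refine ⟨h2.1, vecEqB_iff.1 h1.2, fun k hw => ?_⟩
        have : ¬ k ≤ l.length := fun h => hne k h hw
        omega
      · obtain rfl : k = l.length + 1 := by
          have : ¬ k ≤ l.length := fun h => hne k h hw
          omega
        obtain ⟨P, hP, he⟩ := hb' _ hw
        exact List.ne_nil_of_mem (List.mem_filter.2 ⟨hP, vecEqB_iff.2 he⟩)

theorem search_sound {Q : List (List ℕ)} {s s' : List ℕ} {P : List (List ℕ)}
    (hP : P ∈ search p Q s s') : IsVecWalk p Q (toVec p s') P ∧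
      toVec p (P.headD []) = toVec p s ∧
      ∀ k, Walk (VecMem p Q) k (toVec p s) (toVec p s') → P.length ≤ k + 1 :=
  (searchState_spec Q s s' _).2.2.1 P hP

/-- A shortest walk does not repeat vectors, so `Q.length` rounds suffice to find it. -/
theorem search_ne_nil {Q : List (List ℕ)} {s s' : List ℕ} {k : ℕ}
    (h : Walk (VecMem p Q) k (toVec p s) (toVec p s')) : search p Q s s' ≠ [] := by
  classical
  obtain ⟨n, hn, hmin⟩ := exists_argmin (P := fun k => Walk (VecMem p Q) k (toVec p s) (toVec p s'))
    ⟨k, h⟩ id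
  have h1 := hn.lt_card (F := (Q.map (toVec p)).toFinset)
    (fun x ⟨q, hq, e⟩ => by simpa using ⟨q, hq, e⟩) hmin
  have h2 := List.toFinset_card_le (Q.map (toVec p))
  rw [List.length_map] at h2
  exact (searchState_spec Q s s' _).2.2.2 n (by rw [List.length_replicate]; omega) hn

end Search

/-! ### Sets of vertices and vectors of class sizes -/

section Ranking

variable {n c p : ℕ}

/-- The numbers of elements of `R` of each type. -/
def typeCounts (ty : Fin n → Fin p) (R : Finset (Fin n)) : Fin p → ℤ :=
  fun i => ((R.filter fun u => ty u = i).card : ℤ)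

theorem typeCounts_eq_inter_add (ty : Fin n → Fin p) (R R' : Finset (Fin n)) (i : Fin p) :
    typeCounts ty R i = typeCounts ty (R ∩ R') i + typeCounts ty (R \ R') i := by
  unfold typeCounts
  norm_cast
  rw [← Finset.card_union_of_disjoint, ← Finset.filter_union, Finset.union_comm, Finset.sdiff_union_inter]
  exact Finset.disjoint_filter_filter (Finset.disjoint_sdiff_inter R R').symm

theorem typeCounts_singleton (ty : Fin n → Fin p) (u : Fin n) (i : Fin p) :
    typeCounts ty {u} i = if ty u = i then 1 else 0 := by
  unfold typeCounts
  rw [Finset.filter_singleton]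
  split_ifs <;> simp

/-- The token leaves the class of one vertex and enters that of another; nothing is visible if the
two classes coincide. -/
theorem TJMove.typeCounts (ty : Fin n → Fin p) {R R' : Finset (Fin n)} (h : TJMove R R') :
    typeCounts ty R = typeCounts ty R' ∨ UnitMove (typeCounts ty R) (typeCounts ty R') := by
  obtain ⟨a, ha⟩ := Finset.card_eq_one.1 h.1
  obtain ⟨b, hb⟩ := Finset.card_eq_one.1 h.2
  have h1 := typeCounts_eq_inter_add ty R R'
  have h2 := typeCounts_eq_inter_add ty R' R
  rw [Finset.inter_comm] at h2
  simp only [ha, hb, typeCounts_singleton] at h1 h2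
  by_cases hab : ty a = ty b
  · exact .inl (funext fun i => by rw [h1, h2, hab])
  · refine .inr ⟨ty b, ty a, Ne.symm hab, ?_, ?_, fun l hlb hla => ?_⟩
    · rw [h1, h2, if_neg hab, if_pos rfl]; ring
    · rw [h1, h2, if_pos rfl, if_neg (Ne.symm hab)]; ring
    · rw [h1, h2, if_neg (Ne.symm hla), if_neg (Ne.symm hlb)]

theorem TJMove.card_eq {R R' : Finset (Fin n)} (h : TJMove R R') : R.card = R'.card := by
  have h1 := Finset.card_inter_add_card_sdiff R R'
  have h2 := Finset.card_inter_add_card_sdiff R' R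
  rw [Finset.inter_comm] at h2
  have := h.1
  have := h.2
  omega

/-- The vectors of class sizes of the sets that satisfy a formula. -/
def SatVec (G : ColoredGraph n c) (φ : MSO1 c 0 1) (ty : Fin n → Fin p) (x : Fin p → ℤ) : Prop :=
  ∃ R, typeCounts ty R = x ∧ φ.Sat G R

/-- A `TJ(φ)`-sequence induces a walk of vectors. -/
theorem IsTJSequence.exists_walk {G : ColoredGraph n c} {φ : MSO1 c 0 1} (ty : Fin n → Fin p)
    {S S' : Finset (Fin n)} {L : List (Finset (Fin n))} (h : IsTJSequence G φ S S' L) :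
    ∃ k, k + 1 ≤ L.length ∧ Walk (SatVec G φ ty) k (typeCounts ty S) (typeCounts ty S') := by
  obtain ⟨h1, h2, h3, h4⟩ := h
  induction L generalizing S with
  | nil => simp at h1
  | cons R L ih =>
    obtain rfl : R = S := by simpa using h1
    have hR : SatVec G φ ty (typeCounts ty R) := ⟨R, rfl, h4 R (by simp)⟩
    cases L with
    | nil =>
      obtain rfl : R = S' := by simpa using h2
      exact ⟨0, by simp, hR, rfl⟩
    | cons R' L =>
      rw [List.isChain_cons_cons] at h3
      obtain ⟨k, hk, hw⟩ := ih (S := R') rfl (by simpa using h2) h3.2 fun T hT => h4 T (by simp [hT])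
      simp only [List.length_cons] at hk ⊢
      -- Jumps within a class disappear, so the walk can be shorter than the sequence.
      rcases h3.1.typeCounts ty with e | e
      · exact ⟨k, by omega, e ▸ hw⟩
      · exact ⟨k + 1, by omega, hR, _, e, hw⟩

/-- Without vertex variables and with a single set variable, the cells are the parts of the classes
inside and outside of the set. -/
theorem cellSimilar_of_card {ty : Fin n → Fin p} {θ : ℕ} {K R K' R' : Finset (Fin n)}
    (hin : ∀ i, (K.filter fun u => ty u = i ∧ u ∈ R).card = (K'.filter fun u => ty u = i ∧ u ∈ R').card ∨
      (θ ≤ (K.filter fun u => ty u = i ∧ u ∈ R).card ∧ θ ≤ (K'.filter fun u => ty u = i ∧ u ∈ R').card))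
    (hout : ∀ i, (K.filter fun u => ty u = i ∧ u ∉ R).card =
      (K'.filter fun u => ty u = i ∧ u ∉ R').card ∨ (θ ≤ (K.filter fun u => ty u = i ∧ u ∉ R).card ∧
        θ ≤ (K'.filter fun u => ty u = i ∧ u ∉ R').card)) :
    CellSimilar ty θ K (Fin.elim0 : Fin 0 → Fin n) (fun _ : Fin 1 => R) K'
      (Fin.elim0 : Fin 0 → Fin n) (fun _ : Fin 1 => R') where
  ty_eq i := i.elim0
  eq_iff i := i.elim0
  mem_iff i := i.elim0
  card τ P := by
    by_cases hP : P 0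
    · have key : ∀ K R : Finset (Fin n), cell ty K (Fin.elim0 : Fin 0 → Fin n)
          (fun _ : Fin 1 => R) τ P = K.filter fun u => ty u = τ ∧ u ∈ R := by
        intro K R
        ext u
        rw [mem_cell, Finset.mem_filter]
        simp [hP]
      rw [key, key]
      exact hin τ
    · have key : ∀ K R : Finset (Fin n), cell ty K (Fin.elim0 : Fin 0 → Fin n)
          (fun _ : Fin 1 => R) τ P = K.filter fun u => ty u = τ ∧ u ∉ R := by
        intro K R
        ext u
        rw [mem_cell, Finset.mem_filter]
        simp [hP]
      rw [key, key]
      exact hout τ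

/-- The elements of each type `i` are numbered from `0` to `m i - 1`. -/
structure IsRanking (m : Fin p → ℕ) (ty : Fin n → Fin p) (rank : Fin n → ℕ) : Prop where
  lt : ∀ u, rank u < m (ty u)
  inj : ∀ u v, ty u = ty v → rank u = rank v → u = v
  surj : ∀ i k, k < m i → ∃ u, ty u = i ∧ rank u = k

/-- The set of the first `x i` elements of each type `i`. -/
def canonSet (ty : Fin n → Fin p) (rank : Fin n → ℕ) (x : Fin p → ℤ) : Finset (Fin n) :=
  Finset.univ.filter fun u => (rank u : ℤ) < x (ty u)

theorem mem_canonSet {ty : Fin n → Fin p} {rank : Fin n → ℕ} {x : Fin p → ℤ} {u : Fin n} :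
    u ∈ canonSet ty rank x ↔ (rank u : ℤ) < x (ty u) := by simp [canonSet]

variable {m : Fin p → ℕ} {ty : Fin n → Fin p} {rank : Fin n → ℕ}

theorem IsRanking.card_interval (h : IsRanking m ty rank) (i : Fin p) {a b : ℕ} (hb : b ≤ m i)
    {F : Finset (Fin n)} (hF : ∀ u, u ∈ F ↔ ty u = i ∧ a ≤ rank u ∧ rank u < b) :
    F.card = b - a := by
  rw [← Nat.card_Ico]
  refine Finset.card_bij (fun u _ => rank u) (fun u hu => ?_) (fun u hu v hv => ?_) fun k hk => ?_
  · have := (hF u).1 hu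
    simpa using this.2
  · exact h.inj u v (((hF u).1 hu).1.trans ((hF v).1 hv).1.symm)
  · rw [Finset.mem_Ico] at hk
    obtain ⟨u, hu, rfl⟩ := h.surj i k (by omega)
    exact ⟨u, (hF u).2 ⟨hu, hk⟩, rfl⟩

theorem IsRanking.card_type (h : IsRanking m ty rank) (i : Fin p) :
    (Finset.univ.filter fun u => ty u = i).card = m i := by
  rw [h.card_interval i (a := 0) (b := m i) le_rfl fun u => ?_, Nat.sub_zero]
  simp only [Finset.mem_filter, Finset.mem_univ, true_and]
  exact ⟨fun hu => ⟨hu, Nat.zero_le _, hu ▸ h.lt u⟩, fun hu => hu.1⟩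

theorem IsRanking.card_filter (h : IsRanking m ty rank) (R : Finset (Fin n)) (i : Fin p) :
    ((Finset.univ.filter fun u => ty u = i ∧ u ∈ R).card : ℤ) = typeCounts ty R i ∧
    ((Finset.univ.filter fun u => ty u = i ∧ u ∉ R).card : ℤ) = m i - typeCounts ty R i := by
  have h1 : (Finset.univ.filter fun u => ty u = i ∧ u ∈ R) = R.filter fun u => ty u = i := by
    ext u; simp [and_comm]
  have h2 := Finset.card_filter_add_card_filter_not (s := Finset.univ.filter fun u => ty u = i)
    (fun u => u ∈ R)
  rw [Finset.filter_filter, Finset.filter_filter, h.card_type i, h1] at h2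
  rw [h1]
  unfold typeCounts
  exact ⟨rfl, by omega⟩

theorem IsRanking.typeCounts_mem (h : IsRanking m ty rank) (R : Finset (Fin n)) (i : Fin p) :
    0 ≤ typeCounts ty R i ∧ typeCounts ty R i ≤ m i := by
  have h1 := (h.card_filter R i).2
  have h2 := (h.card_filter R i).1
  omega

theorem IsRanking.typeCounts_canonSet (h : IsRanking m ty rank) {x : Fin p → ℤ}
    (hx : ∀ i, 0 ≤ x i ∧ x i ≤ m i) : typeCounts ty (canonSet ty rank x) = x := by
  funext i
  have hi := hx i
  rw [typeCounts, h.card_interval i (a := 0) (b := (x i).toNat) (by omega) fun u => ?_]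
  · omega
  · rw [Finset.mem_filter, mem_canonSet]
    constructor
    · rintro ⟨h1, rfl⟩
      exact ⟨rfl, by omega, by omega⟩
    · rintro ⟨rfl, -, h1⟩
      exact ⟨by omega, rfl⟩

/-- Whether a set satisfies a formula depends on the shape of its vector only. -/
theorem IsRanking.sat_congr (h : IsRanking m ty rank) {G : ColoredGraph n c} {φ : MSO1 c 0 1}
    (hty : IsTyping G φ.usedColors ty) {R R' : Finset (Fin n)}
    (hs : SameShape (2 ^ φ.nodes) m (typeCounts ty R) (typeCounts ty R')) :
    φ.Sat G R ↔ φ.Sat G R' := by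
  unfold MSO1.Sat
  rw [← MSO1.holdsOn_univ, ← MSO1.holdsOn_univ]
  refine MSO1.holdsOn_congr hty φ (fun a ha => ha) (cellSimilar_of_card (fun i => ?_) fun i => ?_)
    (fun i => i.elim0) fun i => i.elim0
  · have h1 := (h.card_filter R i).1
    have h2 := (h.card_filter R' i).1
    rcases hs i with h3 | h3 <;> omega
  · have h1 := (h.card_filter R i).2
    have h2 := (h.card_filter R' i).2
    rcases hs i with h3 | h3 <;> omega

/-- The closure property of `A` on which `Walk.exists_restricted` rests. The new vector stays within
the bounds, so its canonical set realizes it. -/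
theorem IsRanking.satVec_congr (h : IsRanking m ty rank) {G : ColoredGraph n c} {φ : MSO1 c 0 1}
    (hty : IsTyping G φ.usedColors ty) {x y : Fin p → ℤ} (hx : SatVec G φ ty x)
    (hs : SameShape (2 ^ φ.nodes) m x y) : SatVec G φ ty y := by
  obtain ⟨R, rfl, hR⟩ := hx
  have hy : typeCounts ty (canonSet ty rank y) = y := by
    refine h.typeCounts_canonSet fun i => ?_
    have h1 := h.typeCounts_mem R i
    have h3 := hs i
    generalize 2 ^ φ.nodes = θ at h3
    rcases h3 with h2 | h2 <;> omega
  exact ⟨_, hy, (h.sat_congr hty (by rwa [hy])).1 hR⟩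

/-- Within one class canonical sets are nested, so their difference is an interval of ranks; it has
one element in the class that loses a unit and is empty in the others. -/
theorem IsRanking.tjMove (h : IsRanking m ty rank) {x y : Fin p → ℤ}
    (hx : ∀ i, 0 ≤ x i ∧ x i ≤ m i) (hy : ∀ i, 0 ≤ y i ∧ y i ≤ m i) (hxy : UnitMove x y) :
    TJMove (canonSet ty rank x) (canonSet ty rank y) := by
  have key : ∀ {x y : Fin p → ℤ} (j : Fin p), 0 ≤ y j → x j ≤ m j → y j = x j - 1 →
      (∀ l ≠ j, x l ≤ y l) → (canonSet ty rank x \ canonSet ty rank y).card = 1 := by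
    intro x y j h0 hm hj hl
    rw [h.card_interval j (a := (y j).toNat) (b := (x j).toNat) (by omega) fun u => ?_]
    · omega
    · rw [Finset.mem_sdiff, mem_canonSet, mem_canonSet]
      constructor
      · rintro ⟨h1, h2⟩
        by_cases hu : ty u = j
        · rw [hu] at h1 h2
          exact ⟨hu, by omega, by omega⟩
        · have := hl _ hu
          omega
      · rintro ⟨rfl, h1, h2⟩
        omega
  obtain ⟨i, j, hij, hi, hj, hl⟩ := hxy
  refine ⟨key j (hy j).1 (hx j).2 hj fun l hlj => ?_, key i (hx i).1 (hy i).2 (by omega)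
    fun l hli => ?_⟩
  · by_cases hli : l = i
    · rw [hli]; omega
    · exact (hl l hli hlj).ge
  · by_cases hlj : l = j
    · rw [hlj]; omega
    · exact (hl l hli hlj).le

/-- A union of classes is determined by its vector. -/
theorem IsRanking.canonSet_typeCounts (h : IsRanking m ty rank) {S : Finset (Fin n)}
    (hS : ∀ u v, ty u = ty v → (u ∈ S ↔ v ∈ S)) : canonSet ty rank (typeCounts ty S) = S := by
  ext u
  rw [mem_canonSet]
  have h1 := h.lt u
  have hc := h.card_filter S (ty u)
  by_cases hu : u ∈ S
  · have : (Finset.univ.filter fun v => ty v = ty u ∧ v ∉ S) = ∅ :=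
      Finset.filter_eq_empty_iff.2 fun v _ hv => hv.2 ((hS v u hv.1).2 hu)
    rw [this, Finset.card_empty] at hc
    exact iff_of_true (by omega) hu
  · have : (Finset.univ.filter fun v => ty v = ty u ∧ v ∈ S) = ∅ :=
      Finset.filter_eq_empty_iff.2 fun v _ hv => hu ((hS v u hv.1).1 hv.2)
    rw [this, Finset.card_empty] at hc
    exact iff_of_false (by omega) hu

/-- The classes are made fine enough to separate `S` and `S'`, so that both end vectors are corners.
The linear system of a chain needs this for the right-hand sides at its ends and for the constant
sum. -/
theorem IsRanking.typeCounts_extreme (h : IsRanking m ty rank) {S : Finset (Fin n)}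
    (hS : ∀ u v, ty u = ty v → (u ∈ S ↔ v ∈ S)) (i : Fin p) :
    typeCounts ty S i = 0 ∨ typeCounts ty S i = m i := by
  have hc := h.card_filter S i
  by_cases hu : ∃ u ∈ S, ty u = i
  · obtain ⟨u, hu, rfl⟩ := hu
    have : (Finset.univ.filter fun v => ty v = ty u ∧ v ∉ S) = ∅ :=
      Finset.filter_eq_empty_iff.2 fun v _ hv => hv.2 ((hS v u hv.1).2 hu)
    rw [this, Finset.card_empty] at hc
    omega
  · have : (Finset.univ.filter fun v => ty v = i ∧ v ∈ S) = ∅ :=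
      Finset.filter_eq_empty_iff.2 fun v _ hv => hu ⟨v, hv.2, hv.1⟩
    rw [this, Finset.card_empty] at hc
    omega

/-- Evaluation on a core with at most `θ` elements of each class inside and outside of the set. -/
theorem IsRanking.sat_iff_holdsOn (h : IsRanking m ty rank) {G : ColoredGraph n c} {φ : MSO1 c 0 1}
    (hty : IsTyping G φ.usedColors ty) {x : Fin p → ℕ} (hx : ∀ i, x i ≤ m i)
    {K R : Finset (Fin n)}
    (hR : ∀ u, u ∈ R ↔ rank u < x (ty u) ∧ rank u < 2 ^ φ.nodes)
    (hK : ∀ u, u ∈ K ↔ u ∈ R ∨ (x (ty u) ≤ rank u ∧ rank u < x (ty u) + 2 ^ φ.nodes)) :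
    φ.HoldsOn G K Fin.elim0 (fun _ => R) ↔ φ.Sat G (canonSet ty rank fun i => (x i : ℤ)) := by
  unfold MSO1.Sat
  rw [← MSO1.holdsOn_univ]
  refine MSO1.holdsOn_congr hty φ (fun a ha => ha) (cellSimilar_of_card (fun i => ?_) fun i => ?_)
    (fun i => i.elim0) fun i => i.elim0
  · have hxi := hx i
    rw [h.card_interval i (a := 0) (b := min (x i) (2 ^ φ.nodes)) (by omega) fun u => ?_,
      h.card_interval i (a := 0) (b := x i) hxi fun u => ?_]
    · omega
    · simp only [Finset.mem_filter, Finset.mem_univ, true_and, mem_canonSet, Nat.cast_lt,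
        Nat.zero_le]
      exact and_congr_right fun e => by rw [e]
    · simp only [Finset.mem_filter, hK, hR]
      constructor
      · rintro ⟨h1, rfl, h2⟩
        exact ⟨rfl, by omega, by omega⟩
      · rintro ⟨rfl, h1, h2⟩
        exact ⟨by omega, rfl, by omega⟩
  · have hxi := hx i
    rw [h.card_interval i (a := x i) (b := min (m i) (x i + 2 ^ φ.nodes)) (by omega) fun u => ?_,
      h.card_interval i (a := x i) (b := m i) le_rfl fun u => ?_]
    · omega
    · simp only [Finset.mem_filter, Finset.mem_univ, true_and, mem_canonSet, Nat.cast_lt]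
      have := h.lt u
      constructor
      · rintro ⟨rfl, h1⟩
        exact ⟨rfl, by omega, by omega⟩
      · rintro ⟨rfl, h1, h2⟩
        exact ⟨rfl, by omega⟩
    · simp only [Finset.mem_filter, hK, hR]
      have := h.lt u
      constructor
      · rintro ⟨h1, rfl, h2⟩
        exact ⟨rfl, by omega, by omega⟩
      · rintro ⟨rfl, h1, h2⟩
        exact ⟨by omega, rfl, by omega⟩

end Ranking

/-! ### Correctness of the classes -/

theorem List.Nodup.mem_take_drop_iff {l : List ℕ} (h : l.Nodup) {w : ℕ} (hw : w ∈ l) (a k : ℕ) :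
    w ∈ (l.drop a).take k ↔ a ≤ l.idxOf w ∧ l.idxOf w < a + k := by
  have hlt := List.idxOf_lt_length_iff.2 hw
  constructor
  · intro hm
    obtain ⟨j, hj, e⟩ := List.mem_take_iff_getElem.1 hm
    rw [List.getElem_drop] at e
    rw [← e, h.idxOf_getElem]
    omega
  · rintro ⟨h1, h2⟩
    refine List.mem_take_iff_getElem.2 ⟨l.idxOf w - a, ?_, ?_⟩
    · rw [List.length_drop]; omega
    · rw [List.getElem_drop]
      have : a + (l.idxOf w - a) = l.idxOf w := by omega
      simp only [this, List.getElem_idxOf]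

section Classes

variable {n c : ℕ} {G : SimpleGraph (Fin n)} {g labels : List (List Bool)}

/-- Having the same neighbors apart from each other means equal closed neighborhoods if `u` and `v`
are adjacent, and equal open neighborhoods if not. -/
theorem twinB_iff (hn : g.length = n) (hg : ∀ u v : Fin n, adjB g u v = true ↔ G.Adj u v)
    (u v : Fin n) : twinB g u v = true ↔ Twins G u v := by
  have key : twinB g u v = true ↔ ∀ w : Fin n, w ≠ u → w ≠ v → (G.Adj u w ↔ G.Adj v w) := by
    simp only [twinB, List.all_eq_true, List.mem_range, hn, Bool.or_eq_true, beq_iff_eq]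
    constructor
    · intro h w hu hv
      rcases h w w.2 with (h | h) | h
      · exact absurd (Fin.ext h) hu
      · exact absurd (Fin.ext h) hv
      · rw [← hg, ← hg, h]
    · intro h w hw
      by_cases hu : w = u
      · exact .inl (.inl hu)
      · by_cases hv : w = v
        · exact .inl (.inr hv)
        · refine .inr (Bool.eq_iff_iff.2 ?_)
          have h1 := hg u ⟨w, hw⟩
          have h2 := hg v ⟨w, hw⟩
          rw [h1, h2]
          exact h ⟨w, hw⟩ (fun e => hu (congrArg Fin.val e)) fun e => hv (congrArg Fin.val e)
  rw [key]
  have huv := G.adj_comm u v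
  constructor
  · intro h
    by_cases ha : G.Adj u v
    · refine .inr (Set.ext fun w => ?_)
      have := h w
      simp only [Set.mem_insert_iff, SimpleGraph.mem_neighborSet]
      by_cases h1 : w = u
      · subst h1; simp [huv.1 ha]
      · by_cases h2 : w = v
        · subst h2; simp [ha]
        · simp [h1, h2, h w h1 h2]
    · refine .inl (Set.ext fun w => ?_)
      simp only [SimpleGraph.mem_neighborSet]
      by_cases h1 : w = u
      · subst h1; simp [mt huv.2 ha]
      · by_cases h2 : w = v
        · subst h2; simp [ha]
        · exact h w h1 h2
  · rintro (h | h) w h1 h2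
    · have := Set.ext_iff.1 h w
      simpa using this
    · have := Set.ext_iff.1 h w
      simpa [h1, h2] using this

theorem sameType_iff (hn : g.length = n) (hg : ∀ u v : Fin n, adjB g u v = true ↔ G.Adj u v)
    (u v : Fin n) : sameType g labels u v = true ↔
      Twins G u v ∧ ∀ L ∈ labels, bit L u = bit L v := by
  simp [sameType, twinB_iff hn hg]

theorem Twins.symm {u v : Fin n} (h : Twins G u v) : Twins G v u := h.imp Eq.symm Eq.symm

theorem mem_classReps (hn : g.length = n) {u : ℕ} : u ∈ classReps g labels ↔
    u < n ∧ ∀ w < u, sameType g labels w u = false := by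
  simp [classReps, hn]

theorem nodup_classReps : (classReps g labels).Nodup := List.nodup_range.filter _

/-- The lists in `cl` are disjoint and cover all vertices; `ty u` and `rank u` are the list of `u`
and the position of `u` in it. -/
structure IsClassification (cl : List (List ℕ)) (ty : Fin n → Fin cl.length) (rank : Fin n → ℕ) :
    Prop where
  ranking : IsRanking (fun i => (cl.getD i []).length) ty rank
  mem_iff : ∀ (u : Fin n) (i : Fin cl.length), (u : ℕ) ∈ cl.getD i [] ↔ ty u = i
  mem_take_drop : ∀ (u : Fin n) (i : Fin cl.length) (a k : ℕ),
    (u : ℕ) ∈ ((cl.getD i []).drop a).take k ↔ ty u = i ∧ a ≤ rank u ∧ rank u < a + k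
  lt : ∀ i : ℕ, ∀ w ∈ cl.getD i [], w < n
  nodup : ∀ i : ℕ, (cl.getD i []).Nodup

/-- Each class is represented by its least vertex. Transitivity of the twin relation ensures that
every vertex is covered, and together with symmetry that it lies in only one class. -/
theorem exists_isClassification (hn : g.length = n)
    (hg : ∀ u v : Fin n, adjB g u v = true ↔ G.Adj u v)
    {cl : List (List ℕ)} (hcl : cl = vertexClasses g labels) :
    ∃ (ty : Fin n → Fin cl.length) (rank : Fin n → ℕ), IsClassification cl ty rank ∧
      ∀ u v, ty u = ty v → Twins G u v ∧ ∀ L ∈ labels, bit L u = bit L v := by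
  have hlen : cl.length = (classReps g labels).length := by rw [hcl, vertexClasses, List.length_map]
  have hget : ∀ i (hi : i < (classReps g labels).length), cl.getD i [] =
      (List.range n).filter fun u => sameType g labels (classReps g labels)[i] u := by
    intro i hi
    rw [hcl, vertexClasses, List.getD_eq_getElem _ _ (by simpa using hi), List.getElem_map, hn]
  have hlt : ∀ (i : ℕ), ∀ w ∈ cl.getD i [], w < n := by
    intro i w hw
    by_cases hi : i < cl.length
    · rw [hget i (by omega), List.mem_filter, List.mem_range] at hw
      exact hw.1
    · rw [List.getD_eq_default _ _ (by omega)] at hw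
      simp at hw
  have hnd : ∀ i : ℕ, (cl.getD i []).Nodup := by
    intro i
    by_cases hi : i < cl.length
    · rw [hget i (by omega)]
      exact List.nodup_range.filter _
    · rw [List.getD_eq_default _ _ (by omega)]
      exact List.nodup_nil
  have hrep : ∀ i (hi : i < (classReps g labels).length), (classReps g labels)[i] < n :=
    fun i hi => ((mem_classReps hn).1 (List.getElem_mem hi)).1
  have hsame : ∀ i (hi : i < (classReps g labels).length) (u : Fin n), (u : ℕ) ∈ cl.getD i [] ↔
      Twins G ⟨_, hrep i hi⟩ u ∧ ∀ L ∈ labels, bit L (classReps g labels)[i] = bit L u := by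
    intro i hi u
    rw [hget i hi, List.mem_filter, List.mem_range, ← sameType_iff hn hg ⟨_, hrep i hi⟩ u]
    simp
  have hex : ∀ u : Fin n, ∃ i : Fin cl.length, (u : ℕ) ∈ cl.getD i [] := by
    intro u
    have hself : sameType g labels u u = true :=
      (sameType_iff hn hg u u).2 ⟨.inl rfl, fun _ _ => rfl⟩
    obtain ⟨w, ⟨hwu, hw⟩, hmin⟩ := exists_argmin
      (P := fun w : ℕ => w ≤ u ∧ sameType g labels w u = true) ⟨u, le_rfl, hself⟩ id
    have hwn : w < n := by omega
    have hw' := (sameType_iff hn hg ⟨w, hwn⟩ u).1 hw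
    have hmem : w ∈ classReps g labels := by
      refine (mem_classReps hn).2 ⟨hwn, fun v hv => ?_⟩
      by_contra hc
      rw [Bool.not_eq_false] at hc
      have hc' := (sameType_iff hn hg ⟨v, by omega⟩ ⟨w, hwn⟩).1 hc
      have := hmin v ⟨by omega, (sameType_iff hn hg ⟨v, by omega⟩ u).2
        ⟨hc'.1.trans hw'.1, fun L hL => (hc'.2 L hL).trans (hw'.2 L hL)⟩⟩
      simp only [id] at this
      omega
    obtain ⟨i, hi, rfl⟩ := List.getElem_of_mem hmem
    exact ⟨⟨i, by omega⟩, (hsame i hi u).2 hw'⟩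
  have huniq : ∀ (u : Fin n) (i j : Fin cl.length), (u : ℕ) ∈ cl.getD i [] →
      (u : ℕ) ∈ cl.getD j [] → i = j := by
    have aux : ∀ (u : Fin n) (i j : Fin cl.length), (u : ℕ) ∈ cl.getD i [] →
        (u : ℕ) ∈ cl.getD j [] →
        ¬ (classReps g labels)[(i : ℕ)]'(by omega) < (classReps g labels)[(j : ℕ)]'(by omega) := by
      intro u i j hi hj hij
      have h1 := (hsame i (by omega) u).1 hi
      have h2 := (hsame j (by omega) u).1 hj
      have h3 := ((mem_classReps hn).1 (List.getElem_mem (by omega : (j : ℕ) <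
        (classReps g labels).length))).2 _ hij
      have h4 := (sameType_iff (labels := labels) hn hg ⟨_, hrep i (by omega)⟩
        ⟨_, hrep j (by omega)⟩).2
        ⟨h1.1.trans h2.1.symm, fun L hL => (h1.2 L hL).trans (h2.2 L hL).symm⟩
      rw [h3] at h4
      exact absurd h4 (by simp)
    intro u i j hi hj
    have h1 := aux u i j hi hj
    have h2 := aux u j i hj hi
    have h3 := (nodup_classReps (g := g) (labels := labels)).getElem_inj_iff
      (hi := (by omega : (i : ℕ) < (classReps g labels).length))
      (hj := (by omega : (j : ℕ) < (classReps g labels).length))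
    exact Fin.ext (h3.1 (by omega))
  choose ty hty using hex
  have hmem : ∀ (u : Fin n) (i : Fin cl.length), (u : ℕ) ∈ cl.getD i [] ↔ ty u = i :=
    fun u i => ⟨fun h => huniq u _ _ (hty u) h, fun h => h ▸ hty u⟩
  refine ⟨ty, fun u => (cl.getD (ty u) []).idxOf (u : ℕ), ⟨⟨?_, ?_, ?_⟩, hmem, ?_, hlt, hnd⟩, ?_⟩
  · exact fun u => List.idxOf_lt_length_iff.2 (hty u)
  · intro u v huv he
    simp only [huv] at he
    exact Fin.ext ((List.idxOf_inj (huv ▸ hty u)).1 he)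
  · intro i k hk
    refine ⟨⟨(cl.getD i [])[k], hlt i _ (List.getElem_mem hk)⟩, ?_, ?_⟩
    · exact (hmem _ _).1 (List.getElem_mem hk)
    · have : ty ⟨(cl.getD i [])[k], hlt i _ (List.getElem_mem hk)⟩ = i :=
        (hmem _ _).1 (List.getElem_mem hk)
      simp only [this]
      exact (hnd i).idxOf_getElem k hk
  · intro u i a k
    constructor
    · intro h
      have hu := (hmem u i).1 (List.mem_of_mem_drop (List.mem_of_mem_take h))
      subst hu
      exact ⟨rfl, ((hnd _).mem_take_drop_iff (hty u) a k).1 h⟩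
    · rintro ⟨rfl, h⟩
      exact ((hnd _).mem_take_drop_iff (hty u) a k).2 h
  · intro u v huv
    have h1 := (hsame (ty u) (by omega) u).1 (hty u)
    have h2 := (hsame (ty u) (by omega) v).1 (huv ▸ hty v)
    exact ⟨h1.1.symm.trans h2.1, fun L hL => (h1.2 L hL).symm.trans (h2.2 L hL)⟩

/-- The end vertices are exchanged one at a time. The intermediate pair must not be a loop, hence
the case distinctions. -/
theorem isTyping_of_twins {G : ColoredGraph n c} {T : Type} {ty : Fin n → T} {C : List ℕ}
    (htwin : ∀ u v, ty u = ty v → Twins G.graph u v)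
    (hcol : ∀ a : Fin c, (a : ℕ) ∈ C → ∀ u v, ty u = ty v → (u ∈ G.color a ↔ v ∈ G.color a)) :
    IsTyping G C ty where
  adj u v u' v' huv huv' hu hv := by
    have key : ∀ u v w, ty u = ty v → w ≠ u → w ≠ v → (G.graph.Adj u w ↔ G.graph.Adj v w) := by
      intro u v w h h1 h2
      rcases htwin u v h with h | h
      · simpa using Set.ext_iff.1 h w
      · simpa [h1, h2] using Set.ext_iff.1 h w
    have hc := fun a b => G.graph.adj_comm a b
    by_cases h1 : v = u'
    · subst h1
      by_cases h2 : v' = u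
      · subst h2
        exact hc _ _
      · rw [hc u v, key v v' u hv huv (Ne.symm h2), hc v' u,
          key u v v' hu h2 (Ne.symm huv')]
    · rw [key u u' v hu (Ne.symm huv) h1, hc u' v, key v v' u' hv (Ne.symm h1) huv', hc]
  color := hcol

/-- A representative is determined by its twin class and its bits in the labels. -/
theorem length_vertexClasses (hn : g.length = n)
    (hg : ∀ u v : Fin n, adjB g u v = true ↔ G.Adj u v) :
    (vertexClasses g labels).length ≤ neighborhoodDiversity G * 2 ^ labels.length := by
  classical
  have hrep : ∀ i : Fin (classReps g labels).length, (classReps g labels)[(i : ℕ)] < n :=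
    fun i => ((mem_classReps hn).1 (List.getElem_mem i.2)).1
  let f : Fin (classReps g labels).length →
      Quotient (twinSetoid G) × (Fin labels.length → Bool) := fun i =>
    (Quotient.mk (twinSetoid G) ⟨_, hrep i⟩, fun k => bit labels[k] (classReps g labels)[(i : ℕ)])
  have hf : Function.Injective f := by
    have aux : ∀ i j, f i = f j →
        ¬ (classReps g labels)[(i : ℕ)] < (classReps g labels)[(j : ℕ)] := by
      intro i j hij hlt
      have h1 : Twins G ⟨_, hrep i⟩ ⟨_, hrep j⟩ := Quotient.exact (congrArg Prod.fst hij)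
      have h3 := ((mem_classReps hn).1 (List.getElem_mem j.2)).2 _ hlt
      have h4 := (sameType_iff (labels := labels) hn hg ⟨_, hrep i⟩ ⟨_, hrep j⟩).2
        ⟨h1, fun L hL => by
          obtain ⟨k, hk, rfl⟩ := List.getElem_of_mem hL
          exact congrFun (congrArg Prod.snd hij) ⟨k, hk⟩⟩
      rw [h3] at h4
      exact absurd h4 (by simp)
    intro i j hij
    have h1 := aux i j hij
    have h2 := aux j i hij.symm
    have h3 := (nodup_classReps (g := g) (labels := labels)).getElem_inj_iff (hi := i.2) (hj := j.2)
    exact Fin.ext (h3.1 (by omega))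
  have h := Nat.card_le_card_of_injective f hf
  rw [Nat.card_prod, Nat.card_fin, Nat.card_fun, Nat.card_fin] at h
  rw [vertexClasses, List.length_map]
  simpa [neighborhoodDiversity] using h

end Classes

/-! ### Correctness of the algorithm -/

theorem kernelBound_mono {k n : ℕ} (p : ℕ) (h : k ≤ n) : kernelBound k p ≤ kernelBound n p := by
  rcases Nat.eq_zero_or_pos p with rfl | hp
  · simp [kernelBound]
  rcases Nat.eq_zero_or_pos n with rfl | hn
  · obtain rfl : k = 0 := by omega
    exact le_rfl
  unfold kernelBound
  have h1 : 1 ≤ n * p * (n + 2 * (n * p)) := Nat.mul_pos (Nat.mul_pos hn hp) (by omega)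
  calc _ ≤ (n * p * (n + 2 * (n * p))) ^ (k * p) := Nat.pow_le_pow_left (by gcongr) _
    _ ≤ _ := Nat.pow_le_pow_right h1 (by gcongr)

/-- The compressed chain may have fewer vectors than the maximum for which the algorithm computes
its bound. -/
theorem comboBound_mono (θ : ℕ) {k n : ℕ} (p : ℕ) (h : k ≤ n) :
    comboBound θ k p ≤ comboBound θ n p := by
  have := kernelBound_mono p h
  unfold comboBound
  gcongr

theorem sum_mem_sums {B : ℕ} : ∀ {l : List ℕ} (a : Fin l.length → ℕ), (∀ i, a i ≤ B) →
    ∑ i, a i * l[i] ∈ sums B l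
  | [], _, _ => by simp [sums]
  | b :: l, a, h => by
    rw [sums_cons, List.mem_flatMap]
    refine ⟨a ⟨0, by simp⟩, by simpa [Nat.lt_succ_iff] using h _, List.mem_map.2
      ⟨_, sum_mem_sums (l := l) (fun i => a i.succ) fun i => h _, ?_⟩⟩
    exact (Fin.sum_univ_succ (n := l.length) fun i => a i * (b :: l)[i]).symm

/-- The candidates for the coordinates of the vectors. -/
def coordCandidates (B : ℕ) (T ms : List ℕ) : List (List ℕ × List ℕ) :=
  ms.map fun m => ((List.range (m + 1)).filter fun z => isQuot B T z, List.range (m + 1))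

/-- The bounded combinations of `1` and the numbers in a list, as used for `coordCandidates`. -/
def candidateSums (B : ℕ) (ms : List ℕ) : List ℕ := sums B (1 :: ms)

/-- Separating the positive from the negative coefficients gives two sums with natural coefficients
up to `B`, whose difference is `D * z`. The entry `1` in `candidateSums` carries the constant term.
-/
theorem isQuot_of_isRatCombo {cl : List (List ℕ)} {B z : ℕ}
    (h : IsRatCombo (fun i : Fin cl.length => (cl.getD i []).length) B z) :
    isQuot B (candidateSums B (cl.map List.length)) z = true := by
  obtain ⟨D, h1, h2, a, b, ha, hb, he⟩ := h
  have hmem : ∀ (a : Fin cl.length → ℕ) (b : ℕ), (∀ i, a i ≤ B) → b ≤ B →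
      ∑ i, a i * (cl.getD i []).length + b ∈ candidateSums B (cl.map List.length) := by
    intro a b ha hb
    unfold candidateSums
    rw [sums_cons, List.mem_flatMap]
    refine ⟨b, by simp; omega, List.mem_map.2 ⟨_, sum_mem_sums (l := cl.map List.length)
      (fun i => a (i.cast (by simp))) fun i => ha _, ?_⟩⟩
    rw [mul_one, add_comm]
    congr 1
    refine Fintype.sum_equiv (finCongr (by simp)) _ _ fun i => ?_
    have hi : (i : ℕ) < cl.length := by simpa using i.2
    simp [hi]
  refine isQuot_iff.2 ⟨D.toNat, by omega, by omega, _,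
    hmem (fun i => (-(a i)).toNat) (-b).toNat (fun i => ?_) ?_, _,
    hmem (fun i => (a i).toNat) b.toNat (fun i => ?_) ?_, ?_⟩
  · have := abs_le.1 (ha i); omega
  · have := abs_le.1 hb; omega
  · have := abs_le.1 (ha i); omega
  · have := abs_le.1 hb; omega
  · have hsum : ∑ i, a i * ((cl.getD i []).length : ℤ) =
        ∑ i, ((a i).toNat : ℤ) * (cl.getD i []).length -
          ∑ i, ((-(a i)).toNat : ℤ) * (cl.getD i []).length := by
      rw [← Finset.sum_sub_distrib]
      refine Finset.sum_congr rfl fun i _ => ?_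
      rw [← sub_mul]
      congr 1
      omega
    have hD : ((D.toNat : ℕ) : ℤ) = D := by omega
    zify
    rw [hD, he, hsum]
    have : b = (b.toNat : ℤ) - ((-b).toNat : ℤ) := by omega
    linarith

/-! ### Bounds and completeness of the enumerated vectors -/

section Vectors

variable {cl : List (List ℕ)} {B : ℕ} {T : List ℕ}

theorem getD_le_of_mem_sparse {x : List ℕ}
    (hx : x ∈ (sparse (coordCandidates B T (cl.map List.length))).2.2) (i : Fin cl.length) :
    x.getD i 0 ≤ (cl.getD i []).length := by
  obtain ⟨h1, h2⟩ := List.forall₂_iff_get.1 (sparse_forall₂ (.inr (.inr hx)))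
  have hl : (coordCandidates B T (cl.map List.length)).length = cl.length := by
    simp [coordCandidates]
  have h3 := h2 i (by omega) (by omega)
  rw [List.getD_eq_getElem _ _ (by omega), List.getD_eq_getElem _ _ i.2]
  simp only [coordCandidates, List.get_eq_getElem, List.getElem_map, List.mem_filter,
    List.mem_range] at h3
  omega

theorem mem_sparse_of_isQuot {x : Fin cl.length → ℕ} (hx : ∀ i, x i ≤ (cl.getD i []).length)
    {b : Finset (Fin cl.length)} (hb : b.card ≤ 2) (hq : ∀ i ∉ b, isQuot B T (x i) = true) :
    List.ofFn x ∈ (sparse (coordCandidates B T (cl.map List.length))).2.2 := by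
  have hl : (coordCandidates B T (cl.map List.length)).length = cl.length := by
    simp [coordCandidates]
  have hget : ∀ i : Fin cl.length, (coordCandidates B T (cl.map List.length))[(i : ℕ)]'(by omega) =
      ((List.range ((cl.getD i []).length + 1)).filter fun z => isQuot B T z,
        List.range ((cl.getD i []).length + 1)) := by
    intro i
    rw [List.getD_eq_getElem _ _ i.2]
    simp [coordCandidates]
  refine (mem_sparse (List.forall₂_iff_get.2 ⟨by simp [hl], fun i h1 h2 => ?_⟩)).2.2 ?_
  · have h3 := hget ⟨i, by omega⟩
    simp only [List.get_eq_getElem, List.getElem_ofFn] at h3 ⊢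
    rw [h3, List.mem_range]
    have := hx ⟨i, by omega⟩
    simp only at this
    omega
  · have hzip : (List.ofFn x).zip (coordCandidates B T (cl.map List.length)) =
        (List.finRange cl.length).map fun i => (x i,
          ((List.range ((cl.getD i []).length + 1)).filter fun z => isQuot B T z,
            List.range ((cl.getD i []).length + 1))) := by
      refine List.ext_getElem (by simp [hl]) fun i h1 h2 => ?_
      have h3 := hget ⟨i, by simpa using h2⟩
      have hi : i < cl.length := by simpa using h2
      simp only at h3
      simp [h3, hi]
    rw [hzip, List.countP_map, List.countP_eq_length_filter,
      ← List.toFinset_card_of_nodup ((List.nodup_finRange _).filter _)]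
    refine (Finset.card_le_card fun i hi => ?_).trans hb
    by_contra hib
    have h4 := hq i hib
    have h5 := hx i
    rw [List.mem_toFinset, List.mem_filter] at hi
    have h6 := hi.2
    simp only [Function.comp, List.mem_filter, List.mem_range, h4, and_true,
      decide_eq_true_eq] at h6
    omega

end Vectors

/-! ### Bit lists, canonical sets and the test of a vector -/

section Sets

variable {n c : ℕ}

/-- The bits of a set. -/
def setBits (S : Finset (Fin n)) : List Bool := List.ofFn fun u => decide (u ∈ S)

theorem bit_setBits (S : Finset (Fin n)) (u : Fin n) : bit (setBits S) u = decide (u ∈ S) := by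
  simp [bit, setBits, List.getD_eq_getElem?_getD]

theorem enc_setBits (S : Finset (Fin n)) : enc (setBits S) = encodeSet S := by
  simp only [enc, setBits, encodeSet, List.map_ofFn, Function.comp_def]

variable {cl : List (List ℕ)} {ty : Fin n → Fin cl.length} {rank : Fin n → ℕ}

theorem IsClassification.toVec_classCounts (h : IsClassification cl ty rank) (S : Finset (Fin n)) :
    toVec cl.length (classCounts cl (setBits S)) = typeCounts ty S := by
  funext i
  have h1 : (classCounts cl (setBits S)).getD i 0 =
      ((cl.getD i []).filter fun u => bit (setBits S) u).length := by
    rw [List.getD_eq_getElem _ _ (by simp [classCounts]), List.getD_eq_getElem _ _ i.2]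
    simp [classCounts]
  rw [toVec, typeCounts, h1, ← List.toFinset_card_of_nodup ((h.nodup i).filter _)]
  norm_cast
  symm
  refine Finset.card_bij (fun (u : Fin n) _ => (u : ℕ)) (fun u hu => ?_)
    (fun u _ v _ e => Fin.ext e) fun w hw => ?_
  · rw [Finset.mem_filter] at hu
    rw [List.mem_toFinset, List.mem_filter, bit_setBits, decide_eq_true_eq]
    exact ⟨(h.mem_iff u i).2 hu.2, hu.1⟩
  · rw [List.mem_toFinset, List.mem_filter] at hw
    have hwn := h.lt i w hw.1
    have h2 := bit_setBits S ⟨w, hwn⟩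
    simp only at h2
    rw [h2, decide_eq_true_eq] at hw
    exact ⟨⟨w, hwn⟩, Finset.mem_filter.2 ⟨hw.2, (h.mem_iff ⟨w, hwn⟩ i).1 hw.1⟩, rfl⟩

theorem IsClassification.mem_take (h : IsClassification cl ty rank) (u : Fin n)
    (i : Fin cl.length) (k : ℕ) : (u : ℕ) ∈ (cl.getD i []).take k ↔ ty u = i ∧ rank u < k := by
  have := h.mem_take_drop u i 0 k
  rw [List.drop_zero] at this
  rw [this]
  simp

theorem IsClassification.canonBits_eq (h : IsClassification cl ty rank) (x : List ℕ) :
    canonBits n cl x = setBits (canonSet ty rank (toVec cl.length x)) := by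
  refine List.ext_getElem (by simp [canonBits, setBits]) fun u h1 h2 => ?_
  have hu : u < n := by simpa [canonBits] using h1
  refine Bool.eq_iff_iff.2 ?_
  simp only [canonBits, setBits, List.getElem_map, List.getElem_range, List.getElem_ofFn,
    decide_eq_true_eq, List.any_eq_true, List.mem_range, beq_iff_eq,
    exists_eq_right, mem_canonSet, toVec, Nat.cast_lt]
  constructor
  · rintro ⟨i, hi, hm⟩
    obtain ⟨h3, h4⟩ := (h.mem_take ⟨u, hu⟩ ⟨i, hi⟩ _).1 hm
    rw [h3]
    exact h4
  · intro hr
    exact ⟨ty ⟨u, hu⟩, (ty ⟨u, hu⟩).2, (h.mem_take ⟨u, hu⟩ _ _).2 ⟨rfl, hr⟩⟩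

/-- The lists `coreIn` and `coreOut` pick, in each class, the first `θ` ranks below and from `x i`
on. This is the core on which `IsRanking.sat_iff_holdsOn` permits evaluation. -/
theorem IsClassification.allowed_iff (h : IsClassification cl ty rank) {G : ColoredGraph n c}
    {φ : MSO1 c 0 1} (hty : IsTyping G φ.usedColors ty) {g cols : List (List Bool)}
    (hg : ∀ u v : Fin n, adjB g u v = true ↔ G.graph.Adj u v)
    (hcols : ∀ (a : Fin c) (u : Fin n), bit (cols.getD a []) u = true ↔ u ∈ G.color a)
    {x : List ℕ} (hx : ∀ i : Fin cl.length, x.getD i 0 ≤ (cl.getD i []).length) :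
    allowed (⟨φ⟩, g, cols, cl, 2 ^ φ.nodes) x = true ↔
      φ.Sat G (canonSet ty rank (toVec cl.length x)) := by
  set θ := 2 ^ φ.nodes with hθ
  have hin : ∀ u : Fin n, (u : ℕ) ∈ coreIn cl θ x ↔ rank u < x.getD (ty u) 0 ∧ rank u < θ := by
    intro u
    simp only [coreIn, List.mem_flatMap, List.mem_range, List.take_take]
    constructor
    · rintro ⟨i, hi, hm⟩
      obtain ⟨h3, h4⟩ := (h.mem_take u ⟨i, hi⟩ _).1 hm
      rw [h3]
      simp only
      omega
    · intro hr
      exact ⟨ty u, (ty u).2, (h.mem_take u _ _).2 ⟨rfl, by omega⟩⟩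
  have hout : ∀ u : Fin n, (u : ℕ) ∈ coreOut cl θ x ↔
      x.getD (ty u) 0 ≤ rank u ∧ rank u < x.getD (ty u) 0 + θ := by
    intro u
    simp only [coreOut, List.mem_flatMap, List.mem_range]
    constructor
    · rintro ⟨i, hi, hm⟩
      obtain ⟨h3, h4⟩ := (h.mem_take_drop u ⟨i, hi⟩ _ _).1 hm
      rw [h3]
      exact h4
    · intro hr
      exact ⟨ty u, (ty u).2, (h.mem_take_drop u _ _ _).2 ⟨rfl, hr⟩⟩
  have hlt : ∀ k ∈ coreIn cl θ x ++ coreOut cl θ x, k < n := by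
    intro k hk
    simp only [coreIn, coreOut, List.mem_append, List.mem_flatMap] at hk
    rcases hk with ⟨i, -, hk⟩ | ⟨i, -, hk⟩
    · exact h.lt i k (List.mem_of_mem_take (List.mem_of_mem_take hk))
    · exact h.lt i k (List.mem_of_mem_drop (List.mem_of_mem_take hk))
  unfold allowed
  rw [MSO1.evalB_iff (K' := Finset.univ.filter fun u : Fin n =>
      (u : ℕ) ∈ coreIn cl θ x ++ coreOut cl θ x) (x' := Fin.elim0)
    (X' := fun _ => Finset.univ.filter fun u : Fin n => (u : ℕ) ∈ coreIn cl θ x) hg hcols hlt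
    (fun u => by simp) φ (fun i => i.elim0) (fun j u => by
      obtain rfl : j = 0 := Subsingleton.elim _ _
      simp)]
  refine h.ranking.sat_iff_holdsOn hty hx (fun u => ?_) fun u => ?_
  · rw [Finset.mem_filter, hin]
    simp [hθ]
  · rw [Finset.mem_filter, Finset.mem_filter, List.mem_append, hout]
    simp [hθ]

end Sets

/-! ### Fixed-parameter tractable functions -/

section FPT

variable {α β γ : Type} {κ : α → ℕ}

/-- `q` is bounded by a primitive recursive function of the parameter. -/
def ParamBounded (κ q : α → ℕ) : Prop := ∃ f : ℕ → ℕ, Primrec f ∧ ∀ a, q a ≤ f (κ a)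

theorem Primrec.nat_pow_comp {f g : ℕ → ℕ} (hf : Primrec f) (hg : Primrec g) :
    Primrec fun k => f k ^ g k := by
  have h : Primrec (Nat.unpaired fun a b => a ^ b) := Primrec.nat_iff.2 Nat.Primrec.pow
  have h2 : Primrec fun k => Nat.pair (f k) (g k) := Primrec₂.natPair.comp hf hg
  exact (h.comp h2).of_eq fun k => by simp [Nat.unpaired]

namespace ParamBounded

variable {q r : α → ℕ}

theorem mono (hq : ParamBounded κ q) (h : ∀ a, r a ≤ q a) : ParamBounded κ r :=
  let ⟨f, hf, hb⟩ := hq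
  ⟨f, hf, fun a => (h a).trans (hb a)⟩

theorem param : ParamBounded κ κ := ⟨id, Primrec.id, fun _ => le_rfl⟩

theorem const (k : ℕ) : ParamBounded κ fun _ => k := ⟨fun _ => k, Primrec.const k, fun _ => le_rfl⟩

theorem add (hq : ParamBounded κ q) (hr : ParamBounded κ r) : ParamBounded κ fun a => q a + r a :=
  let ⟨f, hf, hb⟩ := hq
  let ⟨f', hf', hb'⟩ := hr
  ⟨fun k => f k + f' k, Primrec.nat_add.comp hf hf', fun a => add_le_add (hb a) (hb' a)⟩

theorem mul (hq : ParamBounded κ q) (hr : ParamBounded κ r) : ParamBounded κ fun a => q a * r a :=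
  let ⟨f, hf, hb⟩ := hq
  let ⟨f', hf', hb'⟩ := hr
  ⟨fun k => f k * f' k, Primrec.nat_mul.comp hf hf', fun a => Nat.mul_le_mul (hb a) (hb' a)⟩

/-- The base `f k + 1` is positive, which makes the power monotone in the exponent. -/
theorem pow (hq : ParamBounded κ q) (hr : ParamBounded κ r) : ParamBounded κ fun a => q a ^ r a :=
  let ⟨f, hf, hb⟩ := hq
  let ⟨f', hf', hb'⟩ := hr
  ⟨fun k => (f k + 1) ^ f' k,
    Primrec.nat_pow_comp (Primrec.nat_add.comp hf (Primrec.const 1)) hf', fun a =>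
      (Nat.pow_le_pow_left ((hb a).trans (Nat.le_succ _)) _).trans
        (Nat.pow_le_pow_right (Nat.succ_pos _) (hb' a))⟩

end ParamBounded

variable [Enc α] [Enc β] [Enc γ]

/-- `q` is bounded by `f (κ a) * |a| ^ d` for a primitive recursive function `f` and a constant
`d`. -/
def FPTBounded (κ q : α → ℕ) : Prop :=
  ∃ (f : ℕ → ℕ) (d : ℕ), Primrec f ∧ ∀ a, q a ≤ f (κ a) * sz a ^ d

namespace FPTBounded

variable {q r : α → ℕ}

theorem mono (hq : FPTBounded κ q) (h : ∀ a, r a ≤ q a) : FPTBounded κ r :=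
  let ⟨f, d, hf, hb⟩ := hq
  ⟨f, d, hf, fun a => (h a).trans (hb a)⟩

theorem of_param (hq : ParamBounded κ q) : FPTBounded κ q :=
  let ⟨f, hf, hb⟩ := hq
  ⟨f, 0, hf, fun a => by simpa using hb a⟩

theorem size : FPTBounded κ sz := ⟨fun _ => 1, 1, Primrec.const 1, fun a => by simp⟩

theorem add (hq : FPTBounded κ q) (hr : FPTBounded κ r) : FPTBounded κ fun a => q a + r a := by
  obtain ⟨f, d, hf, hb⟩ := hq
  obtain ⟨f', d', hf', hb'⟩ := hr
  refine ⟨fun k => f k + f' k, d + d', Primrec.nat_add.comp hf hf', fun a => ?_⟩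
  have h := sz_pos a
  have h1 : sz a ^ d ≤ sz a ^ (d + d') := Nat.pow_le_pow_right h (by omega)
  have h2 : sz a ^ d' ≤ sz a ^ (d + d') := Nat.pow_le_pow_right h (by omega)
  calc _ ≤ _ := add_le_add (hb a) (hb' a)
    _ ≤ f (κ a) * sz a ^ (d + d') + f' (κ a) * sz a ^ (d + d') := by gcongr
    _ = _ := (add_mul _ _ _).symm

theorem pow (hq : FPTBounded κ q) (k : ℕ) : FPTBounded κ fun a => q a ^ k := by
  obtain ⟨f, d, hf, hb⟩ := hq
  refine ⟨fun j => f j ^ k, d * k, Primrec.nat_pow_comp hf (Primrec.const k), fun a => ?_⟩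
  rw [pow_mul, ← mul_pow]
  exact Nat.pow_le_pow_left (hb a) k

theorem polyLE (hq : FPTBounded κ q) (h : PolyLE r q) : FPTBounded κ r := by
  obtain ⟨d, hd⟩ := h
  exact ((hq.add (.of_param (.const 2))).pow d).mono hd

end FPTBounded

/-- `h` is computed in fixed-parameter time. -/
def FPTComputable (κ : α → ℕ) (h : α → β) : Prop := ∃ μ, FPTBounded κ μ ∧ PT μ h

theorem PolyTime.fptComputable {h : α → β} (hh : PolyTime h) : FPTComputable κ h :=
  ⟨sz, .size, hh⟩

namespace FPTComputable

theorem size {h : α → β} (hh : FPTComputable κ h) : FPTBounded κ fun a => sz (h a) :=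
  let ⟨_, hμ, hP⟩ := hh
  hμ.polyLE hP.size

theorem pair {f : α → β} {g : α → γ} (hf : FPTComputable κ f) (hg : FPTComputable κ g) :
    FPTComputable κ fun a => (f a, g a) :=
  let ⟨_, hμ, hP⟩ := hf
  let ⟨_, hμ', hP'⟩ := hg
  ⟨_, hμ.add hμ', (hP.mono (.of_le fun _ => Nat.le_add_right _ _)).pair
    (hP'.mono (.of_le fun _ => Nat.le_add_left _ _))⟩

theorem comp {ν : β → ℕ} {g : β → γ} (hg : PT ν g) {f : α → β} (hf : FPTComputable κ f)
    (hν : FPTBounded κ fun a => ν (f a)) : FPTComputable κ fun a => g (f a) :=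
  let ⟨_, hμ, hP⟩ := hf
  ⟨_, hμ.add hν, hg.comp (hP.mono (.of_le fun _ => Nat.le_add_right _ _))
    (.of_le fun _ => Nat.le_add_left _ _)⟩

theorem comp_polyTime {g : β → γ} (hg : PolyTime g) {f : α → β} (hf : FPTComputable κ f) :
    FPTComputable κ fun a => g (f a) := comp hg hf hf.size

theorem pow {f g : α → ℕ} (hf : FPTComputable κ f) (hg : FPTComputable κ g)
    (hf' : ParamBounded κ f) (hg' : ParamBounded κ g) : FPTComputable κ fun a => f a ^ g a :=
  comp pow_pt (hf.pair hg) ((FPTBounded.of_param ((hf'.add (.const 1)).pow hg')).add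
    (hf.pair hg).size)

theorem fptSolvable {h : α → β} (hh : FPTComputable κ h) {dom : α → Prop} {sol : α → Tree2 → Prop}
    (hsol : ∀ a, dom a → sol a (enc (h a))) : FPTSolvable enc κ dom sol := by
  obtain ⟨μ, hμ, P, d, hP⟩ := hh
  obtain ⟨f, e, hf, hb⟩ := (hμ.add (.of_param (.const 2))).pow d
  refine ⟨P, f, e, hf.to_comp, fun a ha => ?_⟩
  obtain ⟨t, ht, hrun⟩ := (hP a).1
  exact ⟨_, t, hrun, ht.trans (hb a), hsol a ha⟩

end FPTComputable

end FPT

/-! ### The algorithm -/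

/-- The formula, the adjacency matrix, the colors and the two sets of an instance. -/
abbrev RawInstance :=
  AnyFormula × List (List Bool) × List (List Bool) × List Bool × List Bool × Unit

namespace RawInstance

/-- The sets that distinguish vertices: the two given sets and the colors of the formula. -/
def labels (d : RawInstance) : List (List Bool) :=
  d.2.2.2.1 :: d.2.2.2.2.1 :: d.1.φ.usedColors.map fun a => d.2.2.1.getD a []

/-- The classes of vertices. -/
def classes (d : RawInstance) : List (List ℕ) := vertexClasses d.2.1 d.labels

/-- The number of vertices of a class that a formula can count. -/
def threshold (d : RawInstance) : ℕ := 2 ^ d.1.φ.nodes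

/-- A bound for the number of shapes that a shortest walk visits. -/
def chainBound (d : RawInstance) : ℕ := 2 * (2 * d.threshold + 1) ^ d.classes.length

/-- A bound for the coefficients of the coordinates of the candidates. -/
def coeffBound (d : RawInstance) : ℕ := comboBound d.threshold d.chainBound d.classes.length

/-- The candidates for the coordinates of vectors. -/
def coords (d : RawInstance) : List (List ℕ × List ℕ) :=
  coordCandidates d.coeffBound (candidateSums d.coeffBound (d.classes.map List.length))
    (d.classes.map List.length)

/-- The vectors that the search uses. -/
def vectors (d : RawInstance) : List (List ℕ) :=
  (sparse d.coords).2.2.filter (allowed (d.1, d.2.1, d.2.2.1, d.classes, d.threshold))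

/-- Shortest walks between the vectors of the two sets. -/
def walks (d : RawInstance) : List (List (List ℕ)) :=
  search d.classes.length d.vectors (classCounts d.classes d.2.2.2.1)
    (classCounts d.classes d.2.2.2.2.1)

/-- The sequence of sets for a shortest walk. -/
def output (d : RawInstance) : List (List Bool) :=
  (d.walks.headD []).map fun x => canonBits d.2.1.length d.classes x

end RawInstance

namespace MSO1RInstance

noncomputable instance : Enc MSO1RInstance := ⟨encode⟩

open Classical in
/-- The data of an instance in terms of lists. -/
noncomputable def raw (I : MSO1RInstance) : RawInstance :=
  (⟨I.φ⟩, List.ofFn fun u => List.ofFn fun v => decide (I.G.graph.Adj u v),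
    List.ofFn fun a => setBits (I.G.color a), setBits I.S, setBits I.S', ())

/-- An instance and its raw data have the same tree, so no conversion has to be programmed. The
final unit of `RawInstance` is the `nil` that ends the list of the five components. -/
theorem enc_raw (I : MSO1RInstance) : enc I.raw = I.encode := by
  simp only [enc, raw, encode, encodeGraph, encodeSet, setBits, Tree2.ofList, List.map_ofFn,
    Function.comp_def]

theorem raw_polyTime : PolyTime raw := .cast enc_raw

variable (I : MSO1RInstance)

theorem length_rows : I.raw.2.1.length = I.n := by simp [raw]

theorem adjB_rows (u v : Fin I.n) : adjB I.raw.2.1 u v = true ↔ I.G.graph.Adj u v := by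
  simp [adjB, bit, raw, List.getD_eq_getElem?_getD]

theorem bit_colors (a : Fin I.c) (u : Fin I.n) :
    bit (I.raw.2.2.1.getD a []) u = true ↔ u ∈ I.G.color a := by
  have : I.raw.2.2.1.getD a [] = setBits (I.G.color a) := by
    simp [raw, List.getD_eq_getElem?_getD]
  rw [this, bit_setBits, decide_eq_true_eq]

theorem exists_classification : ∃ (ty : Fin I.n → Fin I.raw.classes.length) (rank : Fin I.n → ℕ),
    IsClassification I.raw.classes ty rank ∧ IsTyping I.G I.φ.usedColors ty ∧
    (∀ u v, ty u = ty v → (u ∈ I.S ↔ v ∈ I.S)) ∧ ∀ u v, ty u = ty v → (u ∈ I.S' ↔ v ∈ I.S') := by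
  obtain ⟨ty, rank, h, ht⟩ := exists_isClassification (labels := I.raw.labels) I.length_rows
    I.adjB_rows rfl
  refine ⟨ty, rank, h, isTyping_of_twins (fun u v huv => (ht u v huv).1)
    fun a ha u v huv => ?_, fun u v huv => ?_, fun u v huv => ?_⟩
  · have := (ht u v huv).2 (I.raw.2.2.1.getD a []) (by
      simp only [RawInstance.labels, List.mem_cons, List.mem_map]
      exact .inr (.inr ⟨a, ha, rfl⟩))
    rw [← bit_colors, ← bit_colors, this]
  · have := (ht u v huv).2 (setBits I.S) (by simp [RawInstance.labels, raw])
    rwa [bit_setBits, bit_setBits, decide_eq_decide] at this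
  · have := (ht u v huv).2 (setBits I.S') (by simp [RawInstance.labels, raw])
    rwa [bit_setBits, bit_setBits, decide_eq_decide] at this

/-- A `TJ(φ)`-sequence gives a walk in the list of vectors that is not longer. -/
theorem exists_walk {ty : Fin I.n → Fin I.raw.classes.length} {rank : Fin I.n → ℕ}
    (h : IsClassification I.raw.classes ty rank) (hty : IsTyping I.G I.φ.usedColors ty)
    (hS : ∀ u v, ty u = ty v → (u ∈ I.S ↔ v ∈ I.S))
    (hS' : ∀ u v, ty u = ty v → (u ∈ I.S' ↔ v ∈ I.S')) {L : List (Finset (Fin I.n))}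
    (hL : IsTJSequence I.G I.φ I.S I.S' L) :
    ∃ k, k + 1 ≤ L.length ∧ Walk (VecMem _ I.raw.vectors) k (typeCounts ty I.S)
      (typeCounts ty I.S') := by
  obtain ⟨k, hk, hw⟩ := hL.exists_walk ty
  have hmem : ∀ x, SatVec I.G I.φ ty x → ∀ i, 0 ≤ x i ∧ x i ≤ (I.raw.classes.getD i []).length := by
    rintro x ⟨R, rfl, -⟩ i
    exact h.ranking.typeCounts_mem R i
  obtain ⟨k', hk', hw'⟩ := Walk.exists_restricted
    (fun x y hx hs => h.ranking.satVec_congr hty hx hs) hmem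
    (h.ranking.typeCounts_extreme hS) (h.ranking.typeCounts_extreme hS') hw
    (B := I.raw.coeffBound) fun k hk => comboBound_mono _ _ hk
  refine ⟨k', by omega, hw'.imp fun x hx => ?_⟩
  obtain ⟨hx, b, hb, hq⟩ := hx
  have hxm := hmem x hx
  have hvec : toVec I.raw.classes.length (List.ofFn fun i => (x i).toNat) = x := by
    funext i
    have := hxm i
    simp [toVec, List.getD_eq_getElem?_getD]
    omega
  have hle : ∀ i, (x i).toNat ≤ (I.raw.classes.getD i []).length := fun i => by
    have := hxm i
    omega
  have hsp : List.ofFn (fun i => (x i).toNat) ∈ (sparse I.raw.coords).2.2 := by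
    refine mem_sparse_of_isQuot hle hb fun i hi => isQuot_of_isRatCombo ?_
    have := hxm i
    have h3 := hq i hi
    rwa [← Int.toNat_of_nonneg this.1] at h3
  refine ⟨_, List.mem_filter.2 ⟨hsp, (h.allowed_iff hty I.adjB_rows I.bit_colors
    (getD_le_of_mem_sparse hsp)).2 ?_⟩, hvec⟩
  rw [hvec]
  obtain ⟨R, rfl, hR⟩ := hx
  -- The canonical set need not be the model `R`, but it has the same vector.
  refine (h.ranking.sat_congr hty fun i => .inl ?_).1 hR
  rw [h.ranking.typeCounts_canonSet hxm]

/-- A walk in the list of vectors gives a `TJ(φ)`-sequence. -/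
theorem isTJSequence_of_isVecWalk {ty : Fin I.n → Fin I.raw.classes.length} {rank : Fin I.n → ℕ}
    (h : IsClassification I.raw.classes ty rank) (hty : IsTyping I.G I.φ.usedColors ty)
    (hS : ∀ u v, ty u = ty v → (u ∈ I.S ↔ v ∈ I.S))
    (hS' : ∀ u v, ty u = ty v → (u ∈ I.S' ↔ v ∈ I.S')) {P : List (List ℕ)}
    (hP : IsVecWalk _ I.raw.vectors (typeCounts ty I.S') P)
    (hhead : toVec _ (P.headD []) = typeCounts ty I.S) :
    IsTJSequence I.G I.φ I.S I.S' (P.map fun x => canonSet ty rank (toVec _ x)) := by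
  have hle : ∀ x ∈ I.raw.vectors, ∀ i : Fin I.raw.classes.length,
      x.getD i 0 ≤ (I.raw.classes.getD i []).length :=
    fun x hx => getD_le_of_mem_sparse (List.mem_filter.1 hx).1
  have hle' : ∀ x ∈ I.raw.vectors, ∀ i : Fin I.raw.classes.length,
      0 ≤ toVec I.raw.classes.length x i ∧
        toVec I.raw.classes.length x i ≤ (I.raw.classes.getD i []).length := fun x hx i => by
    have := hle x hx i
    unfold toVec
    omega
  refine ⟨?_, ?_, (List.isChain_map _).2 (List.IsChain.imp_of_mem_imp (fun x y hx hy hxy => ?_)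
    hP.chain), fun R hR => ?_⟩
  · obtain ⟨q, P', rfl⟩ := hP.exists_cons
    simp only [List.headD_cons] at hhead
    simp only [List.map_cons, List.head?_cons, hhead, h.ranking.canonSet_typeCounts hS]
  · obtain ⟨q, hq, he⟩ := hP.last
    simp only [List.getLast?_map, hq, Option.map_some, he, h.ranking.canonSet_typeCounts hS']
  · exact h.ranking.tjMove (hle' x (hP.mem x hx)) (hle' y (hP.mem y hy)) hxy
  · obtain ⟨x, hx, rfl⟩ := List.mem_map.1 hR
    have hx' := hP.mem x hx
    exact (h.allowed_iff hty I.adjB_rows I.bit_colors (hle x hx')).1 (List.mem_filter.1 hx').2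

/-- The program does not test validity: jumps preserve the cardinality, so the existence of a
sequence implies it. -/
theorem valid_of_isTJSequence {L : List (Finset (Fin I.n))}
    (hL : IsTJSequence I.G I.φ I.S I.S' L) : I.Valid := by
  obtain ⟨h1, h2, h3, h4⟩ := hL
  refine ⟨?_, h4 _ (List.mem_of_mem_head? (by simp [h1])), h4 _ (List.mem_of_getLast? h2)⟩
  have aux : ∀ (L : List (Finset (Fin I.n))) (R : Finset (Fin I.n)), L.head? = some R →
      L.getLast? = some I.S' → L.IsChain TJMove → R.card = I.S'.card := by
    intro L
    induction L with
    | nil => simp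
    | cons R L ih =>
      intro R₀ h1 h2 h3
      obtain rfl : R = R₀ := by simpa using h1
      cases L with
      | nil =>
        obtain rfl : R = I.S' := by simpa using h2
        rfl
      | cons R' L =>
        rw [List.isChain_cons_cons] at h3
        rw [h3.1.card_eq]
        exact ih R' rfl (by simpa using h2) h3.2
  exact aux L _ h1 h2 h3

theorem walks_ne_nil (hI : I.IsYes) : I.raw.walks ≠ [] := by
  obtain ⟨ty, rank, h, hty, hS, hS'⟩ := I.exists_classification
  obtain ⟨-, L, hL⟩ := hI
  obtain ⟨k, -, hw⟩ := I.exists_walk h hty hS hS' hL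
  rw [← h.toVec_classCounts, ← h.toVec_classCounts] at hw
  exact search_ne_nil hw

/-- The walk found is shortest only among the walks in the enumerated vectors. It is optimal among
all sequences because each of them yields such a walk that is not longer. -/
theorem isShortestSolution_output (hI : I.raw.walks ≠ []) :
    I.IsShortestSolution (enc I.raw.output) := by
  obtain ⟨ty, rank, h, hty, hS, hS'⟩ := I.exists_classification
  obtain ⟨P, l, hPl⟩ := List.exists_cons_of_ne_nil hI
  have hP := search_sound (p := I.raw.classes.length) (P := P) (by
    show P ∈ I.raw.walks
    rw [hPl]
    simp)
  have e : I.raw.2.2.2.1 = setBits I.S := rfl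
  have e' : I.raw.2.2.2.2.1 = setBits I.S' := rfl
  rw [e, e', h.toVec_classCounts, h.toVec_classCounts] at hP
  obtain ⟨h1, h2, h3⟩ := hP
  refine ⟨_, ⟨I.isTJSequence_of_isVecWalk h hty hS hS' h1 h2, fun L hL => ?_⟩, ?_⟩
  · obtain ⟨k, hk, hw⟩ := I.exists_walk h hty hS hS' hL
    rw [List.length_map]
    exact (h3 k hw).trans hk
  · unfold RawInstance.output encodeSeq
    rw [hPl, List.headD_cons]
    simp only [I.length_rows, h.canonBits_eq, List.map_map]
    show Tree2.ofList (List.map enc _) = _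
    rw [List.map_map]
    refine congrArg _ (List.map_congr_left fun x _ => ?_)
    exact enc_setBits _

theorem isYes_iff : I.IsYes ↔ I.raw.walks ≠ [] := by
  refine ⟨I.walks_ne_nil, fun h => ?_⟩
  obtain ⟨L, hL, -⟩ := I.isShortestSolution_output h
  exact ⟨I.valid_of_isTJSequence hL.1, L, hL.1⟩

end MSO1RInstance

/-! ### The running time of the algorithm -/

namespace MSO1RInstance

theorem formula_polyTime : PolyTime fun I => (raw I).1 :=
  PolyTime.comp (g := fun d : RawInstance => d.1) (by fun_prop) raw_polyTime

theorem classes_polyTime : PolyTime fun I => (raw I).classes :=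
  PolyTime.comp (g := fun d : RawInstance => d.classes)
    (by unfold RawInstance.classes RawInstance.labels; fun_prop) raw_polyTime

theorem sizes_polyTime : PolyTime fun I => (raw I).classes.map List.length :=
  PolyTime.comp (g := fun l : List (List ℕ) => l.map List.length) (by fun_prop) classes_polyTime

theorem nodes_paramBounded : ParamBounded param fun I => (raw I).1.φ.nodes :=
  ParamBounded.param.mono fun I => I.φ.nodes_le_length.trans (Nat.le_add_left _ _)

/-- The labels are the two given sets and the colors that occur in the formula. With all `c` colors
as labels, this bound would depend on `c`. -/
theorem classes_paramBounded : ParamBounded param fun I => (raw I).classes.length := by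
  refine (ParamBounded.param.mul ((ParamBounded.const 2).pow
    (ParamBounded.param.add (.const 2)))).mono fun I => ?_
  refine (length_vertexClasses I.length_rows I.adjB_rows).trans ?_
  refine Nat.mul_le_mul (Nat.le_add_right _ _) (Nat.pow_le_pow_right (by omega) ?_)
  have h1 := I.φ.length_usedColors
  have h2 := I.φ.nodes_le_length
  have h3 : I.φ.length ≤ I.param := Nat.le_add_left _ _
  show (I.φ.usedColors.map _).length + 1 + 1 ≤ _
  rw [List.length_map]
  omega

theorem threshold_paramBounded : ParamBounded param fun I => (raw I).threshold :=
  (ParamBounded.const 2).pow nodes_paramBounded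

theorem threshold_fptComputable : FPTComputable param fun I => (raw I).threshold :=
  (PolyTime.fptComputable (by fun_prop)).pow
    (PolyTime.comp (g := fun a : AnyFormula => a.φ.nodes) (by fun_prop)
      formula_polyTime).fptComputable (.const 2) nodes_paramBounded

theorem numClasses_fptComputable : FPTComputable param fun I => (raw I).classes.length :=
  (PolyTime.comp (g := fun l : List (List ℕ) => l.length) (by fun_prop)
    classes_polyTime).fptComputable

theorem chainBound_paramBounded : ParamBounded param fun I => (raw I).chainBound :=
  (ParamBounded.const 2).mul ((((ParamBounded.const 2).mul threshold_paramBounded).add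
    (.const 1)).pow classes_paramBounded)

theorem chainBound_fptComputable : FPTComputable param fun I => (raw I).chainBound := by
  have h1 : FPTComputable param fun I => 2 * (raw I).threshold + 1 :=
    FPTComputable.comp_polyTime (g := fun t : ℕ => 2 * t + 1) (by fun_prop) threshold_fptComputable
  exact FPTComputable.comp_polyTime (g := fun t : ℕ => 2 * t) (by fun_prop)
    (h1.pow numClasses_fptComputable
      (((ParamBounded.const 2).mul threshold_paramBounded).add (.const 1)) classes_paramBounded)

theorem kernelBound_paramBounded :
    ParamBounded param fun I => kernelBound (raw I).chainBound (raw I).classes.length := by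
  have h1 := chainBound_paramBounded.mul classes_paramBounded
  exact (h1.mul (chainBound_paramBounded.add ((ParamBounded.const 2).mul h1))).pow h1

theorem kernelBound_fptComputable :
    FPTComputable param fun I => kernelBound (raw I).chainBound (raw I).classes.length := by
  have h := chainBound_fptComputable.pair numClasses_fptComputable
  have h1 := chainBound_paramBounded.mul classes_paramBounded
  exact FPTComputable.pow
    (FPTComputable.comp_polyTime (g := fun z : ℕ × ℕ => z.1 * z.2 * (z.1 + 2 * (z.1 * z.2)))
      (by fun_prop) h)
    (FPTComputable.comp_polyTime (g := fun z : ℕ × ℕ => z.1 * z.2) (by fun_prop) h)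
    (h1.mul (chainBound_paramBounded.add ((ParamBounded.const 2).mul h1))) h1

theorem coeffBound_paramBounded : ParamBounded param fun I => (raw I).coeffBound := by
  have h1 := chainBound_paramBounded.mul classes_paramBounded
  have h2 := kernelBound_paramBounded
  exact (((chainBound_paramBounded.add ((ParamBounded.const 2).mul h1)).mul (h1.mul h2)).mul
    ((threshold_paramBounded.add ((ParamBounded.const 2).mul h2)).add (.const 1))).add h2

theorem coeffBound_fptComputable : FPTComputable param fun I => (raw I).coeffBound := by
  have h := FPTComputable.comp_polyTime (g := fun z : ((ℕ × ℕ) × ℕ) × ℕ =>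
    (z.1.1.1 + 2 * (z.1.1.1 * z.1.1.2)) * (z.1.1.1 * z.1.1.2 * z.2) * (z.1.2 + 2 * z.2 + 1) + z.2)
    (by fun_prop)
    (((chainBound_fptComputable.pair numClasses_fptComputable).pair threshold_fptComputable).pair
      kernelBound_fptComputable)
  exact h

theorem candidateSums_paramBounded : ParamBounded param fun I =>
    (candidateSums (raw I).coeffBound ((raw I).classes.map List.length)).length :=
  ((coeffBound_paramBounded.add (.const 1)).pow (classes_paramBounded.add (.const 1))).mono
    fun I => by simp [candidateSums, length_sums]

theorem candidateSums_fptComputable : FPTComputable param fun I =>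
    candidateSums (raw I).coeffBound ((raw I).classes.map List.length) := by
  have h : FPTComputable param fun I =>
      ((raw I).coeffBound, 1 :: (raw I).classes.map List.length) :=
    coeffBound_fptComputable.pair (FPTComputable.comp_polyTime
      (g := fun l : List ℕ => 1 :: l) (by fun_prop) sizes_polyTime.fptComputable)
  have h2 : FPTBounded param fun I => ((raw I).coeffBound + 1) ^
      (1 :: (raw I).classes.map List.length).length :=
    .of_param (((coeffBound_paramBounded.add (.const 1)).pow
      (classes_paramBounded.add (.const 1))).mono fun I => by simp)
  have h3 := FPTComputable.comp sums_pt h (h2.add h.size)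
  exact h3

theorem coords_fptComputable : FPTComputable param fun I => (raw I).coords := by
  have h := FPTComputable.comp_polyTime
    (g := fun z : (ℕ × List ℕ) × List ℕ => coordCandidates z.1.1 z.1.2 z.2)
    (by unfold coordCandidates isQuot; fun_prop)
    ((coeffBound_fptComputable.pair candidateSums_fptComputable).pair sizes_polyTime.fptComputable)
  exact h

theorem prod_coords_le (d : RawInstance) :
    (d.coords.map fun w => w.1.length + 1).prod ≤ ((d.coeffBound + 1) *
      ((candidateSums d.coeffBound (d.classes.map List.length)).length *
        (candidateSums d.coeffBound (d.classes.map List.length)).length) + 1) ^ d.classes.length := by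
  refine (List.prod_le_pow_card _ ((d.coeffBound + 1) *
    ((candidateSums d.coeffBound (d.classes.map List.length)).length *
      (candidateSums d.coeffBound (d.classes.map List.length)).length) + 1) fun a ha => ?_).trans
    (le_of_eq ?_)
  · simp only [RawInstance.coords, coordCandidates, List.map_map, List.mem_map] at ha
    obtain ⟨c, -, rfl⟩ := ha
    exact Nat.add_le_add_right (length_filter_isQuot _ _ _) 1
  · simp [RawInstance.coords, coordCandidates]

/-- The candidates for the regular coordinates contribute a factor that is bounded in the parameter;
the two arbitrary coordinates cost only a polynomial factor, which is part of `sparse_pt`. -/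
theorem sparse_fptComputable : FPTComputable param fun I => sparse (raw I).coords := by
  have h : ParamBounded param fun I => ((raw I).coords.map fun w => w.1.length + 1).prod :=
    (((((coeffBound_paramBounded.add (.const 1)).mul
      (candidateSums_paramBounded.mul candidateSums_paramBounded)).add (.const 1))).pow
      classes_paramBounded).mono fun I => prod_coords_le _
  have h2 := FPTComputable.comp sparse_pt coords_fptComputable
    ((FPTBounded.of_param h).add coords_fptComputable.size)
  exact h2

theorem vectors_fptComputable : FPTComputable param fun I => (raw I).vectors := by
  have h := (raw_polyTime.fptComputable (κ := param)).pair
    (classes_polyTime.fptComputable.pair threshold_fptComputable)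
  have h1 := FPTComputable.comp_polyTime (g := fun z : RawInstance × List (List ℕ) × ℕ =>
    ((z.1.1, z.1.2.1, z.1.2.2.1, z.2) : TestData)) (by fun_prop) h
  have h2 := h1.pair (FPTComputable.comp_polyTime
    (g := fun e : List (List ℕ) × List (List ℕ) × List (List ℕ) => e.2.2) (by fun_prop)
    sparse_fptComputable)
  have h3 := (ParamBounded.const (κ := param) 2).mul (classes_paramBounded.mul threshold_paramBounded)
  have h4 := ((h3.add ((ParamBounded.const 2).pow h3)).add (.const 2)).pow nodes_paramBounded
  have h5 := FPTComputable.comp filter_allowed_pt h2 ((FPTBounded.of_param h4).add h2.size)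
  exact h5

theorem walks_fptComputable : FPTComputable param fun I => (raw I).walks := by
  have h := FPTComputable.comp_polyTime
    (g := fun z : (RawInstance × List (List ℕ)) × List (List ℕ) =>
      search z.1.2.length z.2 (classCounts z.1.2 z.1.1.2.2.2.1)
        (classCounts z.1.2 z.1.1.2.2.2.2.1)) (by fun_prop)
    ((raw_polyTime.fptComputable.pair classes_polyTime.fptComputable).pair vectors_fptComputable)
  exact h

theorem output_fptComputable : FPTComputable param fun I => (raw I).output := by
  have h := FPTComputable.comp_polyTime
    (g := fun z : (RawInstance × List (List ℕ)) × List (List (List ℕ)) =>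
      (z.2.headD []).map fun x => canonBits z.1.1.2.1.length z.1.2 x) (by fun_prop)
    ((raw_polyTime.fptComputable.pair classes_polyTime.fptComputable).pair walks_fptComputable)
  exact h

end MSO1RInstance

theorem theorem3p1 :
    FPTDecidable MSO1RInstance.encode MSO1RInstance.param MSO1RInstance.IsYes ∧
      FPTSolvable MSO1RInstance.encode MSO1RInstance.param MSO1RInstance.IsYes
        MSO1RInstance.IsShortestSolution := by
  classical
  constructor
  · have h : FPTComputable MSO1RInstance.param fun I => !(MSO1RInstance.raw I).walks.isEmpty :=
      FPTComputable.comp_polyTime (g := fun l : List (List (List ℕ)) => !l.isEmpty) (by fun_prop)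
        MSO1RInstance.walks_fptComputable
    refine h.fptSolvable fun I _ => congrArg Tree2.ofBool (Bool.eq_iff_iff.2 ?_)
    refine Iff.trans ?_ (I.isYes_iff.symm.trans decide_eq_true_iff.symm)
    simp
  · exact MSO1RInstance.output_fptComputable.fptSolvable
      fun I hI => I.isShortestSolution_output (I.walks_ne_nil hI)
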